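/- Let $\Omega\subset\mathbb{R}^2$ be a bounded domain of class $C^2$ (near each boundary point, in suitable Cartesian coordinates, $\Omega$ is the set above the graph of a $C^2$ function) and let $w\in H^3(\Omega)$. Let $n=(n_1,n_2)$ be the outer unit normal on $\partial\Omega$, let $\tau=(\tau_1,\tau_2)=(-n_2,n_1)$ be the unit tangent obtained by rotating $n$ counterclockwise by $\pi/2$, and let $s$ be the arclength on $\partial\Omega$, oriented by $\tau$; a subscript $,_s$ denotes the derivative with respect to $s$. The fields $n$ and $\tau$ are well defined and differentiable in $s$ at every point of $\partial\Omega$. The following functions in $L^2(\partial\Omega)$ exist: the traces on $\partial\Omega$ of $w$ and of its weak Cartesian derivatives $w_{,\alpha}$, $w_{,\alpha\beta}$ ($\alpha,\beta=1,2$); the first and second weak derivatives $w_{,s}$, $w_{,ss}$ of the trace of $w$ with respect to $s$; the normal derivatives $w_{,n}$ and $w_{,nn}$ on $\partial\Omega$, that is, the extensions by continuity from $C^\infty(\overline\Omega)$ to $H^2(\Omega)$ and $H^3(\Omega)$, respectively, with values in $L^2(\partial\Omega)$, of $v\mapsto \frac{d}{dz}v(P+z\,n(P))|_{z=0}$ and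 $v\mapsto \frac{d^2}{dz^2}v(P+z\,n(P))|_{z=0}$, $P\in\partial\Omega$; and the weak derivative $w_{,sn}$ of $w_{,n}$ with respect to $s$. For all $\alpha,\beta\in\{1,2\}$ they satisfy, almost everywhere on $\partial\Omega$ with respect to arclength, $$w_{,\beta}=w_{,n}\,n_\beta+w_{,s}\,\tau_\beta,$$ $$w_{,\alpha\beta}=w_{,ss}\,\tau_\alpha\tau_\beta+w_{,nn}\,n_\alpha n_\beta+w_{,sn}(\tau_\alpha n_\beta+\tau_\beta n_\alpha)+w_{,s}(\tau_\alpha\tau_{\beta,s}-n_\alpha n_{\beta,s})+w_{,n}\,\tau_\alpha n_{\beta,s},$$ $$w_{,\alpha\beta}=w_{,ss}\,\tau_\alpha\tau_\beta+w_{,nn}\,n_\alpha n_\beta+w_{,sn}(\tau_\alpha n_\beta+\tau_\beta n_\alpha)+w_{,s}(\tau_\beta\tau_{\alpha,s}-n_\beta n_{\alpha,s})+w_{,n}\,\tau_\beta n_{\alpha,s}.$$ -/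

import Mathlib

open MeasureTheory Set Filter Topology
open scoped ContDiff

noncomputable section

/-- The Euclidean plane `ℝ²`; the coordinates `x₁, x₂` are `x 0, x 1`. -/
abbrev Plane : Type := EuclideanSpace ℝ (Fin 2)

/-! ### Domains of class `C²`, outer normal, tangent, arclength -/

/-- A bounded domain (open, connected, non-empty) of class `C²`: near each boundary point `P` there
is a rigid change of coordinates `A` with `A P = 0`, under which the part of `Ω` in a rectangle
centred at `P` is the part of the rectangle above the graph of a `C²` function `g` with
`g 0 = g' 0 = 0`. -/
structure IsC2Domain (Ω : Set Plane) : Prop where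
  isOpen : IsOpen Ω
  isConnected : IsConnected Ω
  isBounded : Bornology.IsBounded Ω
  exists_graph : ∀ P ∈ frontier Ω, ∃ (A : Plane ≃ᵃⁱ[ℝ] Plane) (r h : ℝ) (g : ℝ → ℝ),
    0 < r ∧ 0 < h ∧ ContDiff ℝ 2 g ∧ g 0 = 0 ∧ deriv g 0 = 0 ∧ A P = 0 ∧
    ∀ x : Plane, |A x 0| < r → |A x 1| < h → (x ∈ Ω ↔ g (A x 0) < A x 1)

/-- `ν` is the outer unit normal to `Ω` at `P`: near `P` one has `Ω = {ρ < 0}` with a `C¹`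
function `ρ` vanishing at `P`, whose gradient at `P` is a positive multiple of the unit
vector `ν`. -/
def IsOuterUnitNormal (Ω : Set Plane) (P ν : Plane) : Prop :=
  ‖ν‖ = 1 ∧ ∃ ρ : Plane → ℝ, ContDiff ℝ 1 ρ ∧ ρ P = 0 ∧ (∀ᶠ x in 𝓝 P, (x ∈ Ω ↔ ρ x < 0)) ∧
    ∃ c : ℝ, 0 < c ∧ HasGradientAt ρ (c • ν) P

open Classical in
/-- The outer unit normal field `n` on `∂Ω` (the value is `0` where there is no such normal). -/
def outerNormal (Ω : Set Plane) (P : Plane) : Plane :=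
  if h : ∃ ν, IsOuterUnitNormal Ω P ν then h.choose else 0

/-- The unit tangent field `τ = e₃ × n`: the counterclockwise rotation of `n` by `π / 2`. -/
def tangent (Ω : Set Plane) (P : Plane) : Plane :=
  !₂[-(outerNormal Ω P 1), outerNormal Ω P 0]

/-- `ψ` restricted to `(a, b)` is a (positively oriented) arclength parametrization of an arc of
`∂Ω`: it takes values in `∂Ω` and `ψ' = τ ∘ ψ`. -/
def IsArc (Ω : Set Plane) (a b : ℝ) (ψ : ℝ → Plane) : Prop :=
  ∀ s ∈ Ioo a b, ψ s ∈ frontier Ω ∧ HasDerivAt ψ (tangent Ω (ψ s)) s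

/-- The function `f` on `∂Ω` has at `P ∈ ∂Ω` the classical derivative `d` with respect to the
arclength: there is an arclength parametrization of an arc of `∂Ω` through `P`, and along every
one the derivative of `f` at `P` exists and equals `d`. -/
def HasArcDerivAt (Ω : Set Plane) (f : Plane → ℝ) (d : ℝ) (P : Plane) : Prop :=
  (∃ (a b : ℝ) (ψ : ℝ → Plane), (0 : ℝ) ∈ Ioo a b ∧ IsArc Ω a b ψ ∧ ψ 0 = P) ∧
  ∀ (a b : ℝ) (ψ : ℝ → Plane), (0 : ℝ) ∈ Ioo a b → IsArc Ω a b ψ → ψ 0 = P →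
    HasDerivAt (fun s => f (ψ s)) d 0

open Classical in
/-- The classical arclength derivative `f,ₛ` of a function on `∂Ω` (`0` if there is none). -/
def arcDeriv (Ω : Set Plane) (f : Plane → ℝ) (P : Plane) : ℝ :=
  if h : ∃ d, HasArcDerivAt Ω f d P then h.choose else 0

/-- The arclength measure on `∂Ω`, i.e. the one-dimensional Hausdorff measure. -/
def arcMeasure (Ω : Set Plane) : Measure Plane := (μH[1]).restrict (frontier Ω)

/-- `h ∈ L²(∂Ω)` is the weak derivative of `g ∈ L²(∂Ω)` with respect to the arclength. -/
def HasWeakArcDeriv (Ω : Set Plane) (g h : Plane → ℝ) : Prop :=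
  MemLp g 2 (arcMeasure Ω) ∧ MemLp h 2 (arcMeasure Ω) ∧
  ∀ (a b : ℝ) (ψ : ℝ → Plane), IsArc Ω a b ψ →
    ∀ η : ℝ → ℝ, ContDiff ℝ ∞ η → HasCompactSupport η → tsupport η ⊆ Ioo a b →
      ∫ s in Ioo a b, g (ψ s) * deriv η s = - ∫ s in Ioo a b, h (ψ s) * η s

/-! ### Sobolev spaces -/

/-- Classical partial derivatives of higher order: `iterPartial [i₁, …, iₘ] f = ∂_{i₁} ⋯ ∂_{iₘ} f`.
-/
def iterPartial : List (Fin 2) → (Plane → ℝ) → Plane → ℝ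
  | [], f => f
  | i :: l, f => fun x => fderiv ℝ (iterPartial l f) x (EuclideanSpace.single i 1)

/-- `v` is the weak partial derivative `∂_{i₁} ⋯ ∂_{iₘ} u` in `Ω`, where `l = [i₁, …, iₘ]`. -/
def HasWeakDeriv (Ω : Set Plane) (l : List (Fin 2)) (u v : Plane → ℝ) : Prop :=
  LocallyIntegrableOn u Ω volume ∧ LocallyIntegrableOn v Ω volume ∧
  ∀ φ : Plane → ℝ, ContDiff ℝ ∞ φ → HasCompactSupport φ → tsupport φ ⊆ Ω →
    ∫ x in Ω, u x * iterPartial l φ x = (-1) ^ l.length * ∫ x in Ω, v x * φ x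

/-- `u ∈ Hᵏ(Ω)`: all weak derivatives of order at most `k` exist and are in `L²(Ω)`. -/
def MemSobolev (Ω : Set Plane) (k : ℕ) (u : Plane → ℝ) : Prop :=
  ∀ l : List (Fin 2), l.length ≤ k →
    ∃ v, HasWeakDeriv Ω l u v ∧ MemLp v 2 (volume.restrict Ω)

/-- The `vⱼ` are smooth up to the boundary (restrictions of functions in `C^∞(ℝ²)`) and converge
to `u` in `Hᵏ(Ω)`. -/
def SmoothApprox (Ω : Set Plane) (k : ℕ) (v : ℕ → Plane → ℝ) (u : Plane → ℝ) : Prop :=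
  (∀ j, ContDiff ℝ ∞ (v j)) ∧
  ∀ l : List (Fin 2), l.length ≤ k → ∃ d, HasWeakDeriv Ω l u d ∧
    MemLp d 2 (volume.restrict Ω) ∧
    Tendsto (fun j => eLpNorm (fun x => iterPartial l (v j) x - d x) 2 (volume.restrict Ω))
      atTop (𝓝 0)

/-! ### Boundary values -/

/-- `g ∈ L²(∂Ω)` is the value at `u ∈ Hᵏ(Ω)` of the extension by continuity, from `Hᵏ(Ω)` to
`L²(∂Ω)`, of the boundary operator `B`, which is given on functions smooth up to the boundary. That
is: `u` is the limit in `Hᵏ(Ω)` of some sequence of such functions, and for every such sequence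
`vⱼ → u` one has `B vⱼ → g` in `L²(∂Ω)`. -/
def IsExtendedValue (Ω : Set Plane) (k : ℕ) (B : (Plane → ℝ) → Plane → ℝ)
    (u g : Plane → ℝ) : Prop :=
  MemLp g 2 (arcMeasure Ω) ∧
  (∃ v, SmoothApprox Ω k v u) ∧
  ∀ v, SmoothApprox Ω k v u →
    Tendsto (fun j => eLpNorm (fun P => B (v j) P - g P) 2 (arcMeasure Ω)) atTop (𝓝 0)

/-- `g` is the trace on `∂Ω` of `u ∈ H¹(Ω)`. -/
def IsTrace (Ω : Set Plane) (u g : Plane → ℝ) : Prop :=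
  IsExtendedValue Ω 1 (fun v => v) u g

/-- `g` is the normal derivative of order `m` on `∂Ω` of `u ∈ H^{m+1}(Ω)`: for smooth functions it
is the `m`-th derivative with respect to the shift `z` along the outer unit normal. -/
def IsNormalDeriv (Ω : Set Plane) (m : ℕ) (u g : Plane → ℝ) : Prop :=
  IsExtendedValue Ω (m + 1)
    (fun v P => iteratedDeriv m (fun z : ℝ => v (P + z • outerNormal Ω P)) 0) u g

/-- Functions on `∂Ω` meant to be the boundary values `w`, `w,_β` (`cart`), `w,_{αβ}` (`cart2`),
`w,ₛ`, `w,ₙ`, `w,ₛₛ`, `w,ₛₙ`, `w,ₙₙ`. -/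
structure BoundaryFunctions where
  val : Plane → ℝ
  cart : Fin 2 → Plane → ℝ
  cart2 : Fin 2 → Fin 2 → Plane → ℝ
  s : Plane → ℝ
  n : Plane → ℝ
  ss : Plane → ℝ
  sn : Plane → ℝ
  nn : Plane → ℝ

/-- `J` consists of the boundary values of `w` and of its Cartesian and local derivatives. The
Cartesian ones are the traces of the weak derivatives of `w`; `w,ₛ` and `w,ₛₛ` are the first and
second weak derivatives of the trace of `w` with respect to the arclength, `w,ₛₙ` is the weak
derivative of `w,ₙ` with respect to the arclength. -/
structure IsBoundaryDerivatives (Ω : Set Plane) (w : Plane → ℝ) (J : BoundaryFunctions) :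
    Prop where
  val : IsTrace Ω w J.val
  cart : ∀ β, ∃ d, HasWeakDeriv Ω [β] w d ∧ IsTrace Ω d (J.cart β)
  cart2 : ∀ α β, ∃ d, HasWeakDeriv Ω [α, β] w d ∧ IsTrace Ω d (J.cart2 α β)
  s : HasWeakArcDeriv Ω J.val J.s
  n : IsNormalDeriv Ω 1 w J.n
  ss : HasWeakArcDeriv Ω J.s J.ss
  sn : HasWeakArcDeriv Ω J.n J.sn
  nn : IsNormalDeriv Ω 2 w J.nn

end

/-! ### Convergence in `L²` -/

/-! For a function smooth up to the boundary the formulas are the chain rule together with the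
Frenet equations, so the work lies in giving every boundary value a meaning for `w` and in passing
to the limit.

Three analytic facts carry this. Functions smooth up to the boundary are dense in the Sobolev space
(`IsC2Domain.exists_smoothApprox`): near a boundary point, mollification with kernels displaced so
that they see only points of `Ω`, then a partition of unity. The trace inequality
(`IsC2Domain.exists_eLpNorm_arcMeasure_le`) bounds the boundary norm of a smooth function by its
`H¹` norm. Hence all Cartesian derivatives of order at most two of an approximating sequence
converge in `L²(∂Ω)`, to limits independent of the sequence (`SmoothApprox.exists_traces`). Finally,
the frame and its arclength derivatives are continuous on the compact boundary, because the
arclength charts are `C²`; multiplying by them preserves `L²` convergence.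

Along an arc, a smooth function times a frame component is `C¹`, so it can be integrated by parts
against a test function. In the limit this exhibits the arclength derivatives as explicit
combinations of Cartesian traces (`hasWeakArcDeriv_mul`); normal derivatives are treated by the
chain rule. The resulting candidates are collected in `frameBoundaryFunctions`.

For these candidates the claim is pointwise algebra (`frameBoundaryFunctions_formulas`): it uses
`|τ| = 1`, the Frenet equations `τ,ₛ = -κ n` and `n,ₛ = κ τ`, and symmetry of the second traces.
Uniqueness of each boundary value (`IsBoundaryDerivatives.ae_eq`) transfers the result to any
admissible `J`. -/

theorem eLpNorm_two_le_add {X : Type*} [MeasurableSpace X] {μ : Measure X} {f g h : X → ℝ}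
    (hg : MemLp g 2 μ) (hh : MemLp h 2 μ) (hf : ∀ x, f x = g x + h x) :
    eLpNorm f 2 μ ≤ eLpNorm g 2 μ + eLpNorm h 2 μ := by
  have : f = g + h := funext hf
  rw [this]
  exact eLpNorm_add_le hg.1 hh.1 one_le_two

theorem eLpNorm_two_le_add_of_sub {X : Type*} [MeasurableSpace X] {μ : Measure X} {f g h : X → ℝ}
    (hg : MemLp g 2 μ) (hh : MemLp h 2 μ) (hf : ∀ x, f x = g x - h x) :
    eLpNorm f 2 μ ≤ eLpNorm g 2 μ + eLpNorm h 2 μ := by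
  have : f = g - h := funext hf
  rw [this]
  exact eLpNorm_sub_le hg.1 hh.1 one_le_two

/-- The functions `f j` and `g` are in `L²(μ)`, and `f j → g` in `L²(μ)`. -/
structure L2Tendsto {X : Type*} [MeasurableSpace X] (μ : Measure X) (f : ℕ → X → ℝ) (g : X → ℝ) :
    Prop where
  memLp : ∀ j, MemLp (f j) 2 μ
  memLp_lim : MemLp g 2 μ
  tendsto : Tendsto (fun j => eLpNorm (fun x => f j x - g x) 2 μ) atTop (𝓝 0)

namespace L2Tendsto

variable {X : Type*} [MeasurableSpace X] {μ ν : Measure X} {f f' : ℕ → X → ℝ} {g g' : X → ℝ}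

/-- Used both to restrict convergence to a subset and to carry it from `∂Ω` to parameter intervals,
where the push-forward of Lebesgue measure is dominated by arclength. -/
theorem mono_measure (h : L2Tendsto μ f g) {C : ENNReal} (hC : C ≠ ⊤) (hν : ν ≤ C • μ) :
    L2Tendsto ν f g := by
  refine ⟨fun j => (h.memLp j).of_measure_le_smul hC hν, h.memLp_lim.of_measure_le_smul hC hν, ?_⟩
  have h2 : Tendsto (fun j => C ^ (1 / (2 : ENNReal).toReal) *
      eLpNorm (fun x => f j x - g x) 2 μ) atTop (𝓝 0) := by
    have := ENNReal.Tendsto.const_mul (a := C ^ (1 / (2 : ENNReal).toReal)) h.tendsto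
      (Or.inr (ENNReal.rpow_ne_top_of_nonneg (by positivity) hC))
    simpa using this
  refine tendsto_of_tendsto_of_tendsto_of_le_of_le tendsto_const_nhds h2 (fun _ => zero_le) ?_
  intro j
  refine (eLpNorm_mono_measure _ hν).trans ?_
  rw [eLpNorm_smul_measure_of_ne_top (by simp)]
  simp

theorem congr_right (h : L2Tendsto μ f g) (hg : g =ᵐ[μ] g') : L2Tendsto μ f g' := by
  refine ⟨h.memLp, h.memLp_lim.ae_eq hg, h.tendsto.congr fun j => eLpNorm_congr_ae ?_⟩
  filter_upwards [hg] with x hx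
  rw [hx]

theorem congr_left (h : L2Tendsto μ f g) (hf : ∀ j, f j =ᵐ[μ] f' j) : L2Tendsto μ f' g := by
  refine ⟨fun j => (h.memLp j).ae_eq (hf j), h.memLp_lim,
    h.tendsto.congr fun j => eLpNorm_congr_ae ?_⟩
  filter_upwards [hf j] with x hx
  rw [hx]

theorem add (h : L2Tendsto μ f g) (h' : L2Tendsto μ f' g') :
    L2Tendsto μ (fun j x => f j x + f' j x) (fun x => g x + g' x) := by
  refine ⟨fun j => (h.memLp j).add (h'.memLp j), h.memLp_lim.add h'.memLp_lim, ?_⟩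
  have h2 := h.tendsto.add h'.tendsto
  rw [add_zero] at h2
  refine tendsto_of_tendsto_of_tendsto_of_le_of_le tendsto_const_nhds h2 (fun _ => zero_le) ?_
  intro j
  exact eLpNorm_two_le_add ((h.memLp j).sub h.memLp_lim) ((h'.memLp j).sub h'.memLp_lim)
    fun x => by ring

theorem zero : L2Tendsto μ (fun _ _ => 0) (fun _ => 0) :=
  ⟨fun _ => MemLp.zero', MemLp.zero', by simp⟩

theorem sum {ι : Type*} (s : Finset ι) {F : ι → ℕ → X → ℝ} {G : ι → X → ℝ}
    (h : ∀ i ∈ s, L2Tendsto μ (F i) (G i)) :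
    L2Tendsto μ (fun j x => ∑ i ∈ s, F i j x) (fun x => ∑ i ∈ s, G i x) := by
  classical
  induction s using Finset.induction_on with
  | empty => simpa using zero
  | insert a s ha ih =>
    simp only [Finset.sum_insert ha]
    exact (h a (by simp)).add (ih fun i hi => h i (by simp [hi]))

theorem mul_bounded (h : L2Tendsto μ f g) {c : X → ℝ} (hc : AEStronglyMeasurable c μ) {C : ℝ}
    (hC : ∀ᵐ x ∂μ, ‖c x‖ ≤ C) : L2Tendsto μ (fun j x => f j x * c x) (fun x => g x * c x) := by
  have hc' : MemLp c ⊤ μ := memLp_top_of_bound hc C hC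
  refine ⟨fun j => hc'.mul (h.memLp j), hc'.mul h.memLp_lim, ?_⟩
  have h2 : Tendsto (fun j => ENNReal.ofReal C * eLpNorm (fun x => f j x - g x) 2 μ)
      atTop (𝓝 0) := by
    have := ENNReal.Tendsto.const_mul (a := ENNReal.ofReal C) h.tendsto
      (Or.inr ENNReal.ofReal_ne_top)
    simpa using this
  refine tendsto_of_tendsto_of_tendsto_of_le_of_le tendsto_const_nhds h2 (fun _ => zero_le) ?_
  intro j
  refine eLpNorm_le_mul_eLpNorm_of_ae_le_mul ?_ _
  filter_upwards [hC] with x hx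
  rw [← sub_mul, norm_mul, mul_comm]
  gcongr

theorem unique (h : L2Tendsto μ f g) (h' : L2Tendsto μ f g') : g =ᵐ[μ] g' := by
  have h2 := h.tendsto.add h'.tendsto
  rw [add_zero] at h2
  have h3 : eLpNorm (g - g') 2 μ ≤ 0 := by
    refine ge_of_tendsto h2 (Eventually.of_forall fun j => ?_)
    rw [add_comm]
    exact eLpNorm_two_le_add_of_sub ((h'.memLp j).sub h'.memLp_lim) ((h.memLp j).sub h.memLp_lim)
      fun x => by simp
  rw [nonpos_iff_eq_zero, eLpNorm_eq_zero_iff (h.memLp_lim.sub h'.memLp_lim).1 (by norm_num)] at h3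
  filter_upwards [h3] with x hx
  simpa [sub_eq_zero] using hx

/-- Cauchy–Schwarz bounds the `L¹` norm of `(f j - g) c`. This is how identities tested against a
fixed function survive the limit. -/
theorem tendsto_integral_mul (h : L2Tendsto μ f g) {c : X → ℝ} (hc : MemLp c 2 μ) :
    Tendsto (fun j => ∫ x, f j x * c x ∂μ) atTop (𝓝 (∫ x, g x * c x ∂μ)) := by
  refine tendsto_integral_of_L1' _ (h.memLp_lim.integrable_mul hc).1
    (Eventually.of_forall fun j => (h.memLp j).integrable_mul hc) ?_
  have h2 : Tendsto (fun j => eLpNorm (fun x => f j x - g x) 2 μ * eLpNorm c 2 μ)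
      atTop (𝓝 0) := by
    have := ENNReal.Tendsto.mul_const (b := eLpNorm c 2 μ) h.tendsto (Or.inr hc.2.ne)
    simpa using this
  refine tendsto_of_tendsto_of_tendsto_of_le_of_le tendsto_const_nhds h2 (fun _ => zero_le) ?_
  intro j
  have h3 : ((fun x => f j x * c x) - fun x => g x * c x) =
      (fun x => f j x - g x) • c := by
    ext x
    simp [sub_mul]
  have h4 : MemLp (fun x => f j x - g x) 2 μ := (h.memLp j).sub h.memLp_lim
  change eLpNorm ((fun x => f j x * c x) - fun x => g x * c x) 1 μ ≤ _
  rw [h3]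
  exact eLpNorm_smul_le_mul_eLpNorm hc.1 h4.1

theorem tendsto_sub (h : L2Tendsto μ f g) (h' : L2Tendsto μ f' g) :
    Tendsto (fun j => eLpNorm (fun x => f j x - f' j x) 2 μ) atTop (𝓝 0) := by
  have h2 := h.tendsto.add h'.tendsto
  rw [add_zero] at h2
  refine tendsto_of_tendsto_of_tendsto_of_le_of_le tendsto_const_nhds h2 (fun _ => zero_le) ?_
  intro j
  exact eLpNorm_two_le_add_of_sub ((h.memLp j).sub h.memLp_lim) ((h'.memLp j).sub h'.memLp_lim)
    fun x => by ring

theorem of_tendsto_sub (h : L2Tendsto μ f g) (hf' : ∀ j, MemLp (f' j) 2 μ)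
    (h' : Tendsto (fun j => eLpNorm (fun x => f' j x - f j x) 2 μ) atTop (𝓝 0)) :
    L2Tendsto μ f' g := by
  have h2 := h'.add h.tendsto
  rw [add_zero] at h2
  refine ⟨hf', h.memLp_lim, ?_⟩
  refine tendsto_of_tendsto_of_tendsto_of_le_of_le tendsto_const_nhds h2 (fun _ => zero_le) ?_
  intro j
  exact eLpNorm_two_le_add ((hf' j).sub (h.memLp j)) ((h.memLp j).sub h.memLp_lim)
    fun x => by ring

end L2Tendsto

/-- Completeness of `L²`: a sequence with `‖f i - f j‖ ≤ b i + b j` and `b → 0` converges. -/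
theorem exists_l2Tendsto_of_cauchy {X : Type*} [MeasurableSpace X] {μ : Measure X}
    {f : ℕ → X → ℝ} (hf : ∀ j, MemLp (f j) 2 μ) {b : ℕ → ENNReal} (hb : Tendsto b atTop (𝓝 0))
    (h : ∀ i j, eLpNorm (fun x => f i x - f j x) 2 μ ≤ b i + b j) :
    ∃ g, L2Tendsto μ f g := by
  have hc : CauchySeq fun j => (hf j).toLp (f j) := by
    rw [EMetric.cauchySeq_iff]
    intro ε hε
    have h2 : ∀ᶠ j in atTop, b j < ε / 2 := hb.eventually (gt_mem_nhds (by simpa using hε.ne'))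
    obtain ⟨N, hN⟩ := eventually_atTop.1 h2
    refine ⟨N, fun m hm n hn => ?_⟩
    rw [Lp.edist_toLp_toLp]
    calc eLpNorm (f m - f n) 2 μ ≤ b m + b n := h m n
      _ < ε / 2 + ε / 2 := ENNReal.add_lt_add (hN m hm) (hN n hn)
      _ = ε := ENNReal.add_halves ε
  obtain ⟨g, hg⟩ := cauchySeq_tendsto_of_complete hc
  refine ⟨g, hf, Lp.memLp g, ?_⟩
  have := (Lp.tendsto_Lp_iff_tendsto_eLpNorm'' f hf g (Lp.memLp g)).1 (by simpa using hg)
  exact this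

/-! ### Iterated partial derivatives -/

theorem contDiff_iterPartial {f : Plane → ℝ} (hf : ContDiff ℝ ∞ f) (l : List (Fin 2)) :
    ContDiff ℝ ∞ (iterPartial l f) := by
  induction l with
  | nil => exact hf
  | cons i l ih => exact (ih.fderiv_right (m := ∞) (by simp)).clm_apply contDiff_const

theorem iterPartial_append (l m : List (Fin 2)) (f : Plane → ℝ) :
    iterPartial (l ++ m) f = iterPartial l (iterPartial m f) := by
  induction l with
  | nil => rfl
  | cons i l ih => simp only [List.cons_append, iterPartial, ih]

theorem differentiable_iterPartial {f : Plane → ℝ} (hf : ContDiff ℝ ∞ f) (l : List (Fin 2)) :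
    Differentiable ℝ (iterPartial l f) :=
  (contDiff_iterPartial hf l).differentiable (by simp)

theorem iterPartial_add {f g : Plane → ℝ} (hf : ContDiff ℝ ∞ f) (hg : ContDiff ℝ ∞ g)
    (l : List (Fin 2)) :
    iterPartial l (fun x => f x + g x) = fun x => iterPartial l f x + iterPartial l g x := by
  induction l with
  | nil => rfl
  | cons i l ih =>
    simp only [iterPartial, ih]
    ext x
    rw [fderiv_fun_add (differentiable_iterPartial hf l x) (differentiable_iterPartial hg l x)]
    rfl

theorem iterPartial_sub {f g : Plane → ℝ} (hf : ContDiff ℝ ∞ f) (hg : ContDiff ℝ ∞ g)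
    (l : List (Fin 2)) :
    iterPartial l (fun x => f x - g x) = fun x => iterPartial l f x - iterPartial l g x := by
  induction l with
  | nil => rfl
  | cons i l ih =>
    simp only [iterPartial, ih]
    ext x
    rw [fderiv_fun_sub (differentiable_iterPartial hf l x) (differentiable_iterPartial hg l x)]
    rfl

theorem iterPartial_zero (l : List (Fin 2)) : iterPartial l (fun _ => 0) = fun _ => 0 := by
  induction l with
  | nil => rfl
  | cons i l ih => simp [iterPartial, ih]

theorem iterPartial_sum {ι : Type*} (s : Finset ι) {f : ι → Plane → ℝ}
    (hf : ∀ i, ContDiff ℝ ∞ (f i)) (l : List (Fin 2)) :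
    iterPartial l (fun x => ∑ i ∈ s, f i x) = fun x => ∑ i ∈ s, iterPartial l (f i) x := by
  classical
  induction s using Finset.induction_on with
  | empty => simpa using iterPartial_zero l
  | insert a s ha ih =>
    simp only [Finset.sum_insert ha]
    rw [iterPartial_add (hf a) (ContDiff.sum fun i _ => hf i), ih]

/-- Schwarz's theorem. Besides reordering derivatives, it yields the equality of the two mixed
second traces. -/
theorem iterPartial_single_comm {f : Plane → ℝ} (hf : ContDiff ℝ ∞ f) (i j : Fin 2) :
    iterPartial [i, j] f = iterPartial [j, i] f := by
  ext x
  have h2 : DifferentiableAt ℝ (fderiv ℝ f) x :=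
    ((hf.fderiv_right (m := ∞) (by simp)).differentiable (by simp)) x
  have key : ∀ a b : Fin 2, iterPartial [a, b] f x =
      fderiv ℝ (fderiv ℝ f) x (EuclideanSpace.single a 1) (EuclideanSpace.single b 1) := by
    intro a b
    simp only [iterPartial]
    rw [fderiv_clm_apply h2 (differentiableAt_const _)]
    simp
  rw [key, key]
  have hs : IsSymmSndFDerivAt ℝ f x :=
    hf.contDiffAt.isSymmSndFDerivAt (by simpa using ENat.LEInfty.out)
  exact hs _ _

theorem iterPartial_cons_comm {f : Plane → ℝ} (hf : ContDiff ℝ ∞ f) (i : Fin 2)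
    (l : List (Fin 2)) : iterPartial (i :: l) f = iterPartial (l ++ [i]) f := by
  induction l generalizing f with
  | nil => rfl
  | cons j l ih =>
    have h1 : iterPartial (i :: j :: l) f = iterPartial [i, j] (iterPartial l f) := rfl
    rw [h1, iterPartial_single_comm (contDiff_iterPartial hf l)]
    change iterPartial [j] (iterPartial (i :: l) f) = _
    rw [ih hf, List.cons_append]
    rfl

/-- A weak derivative along `l ++ m` is tested against `∂_l ∂_m φ`, whereas moving the two blocks
over successively produces `∂_m ∂_l φ`. -/
theorem iterPartial_append_comm {f : Plane → ℝ} (hf : ContDiff ℝ ∞ f) (l m : List (Fin 2)) :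
    iterPartial (l ++ m) f = iterPartial (m ++ l) f := by
  induction l generalizing f with
  | nil => simp
  | cons i l ih =>
    rw [List.cons_append, iterPartial_cons_comm hf, iterPartial_append,
      ih (contDiff_iterPartial hf [i]), iterPartial_append m, iterPartial_append m,
      ← iterPartial_append l, ← iterPartial_cons_comm hf]

theorem tsupport_iterPartial_subset (l : List (Fin 2)) (f : Plane → ℝ) :
    tsupport (iterPartial l f) ⊆ tsupport f := by
  induction l with
  | nil => rfl
  | cons i l ih =>
    refine Subset.trans ?_ ((tsupport_fderiv_subset ℝ (f := iterPartial l f)).trans ih)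
    refine closure_mono fun x hx hx' => hx ?_
    simp [iterPartial, hx']

theorem hasCompactSupport_iterPartial {f : Plane → ℝ} (hf : HasCompactSupport f)
    (l : List (Fin 2)) : HasCompactSupport (iterPartial l f) :=
  hf.of_isClosed_subset (isClosed_tsupport _) (tsupport_iterPartial_subset l f)

/-- Integration by parts for smooth functions. -/
theorem integral_mul_iterPartial {v φ : Plane → ℝ} (hv : ContDiff ℝ ∞ v) (hφ : ContDiff ℝ ∞ φ)
    (hc : HasCompactSupport φ) (l : List (Fin 2)) :
    ∫ x, v x * iterPartial l φ x = (-1) ^ l.length * ∫ x, iterPartial l v x * φ x := by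
  induction l generalizing v with
  | nil => simp [iterPartial]
  | cons i l ih =>
    have hl := contDiff_iterPartial hφ l
    have hlc := hasCompactSupport_iterPartial hc l
    have h1 : ∫ x, v x * iterPartial (i :: l) φ x =
        - ∫ x, iterPartial [i] v x * iterPartial l φ x := by
      have e1 : Continuous (iterPartial [i] v) := (contDiff_iterPartial hv [i]).continuous
      have e2 : Continuous (iterPartial (i :: l) φ) := (contDiff_iterPartial hφ (i :: l)).continuous
      refine integral_mul_fderiv_eq_neg_fderiv_mul_of_integrable ?_ ?_ ?_
        (fun x _ => hv.differentiable (by simp) x) (fun x _ => hl.differentiable (by simp) x)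
      · exact (e1.mul hl.continuous).integrable_of_hasCompactSupport hlc.mul_left
      · exact (hv.continuous.mul e2).integrable_of_hasCompactSupport
          (hasCompactSupport_iterPartial hc (i :: l)).mul_left
      · exact (hv.continuous.mul hl.continuous).integrable_of_hasCompactSupport hlc.mul_left
    rw [h1, ih (contDiff_iterPartial hv [i]), ← iterPartial_append, ← iterPartial_cons_comm hv,
      List.length_cons, pow_succ]
    ring

/-! ### Weak derivatives -/

theorem setIntegral_mul_iterPartial {Ω : Set Plane} {v φ : Plane → ℝ} (hv : ContDiff ℝ ∞ v)
    (hφ : ContDiff ℝ ∞ φ) (hc : HasCompactSupport φ) (hs : tsupport φ ⊆ Ω) (l : List (Fin 2)) :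
    ∫ x in Ω, v x * iterPartial l φ x = (-1) ^ l.length * ∫ x in Ω, iterPartial l v x * φ x := by
  rw [setIntegral_eq_integral_of_forall_compl_eq_zero, integral_mul_iterPartial hv hφ hc,
    setIntegral_eq_integral_of_forall_compl_eq_zero]
  · intro x hx
    rw [image_eq_zero_of_notMem_tsupport (fun h => hx (hs h)), mul_zero]
  · intro x hx
    rw [image_eq_zero_of_notMem_tsupport
      (fun h => hx (hs (tsupport_iterPartial_subset l φ h))), mul_zero]

theorem MeasureTheory.MemLp.locallyIntegrableOn_of_restrict {Ω : Set Plane} {u : Plane → ℝ}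
    (hu : MemLp u 2 (volume.restrict Ω)) : LocallyIntegrableOn u Ω volume :=
  locallyIntegrableOn_of_locallyIntegrable_restrict (hu.locallyIntegrable one_le_two)

/-- The fundamental lemma of the calculus of variations, applied to `v - v'` on the open set `Ω`. -/
theorem HasWeakDeriv.ae_eq {Ω : Set Plane} (hΩ : IsOpen Ω) {l : List (Fin 2)}
    {u v v' : Plane → ℝ} (h : HasWeakDeriv Ω l u v) (h' : HasWeakDeriv Ω l u v') :
    v =ᵐ[volume.restrict Ω] v' := by
  have key := hΩ.ae_eq_zero_of_integral_contDiff_smul_eq_zero (μ := volume)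
    (f := fun x => v x - v' x) (h.2.1.sub h'.2.1) ?_
  · rw [Filter.EventuallyEq, ae_restrict_iff' hΩ.measurableSet]
    filter_upwards [key] with x hx hxΩ
    exact sub_eq_zero.1 (hx hxΩ)
  intro φ hφ hc hs
  have e1 := (h.2.2 φ hφ hc hs).symm.trans (h'.2.2 φ hφ hc hs)
  have e2 : ∫ x in Ω, v x * φ x = ∫ x in Ω, v' x * φ x :=
    mul_left_cancel₀ (pow_ne_zero _ (by norm_num)) e1
  have hint : ∀ f : Plane → ℝ, LocallyIntegrableOn f Ω volume →
      Integrable (fun x => f x * φ x) (volume.restrict Ω) := by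
    intro f hf
    have h1 : IntegrableOn (fun x => f x * φ x) (tsupport φ) volume :=
      (hf.integrableOn_compact_subset hs hc).mul_continuousOn hφ.continuous.continuousOn hc
    have h2 : Integrable (fun x => f x * φ x) volume := by
      rw [← integrableOn_iff_integrable_of_support_subset (s := tsupport φ)]
      · exact h1
      · exact (Function.support_mul_subset_right _ _).trans (subset_tsupport _)
    exact h2.restrict
  rw [← setIntegral_eq_integral_of_forall_compl_eq_zero (s := Ω)]
  · have e3 : ∀ x, φ x • (v x - v' x) = v x * φ x - v' x * φ x := by
      intro x; simp only [smul_eq_mul]; ring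
    simp_rw [e3]
    rw [integral_sub (hint v h.2.1) (hint v' h'.2.1), e2, sub_self]
  · intro x hx
    rw [image_eq_zero_of_notMem_tsupport (fun h => hx (hs h)), zero_smul]

/-- Both sides of the integration by parts formula for `v j` converge, since test functions and
their derivatives are in `L²`. -/
theorem hasWeakDeriv_of_l2Tendsto {Ω : Set Plane} {l : List (Fin 2)} {v : ℕ → Plane → ℝ}
    {w d : Plane → ℝ} (hv : ∀ j, ContDiff ℝ ∞ (v j)) (hw : L2Tendsto (volume.restrict Ω) v w)
    (hd : L2Tendsto (volume.restrict Ω) (fun j => iterPartial l (v j)) d) :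
    HasWeakDeriv Ω l w d := by
  refine ⟨hw.memLp_lim.locallyIntegrableOn_of_restrict, hd.memLp_lim.locallyIntegrableOn_of_restrict,
    fun φ hφ hc hs => ?_⟩
  have hm : ∀ m : List (Fin 2), MemLp (iterPartial m φ) 2 (volume.restrict Ω) := fun m =>
    ((contDiff_iterPartial hφ m).continuous.memLp_of_hasCompactSupport
      (hasCompactSupport_iterPartial hc m)).restrict _
  have h1 := hw.tendsto_integral_mul (hm l)
  have h2 := (hd.tendsto_integral_mul (hm [])).const_mul ((-1 : ℝ) ^ l.length)
  refine tendsto_nhds_unique h1 (h2.congr fun j => ?_)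
  exact (setIntegral_mul_iterPartial (hv j) hφ hc hs l).symm

/-- Only convergence of the classical derivatives has to be checked: weak derivatives are closed
under `L²` limits, which identifies the limits. -/
theorem SmoothApprox.of_l2Tendsto {Ω : Set Plane} {k : ℕ} {v : ℕ → Plane → ℝ} {w : Plane → ℝ}
    (hv : ∀ j, ContDiff ℝ ∞ (v j)) (hw : L2Tendsto (volume.restrict Ω) v w)
    (h : ∀ l : List (Fin 2), l.length ≤ k →
      ∃ d, L2Tendsto (volume.restrict Ω) (fun j => iterPartial l (v j)) d) :
    SmoothApprox Ω k v w := by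
  refine ⟨hv, fun l hl => ?_⟩
  obtain ⟨d, hd⟩ := h l hl
  exact ⟨d, hasWeakDeriv_of_l2Tendsto hv hw hd, hd.memLp_lim, hd.tendsto⟩

theorem SmoothApprox.mono {Ω : Set Plane} {k m : ℕ} (hkm : m ≤ k) {v : ℕ → Plane → ℝ}
    {w : Plane → ℝ} (h : SmoothApprox Ω k v w) : SmoothApprox Ω m v w :=
  ⟨h.1, fun l hl => h.2 l (hl.trans hkm)⟩

/-- The definition of `d` is tested with `∂_l φ`, again an admissible test function. -/
theorem HasWeakDeriv.of_append {Ω : Set Plane} {l m : List (Fin 2)} {u d e : Plane → ℝ}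
    (hd : HasWeakDeriv Ω m u d) (he : HasWeakDeriv Ω (l ++ m) u e) : HasWeakDeriv Ω l d e := by
  refine ⟨hd.2.1, he.2.1, fun φ hφ hc hs => ?_⟩
  have h1 := hd.2.2 _ (contDiff_iterPartial hφ l) (hasCompactSupport_iterPartial hc l)
    ((tsupport_iterPartial_subset l φ).trans hs)
  have h2 := he.2.2 φ hφ hc hs
  have h3 : iterPartial (l ++ m) φ = iterPartial m (iterPartial l φ) := by
    rw [iterPartial_append_comm hφ, iterPartial_append]
  rw [h3, h1, List.length_append, pow_add, mul_comm ((-1 : ℝ) ^ l.length), mul_assoc] at h2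
  exact mul_left_cancel₀ (pow_ne_zero _ (by norm_num)) h2

/-- This makes the `H¹` trace theory available for the weak derivatives of `w`. -/
theorem SmoothApprox.of_hasWeakDeriv {Ω : Set Plane} {k : ℕ} {v : ℕ → Plane → ℝ} {w d : Plane → ℝ}
    {m : List (Fin 2)} (h : SmoothApprox Ω (k + m.length) v w) (hd : HasWeakDeriv Ω m w d) :
    SmoothApprox Ω k (fun j => iterPartial m (v j)) d := by
  refine ⟨fun j => contDiff_iterPartial (h.1 j) m, fun l hl => ?_⟩
  obtain ⟨e, he, he2, he3⟩ := h.2 (l ++ m) (by rw [List.length_append]; omega)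
  refine ⟨e, hd.of_append he, he2, ?_⟩
  simpa only [iterPartial_append] using he3

/-! ### Boundary graphs -/

/-- The coordinate of `x` along the unit vector `a`, with origin `P`. -/
def coordT (P a x : Plane) : ℝ := a 0 * (x 0 - P 0) + a 1 * (x 1 - P 1)

/-- The coordinate of `x` along the counterclockwise rotation of the unit vector `a`, with
origin `P`. -/
def coordN (P a x : Plane) : ℝ := -(a 1) * (x 0 - P 0) + a 0 * (x 1 - P 1)

/-- The point with coordinates `(t, y)` in the frame with origin `P` and first vector `a`. -/
def framePoint (P a : Plane) (t y : ℝ) : Plane :=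
  !₂[P 0 + t * a 0 - y * a 1, P 1 + t * a 1 + y * a 0]

theorem coordT_framePoint {P a : Plane} (ha : a 0 ^ 2 + a 1 ^ 2 = 1) (t y : ℝ) :
    coordT P a (framePoint P a t y) = t := by
  simp only [coordT, framePoint, PiLp.toLp_apply, Matrix.cons_val_zero, Matrix.cons_val_one]
  linear_combination t * ha

theorem coordN_framePoint {P a : Plane} (ha : a 0 ^ 2 + a 1 ^ 2 = 1) (t y : ℝ) :
    coordN P a (framePoint P a t y) = y := by
  simp only [coordN, framePoint, PiLp.toLp_apply, Matrix.cons_val_zero, Matrix.cons_val_one]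
  linear_combination y * ha

theorem framePoint_coord {P a : Plane} (ha : a 0 ^ 2 + a 1 ^ 2 = 1) (x : Plane) :
    framePoint P a (coordT P a x) (coordN P a x) = x := by
  ext i
  fin_cases i
  · simp [coordT, coordN, framePoint]
    linear_combination (x 0 - P 0) * ha
  · simp [coordT, coordN, framePoint]
    linear_combination (x 1 - P 1) * ha

@[fun_prop]
theorem contDiff_coordT (P a : Plane) {n : WithTop ℕ∞} : ContDiff ℝ n (coordT P a) := by
  unfold coordT; fun_prop

@[fun_prop]
theorem contDiff_coordN (P a : Plane) {n : WithTop ℕ∞} : ContDiff ℝ n (coordN P a) := by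
  unfold coordN; fun_prop

theorem continuous_coordT (P a : Plane) : Continuous (coordT P a) :=
  (contDiff_coordT P a (n := 0)).continuous

theorem continuous_coordN (P a : Plane) : Continuous (coordN P a) :=
  (contDiff_coordN P a (n := 0)).continuous

theorem plane_norm_sq (a : Plane) : ‖a‖ ^ 2 = a 0 ^ 2 + a 1 ^ 2 := by
  rw [EuclideanSpace.norm_sq_eq]; simp

theorem norm_eq_one_iff_sq (a : Plane) : ‖a‖ = 1 ↔ a 0 ^ 2 + a 1 ^ 2 = 1 := by
  rw [← plane_norm_sq, pow_eq_one_iff_of_nonneg (norm_nonneg a) two_ne_zero]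

/-- In a rectangle centred at `P`, with sides parallel to `a` and its rotation, `Ω` is the part
above the graph of the `C²` function `g`. -/
structure IsLocalGraph (Ω : Set Plane) (P a : Plane) (r h : ℝ) (g : ℝ → ℝ) : Prop where
  unit : a 0 ^ 2 + a 1 ^ 2 = 1
  r_pos : 0 < r
  h_pos : 0 < h
  contDiff : ContDiff ℝ 2 g
  zero : g 0 = 0
  mem_iff : ∀ x, |coordT P a x| < r → |coordN P a x| < h → (x ∈ Ω ↔ g (coordT P a x) < coordN P a x)

/-- The rigid motion `A` may reverse orientation, while the frame `(a, rot a)` is always positively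
oriented; the discrepancy is absorbed by reflecting the variable of `g`. -/
theorem IsC2Domain.exists_isLocalGraph {Ω : Set Plane} (hΩ : IsC2Domain Ω) {P : Plane}
    (hP : P ∈ frontier Ω) : ∃ a r h g, IsLocalGraph Ω P a r h g := by
  obtain ⟨A, r, h, g, hr, hh, hg, hg0, -, hAP, hA⟩ := hΩ.exists_graph P hP
  set c : Fin 2 → Plane := fun i => A.linearIsometryEquiv.symm (EuclideanSpace.single i 1) with hc
  have hcoord : ∀ x i, A x i = c i 0 * (x 0 - P 0) + c i 1 * (x 1 - P 1) := by
    intro x i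
    have h1 : A x = A.linearIsometryEquiv (x - P) := by
      have := A.map_vsub x P
      simp only [hAP, vsub_eq_sub, sub_zero] at this
      exact this.symm
    have h2 : A x i = inner ℝ (EuclideanSpace.single i (1 : ℝ)) (A x) := by
      rw [EuclideanSpace.inner_single_left]; simp
    rw [h2, h1, ← A.linearIsometryEquiv.symm.inner_map_map, LinearIsometryEquiv.symm_apply_apply,
      PiLp.inner_apply, Fin.sum_univ_two]
    simp [hc, mul_comm]
  have hinner : ∀ i j, c i 0 * c j 0 + c i 1 * c j 1 = if i = j then 1 else 0 := by
    intro i j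
    have : inner ℝ (c j) (c i) = c i 0 * c j 0 + c i 1 * c j 1 := by
      rw [PiLp.inner_apply, Fin.sum_univ_two]; simp
    rw [← this, hc]
    simp only [LinearIsometryEquiv.inner_map_map]
    rw [EuclideanSpace.inner_single_left]
    fin_cases i <;> fin_cases j <;> simp
  have h00 := hinner 0 0
  have h01 := hinner 0 1
  have h11 := hinner 1 1
  simp only [↓reduceIte, zero_ne_one] at h00 h01 h11
  -- Chosen so that `c 1` is the counterclockwise rotation of `a`; then `c 0 = ε a`, where the
  -- determinant `ε` is `1` or `-1`.
  set a : Plane := !₂[c 1 1, -(c 1 0)] with ha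
  have ha0 : a 0 = c 1 1 := rfl
  have ha1 : a 1 = -(c 1 0) := rfl
  set ε : ℝ := c 0 0 * c 1 1 - c 0 1 * c 1 0 with hε
  have hε2 : ε ^ 2 = 1 := by
    have : ε ^ 2 = (c 0 0 * c 0 0 + c 0 1 * c 0 1) * (c 1 0 * c 1 0 + c 1 1 * c 1 1)
      - (c 0 0 * c 1 0 + c 0 1 * c 1 1) ^ 2 := by rw [hε]; ring
    rw [this, h00, h11, h01]; norm_num
  have hεabs : |ε| = 1 := by
    rwa [← pow_eq_one_iff_of_nonneg (abs_nonneg ε) two_ne_zero, sq_abs]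
  have hc00 : c 0 0 = ε * c 1 1 := by
    rw [hε]
    linear_combination (-c 0 0) * h11 + c 1 0 * h01
  have hc01 : c 0 1 = -(ε * c 1 0) := by
    rw [hε]
    linear_combination (-c 0 1) * h11 + c 1 1 * h01
  have e0 : ∀ x, A x 0 = ε * coordT P a x := by
    intro x
    rw [hcoord, coordT, ha0, ha1, hc00, hc01]; ring
  have e1 : ∀ x, A x 1 = coordN P a x := by
    intro x
    rw [hcoord, coordN, ha0, ha1]; ring
  have hg1 : ContDiff ℝ 2 fun t => g (ε * t) := by fun_prop
  refine ⟨a, r, h, fun t => g (ε * t), ?_, hr, hh, hg1, by simpa using hg0, ?_⟩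
  · rw [ha0, ha1]; linarith
  · intro x hx1 hx2
    have := hA x (by rw [e0, abs_mul, hεabs, one_mul]; exact hx1)
      (by rwa [e1])
    rw [this, e0, e1]

namespace IsLocalGraph

variable {Ω : Set Plane} {P a : Plane} {r h : ℝ} {g : ℝ → ℝ}

/-- The open rectangle in which the boundary is a graph. -/
def rect (P a : Plane) (r h : ℝ) : Set Plane := {x | |coordT P a x| < r ∧ |coordN P a x| < h}

theorem isOpen_rect : IsOpen (rect P a r h) :=
  (isOpen_lt (continuous_coordT P a).abs continuous_const).inter
    (isOpen_lt (continuous_coordN P a).abs continuous_const)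

theorem self_mem_rect (H : IsLocalGraph Ω P a r h g) : P ∈ rect P a r h := by
  simp [rect, coordT, coordN, H.r_pos, H.h_pos]

/-- Points strictly above the graph lie in the open set `Ω`, points strictly below have a
neighbourhood missing `Ω`, and points on the graph are limits of points above it. -/
theorem mem_frontier_iff (H : IsLocalGraph Ω P a r h g) (hΩ : IsOpen Ω) {x : Plane}
    (hx : x ∈ rect P a r h) : x ∈ frontier Ω ↔ g (coordT P a x) = coordN P a x := by
  have hgc := H.contDiff.continuous.comp (continuous_coordT P a)
  constructor
  · intro hf
    rcases lt_trichotomy (g (coordT P a x)) (coordN P a x) with h1 | h1 | h1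
    · have : x ∈ Ω := (H.mem_iff x hx.1 hx.2).2 h1
      rw [hΩ.frontier_eq] at hf
      exact absurd this hf.2
    · exact h1
    · exfalso
      have hev : ∀ᶠ z in 𝓝 x, z ∉ Ω := by
        filter_upwards [isOpen_rect.mem_nhds hx,
          (isOpen_lt (continuous_coordN P a) hgc).mem_nhds h1] with z hz hz2 hzΩ
        exact absurd ((H.mem_iff z hz.1 hz.2).1 hzΩ) (not_lt.2 (le_of_lt hz2))
      have := mem_closure_iff_frequently.1 (frontier_subset_closure hf)
      exact this hev
  · intro he
    rw [hΩ.frontier_eq]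
    refine ⟨?_, fun hxΩ => ?_⟩
    · rw [mem_closure_iff_frequently]
      have hc : Tendsto (fun z : ℝ => framePoint P a (coordT P a x) (coordN P a x + z)) (𝓝[>] 0)
          (𝓝 x) := by
        have : Continuous fun z : ℝ => framePoint P a (coordT P a x) (coordN P a x + z) := by
          unfold framePoint; fun_prop
        have h2 := this.tendsto 0
        rw [add_zero, framePoint_coord H.unit] at h2
        exact h2.mono_left nhdsWithin_le_nhds
      have hev : ∀ᶠ z in 𝓝[>] (0 : ℝ),
          framePoint P a (coordT P a x) (coordN P a x + z) ∈ Ω := by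
        filter_upwards [hc (isOpen_rect.mem_nhds hx), self_mem_nhdsWithin] with z hz hz2
        rw [H.mem_iff _ hz.1 hz.2, coordT_framePoint H.unit, coordN_framePoint H.unit, he]
        simpa using hz2
      exact hc.frequently hev.frequently
    · exact absurd ((H.mem_iff x hx.1 hx.2).1 hxΩ) (by rw [he]; exact lt_irrefl _)

end IsLocalGraph

/-! ### The outer unit normal -/

/-- For distinct unit vectors `⟨ν, ν'⟩ < 1`, so in the direction `ν' - ν` the function `ρ` strictly
decreases and `ρ'` strictly increases at `P`. Nearby points on that ray would lie both inside and
outside `Ω`. -/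
theorem IsOuterUnitNormal.eq {Ω : Set Plane} {P ν ν' : Plane} (h : IsOuterUnitNormal Ω P ν)
    (h' : IsOuterUnitNormal Ω P ν') : ν = ν' := by
  obtain ⟨hν, ρ, -, hρ0, hρ, c, hc, hg⟩ := h
  obtain ⟨hν', ρ', -, hρ0', hρ', c', hc', hg'⟩ := h'
  by_contra hne
  have hlt : inner ℝ ν ν' < 1 := by
    refine (real_inner_le_norm ν ν').lt_of_ne (fun he => hne ?_) |>.trans_eq (by rw [hν, hν']; simp)
    have := inner_eq_norm_mul_iff_real.1 he
    rw [hν, hν'] at this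
    simpa using this
  set v := ν' - ν
  have e1 : inner ℝ ν v < 0 := by
    simp only [v, inner_sub_right, real_inner_self_eq_norm_sq, hν]; linarith
  have e2 : 0 < inner ℝ ν' v := by
    simp only [v, inner_sub_right, real_inner_self_eq_norm_sq, hν']
    rw [real_inner_comm] at hlt; linarith
  have hline : ∀ (ρ : Plane → ℝ) (c : ℝ) (ν : Plane), HasGradientAt ρ (c • ν) P →
      HasDerivAt (fun t : ℝ => ρ (P + t • v)) (c * inner ℝ ν v) 0 := by
    intro ρ c ν hg
    have h1 : HasDerivAt (fun t : ℝ => P + t • v) v 0 := by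
      simpa using ((hasDerivAt_id (0 : ℝ)).smul_const v).const_add P
    have h2 := (hasGradientAt_iff_hasFDerivAt.1 hg)
    have h3 : HasFDerivAt ρ ((InnerProductSpace.toDual ℝ Plane) (c • ν)) (P + (0 : ℝ) • v) := by
      simpa using h2
    have := h3.comp_hasDerivAt (0 : ℝ) h1
    simpa [inner_smul_left, Function.comp_def] using! this
  have d1 := hline ρ c ν hg
  have d2 := hline ρ' c' ν' hg'
  have htend : Tendsto (fun t : ℝ => P + t • v) (𝓝[>] 0) (𝓝 P) := by
    have : Continuous fun t : ℝ => P + t • v := by fun_prop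
    have h2 := this.tendsto 0
    rw [zero_smul, add_zero] at h2
    exact h2.mono_left nhdsWithin_le_nhds
  have s1 : ∀ᶠ t in 𝓝[>] (0 : ℝ), ρ (P + t • v) < 0 := by
    have h1 := d1.tendsto_slope_zero_right.eventually (gt_mem_nhds (mul_neg_of_pos_of_neg hc e1))
    filter_upwards [h1, self_mem_nhdsWithin] with t ht ht0
    simp only [zero_add, zero_smul, add_zero, hρ0, sub_zero, smul_eq_mul] at ht
    exact neg_of_mul_neg_right ht (inv_pos.2 ht0).le
  have s2 : ∀ᶠ t in 𝓝[>] (0 : ℝ), 0 < ρ' (P + t • v) := by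
    have h1 := d2.tendsto_slope_zero_right.eventually (lt_mem_nhds (mul_pos hc' e2))
    filter_upwards [h1, self_mem_nhdsWithin] with t ht ht0
    simp only [zero_add, zero_smul, add_zero, hρ0', sub_zero, smul_eq_mul] at ht
    exact pos_of_mul_pos_right ht (inv_pos.2 ht0).le
  obtain ⟨t, h1, h2, h3, h4⟩ := (s1.and (s2.and ((htend.eventually hρ).and
    (htend.eventually hρ')))).exists
  exact absurd (h4.1 (h3.2 h1)) (not_lt.2 h2.le)

theorem IsOuterUnitNormal.outerNormal_eq {Ω : Set Plane} {P ν : Plane}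
    (h : IsOuterUnitNormal Ω P ν) : outerNormal Ω P = ν := by
  have hex : ∃ ν, IsOuterUnitNormal Ω P ν := ⟨ν, h⟩
  rw [outerNormal, dif_pos hex]
  exact hex.choose_spec.eq h

/-! ### Arclength charts -/

/-- The counterclockwise rotation by `π / 2`. -/
def rot (a : Plane) : Plane := !₂[-(a 1), a 0]

theorem framePoint_eq (P a : Plane) (t y : ℝ) : framePoint P a t y = P + t • a + y • rot a := by
  ext i
  fin_cases i
  · simp [framePoint, rot]; ring
  · simp [framePoint, rot]

theorem rot_smul (c : ℝ) (a : Plane) : rot (c • a) = c • rot a := by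
  ext i
  fin_cases i <;> simp [rot]

theorem hasFDerivAt_coordT (P a x : Plane) : HasFDerivAt (coordT P a) (innerSL ℝ a) x := by
  have h : coordT P a = fun x => innerSL ℝ a (x - P) := by
    ext x
    simp [coordT, PiLp.inner_apply, Fin.sum_univ_two, mul_comm]
  rw [h]
  simpa using! (innerSL ℝ a).hasFDerivAt.comp x ((hasFDerivAt_id x).sub_const P)

theorem coordN_eq_coordT (P a : Plane) : coordN P a = coordT P (rot a) := by
  ext x; simp [coordT, coordN, rot]

/-- `σ` is the arclength of the graph measured from `0`, and `ξ` is its inverse, of class `C²`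
because `σ` is `C²` with `σ' ≥ 1`. -/
theorem exists_arclength {g : ℝ → ℝ} (hg : ContDiff ℝ 2 g) :
    ∃ σ ξ : ℝ → ℝ, ContDiff ℝ 2 σ ∧ ContDiff ℝ 2 ξ ∧ (∀ s, σ (ξ s) = s) ∧ (∀ t, ξ (σ t) = t) ∧
      ∀ s, HasDerivAt ξ (√(1 + deriv g (ξ s) ^ 2))⁻¹ s := by
  set q : ℝ → ℝ := fun t => √(1 + deriv g t ^ 2) with hq
  have hg' : ContDiff ℝ 1 (deriv g) := ((contDiff_succ_iff_deriv (n := 1)).1 hg).2.2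
  have hq1 : ContDiff ℝ 1 q := (contDiff_const.add (hg'.pow 2)).sqrt fun t => by positivity
  have hq_one : ∀ t, 1 ≤ q t := fun t => by
    rw [hq, Real.one_le_sqrt]; linarith [sq_nonneg (deriv g t)]
  set σ : ℝ → ℝ := fun t => ∫ x in (0 : ℝ)..t, q x with hσ
  have hσd : ∀ t, HasDerivAt σ (q t) t := fun t =>
    (hq1.continuous.integral_hasStrictDerivAt 0 t).hasDerivAt
  have hσderiv : deriv σ = q := funext fun t => (hσd t).deriv
  have hσ2 : ContDiff ℝ 2 σ :=
    (contDiff_succ_iff_deriv (n := 1)).2 ⟨fun t => (hσd t).differentiableAt, by simp, hσderiv ▸ hq1⟩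
  have hmono : StrictMono σ := strictMono_of_deriv_pos fun t => by
    rw [hσderiv]; exact zero_lt_one.trans_le (hq_one t)
  -- Comparison with the identity forces `σ` to be unbounded in both directions, hence surjective.
  have hmono2 : Monotone fun t => σ t - t := by
    refine monotone_of_deriv_nonneg (fun t => ((hσd t).sub (hasDerivAt_id t)).differentiableAt) ?_
    intro t
    have := ((hσd t).sub (hasDerivAt_id t)).deriv
    change 0 ≤ deriv (σ - id) t
    rw [this]; linarith [hq_one t]
  have hσ0 : σ 0 = 0 := by simp [hσ]
  have hsurj : Function.Surjective σ := by
    refine hσ2.continuous.surjective ?_ ?_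
    · refine tendsto_atTop_mono' _ ?_ tendsto_id
      filter_upwards [eventually_ge_atTop 0] with t ht
      have := hmono2 ht
      simp only [hσ0, sub_zero, id] at this ⊢
      linarith
    · refine tendsto_atBot_mono' _ ?_ tendsto_id
      filter_upwards [eventually_le_atBot 0] with t ht
      have := hmono2 ht
      simp only [hσ0, sub_zero, id] at this ⊢
      linarith
  set e : ℝ ≃ₜ ℝ := (hmono.orderIsoOfSurjective σ hsurj).toHomeomorph with he
  have hes : ∀ s, σ (e.symm s) = s := fun s => e.apply_symm_apply s
  have hes' : ∀ t, e.symm (σ t) = t := fun t => e.symm_apply_apply t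
  refine ⟨σ, e.symm, hσ2, ?_, hes, hes', ?_⟩
  · exact e.contDiff_symm_deriv (f' := q) (fun t => (zero_lt_one.trans_le (hq_one t)).ne') hσd hσ2
  · intro s
    exact HasDerivAt.of_local_left_inverse e.symm.continuous.continuousAt (hσd _)
      (zero_lt_one.trans_le (hq_one _)).ne' (Eventually.of_forall hes)

/-- `Γ` is an arclength parametrization of the part of `∂Ω` in the open set `U`, and the function
`S` of class `C²` on the plane restricts to its inverse. -/
structure IsArcChart (Ω : Set Plane) (Γ : ℝ → Plane) (S : Plane → ℝ) (U : Set Plane) : Prop where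
  contDiff_curve : ContDiff ℝ 2 Γ
  contDiff_coord : ContDiff ℝ 2 S
  coord_curve : ∀ s, S (Γ s) = s
  curve_coord : ∀ Q ∈ frontier Ω, Q ∈ U → Γ (S Q) = Q
  isOpen : IsOpen U
  mem_frontier : ∀ s, Γ s ∈ U → Γ s ∈ frontier Ω
  isOuterUnitNormal : ∀ s, Γ s ∈ U → IsOuterUnitNormal Ω (Γ s) (outerNormal Ω (Γ s))
  hasDerivAt : ∀ s, Γ s ∈ U → HasDerivAt Γ (tangent Ω (Γ s)) s

/-- The defining function is `g ∘ coordT - coordN`, negative exactly above the graph; its gradient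
`g' a - rot a` has length `√(1 + g'²)`. -/
theorem IsLocalGraph.isOuterUnitNormal {Ω : Set Plane} {P a : Plane} {r h : ℝ} {g : ℝ → ℝ}
    (H : IsLocalGraph Ω P a r h g) {t : ℝ}
    (hx : framePoint P a t (g t) ∈ IsLocalGraph.rect P a r h) :
    IsOuterUnitNormal Ω (framePoint P a t (g t))
      ((√(1 + deriv g t ^ 2))⁻¹ • (deriv g t • a - rot a)) := by
  have hT := coordT_framePoint (P := P) H.unit t (g t)
  have hN := coordN_framePoint (P := P) H.unit t (g t)
  set x := framePoint P a t (g t) with hxdef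
  have hpos : 0 < √(1 + deriv g t ^ 2) := Real.sqrt_pos.2 (by positivity)
  refine ⟨?_, fun x => g (coordT P a x) - coordN P a x, ?_, ?_, ?_, √(1 + deriv g t ^ 2), hpos, ?_⟩
  · rw [norm_smul, norm_inv, Real.norm_of_nonneg hpos.le, inv_mul_eq_one₀ hpos.ne']
    rw [← sq_eq_sq₀ hpos.le (norm_nonneg _), plane_norm_sq, Real.sq_sqrt (by positivity)]
    simp only [rot, PiLp.sub_apply, PiLp.smul_apply, Matrix.cons_val_zero,
      Matrix.cons_val_one, smul_eq_mul]
    linear_combination (-1 - deriv g t ^ 2) * H.unit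
  · have := H.contDiff.of_le (m := 1) (by norm_num)
    exact (this.comp (contDiff_coordT P a)).sub (contDiff_coordN P a)
  · simp [hT, hN]
  · filter_upwards [IsLocalGraph.isOpen_rect.mem_nhds hx] with z hz
    rw [H.mem_iff z hz.1 hz.2, sub_neg]
  · rw [smul_inv_smul₀ hpos.ne', hasGradientAt_iff_hasFDerivAt]
    have hgd : HasDerivAt g (deriv g t) (coordT P a x) := by
      rw [hT]; exact (H.contDiff.differentiable (by norm_num) t).hasDerivAt
    have h1 := hgd.comp_hasFDerivAt x (hasFDerivAt_coordT P a x)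
    have h2 := hasFDerivAt_coordT P (rot a) x
    rw [← coordN_eq_coordT] at h2
    have h3 : InnerProductSpace.toDual ℝ Plane (deriv g t • a - rot a) =
        deriv g t • innerSL ℝ a - innerSL ℝ (rot a) := by
      ext z
      simp
    rw [h3]
    exact h1.sub h2

/-- `Γ` runs along the graph with the inverse arclength `ξ`. The coordinate `σ ∘ coordT` ignores the
direction `rot a`, so it is `C²` on the whole plane. -/
theorem IsLocalGraph.exists_isArcChart {Ω : Set Plane} (hΩ : IsOpen Ω) {P a : Plane} {r h : ℝ}
    {g : ℝ → ℝ} (H : IsLocalGraph Ω P a r h g) :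
    ∃ Γ S, IsArcChart Ω Γ S (IsLocalGraph.rect P a r h) := by
  obtain ⟨σ, ξ, hσ, hξ, hσξ, hξσ, hξd⟩ := exists_arclength H.contDiff
  refine ⟨fun s => framePoint P a (ξ s) (g (ξ s)), fun x => σ (coordT P a x), ?_, ?_, ?_, ?_,
    IsLocalGraph.isOpen_rect, ?_, ?_, ?_⟩
  · have := H.contDiff
    simp only [framePoint_eq]
    fun_prop
  · fun_prop
  · intro s
    simp only [coordT_framePoint H.unit, hσξ]
  · intro Q hQ hQU
    simp only [hξσ]
    rw [(H.mem_frontier_iff hΩ hQU).1 hQ, framePoint_coord H.unit]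
  · intro s hs
    rw [H.mem_frontier_iff hΩ hs, coordT_framePoint H.unit, coordN_framePoint H.unit]
  · intro s hs
    have := H.isOuterUnitNormal hs
    rwa [this.outerNormal_eq]
  · intro s hs
    have h1 := (H.isOuterUnitNormal hs).outerNormal_eq
    -- With `Ω` above the graph the outer normal points down, and its rotation points towards
    -- increasing `t`; the orientations of `Γ` and `τ` agree.
    have h2 : tangent Ω (framePoint P a (ξ s) (g (ξ s))) =
        (√(1 + deriv g (ξ s) ^ 2))⁻¹ • (a + deriv g (ξ s) • rot a) := by
      change rot (outerNormal Ω _) = _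
      rw [h1, rot_smul]
      congr 1
      ext i
      fin_cases i <;> simp [rot] <;> ring
    rw [h2]
    simp only [framePoint_eq]
    have hgd : HasDerivAt (fun s => g (ξ s)) (deriv g (ξ s) * (√(1 + deriv g (ξ s) ^ 2))⁻¹) s :=
      (H.contDiff.differentiable (by norm_num) (ξ s)).hasDerivAt.comp s (hξd s)
    have := (((hξd s).smul_const a).const_add P).add (hgd.smul_const (rot a))
    convert! this using 1
    rw [smul_add, smul_smul, mul_comm]

theorem IsC2Domain.exists_isArcChart {Ω : Set Plane} (hΩ : IsC2Domain Ω) {P : Plane}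
    (hP : P ∈ frontier Ω) : ∃ Γ S U, IsArcChart Ω Γ S U ∧ P ∈ U := by
  obtain ⟨a, r, h, g, H⟩ := hΩ.exists_isLocalGraph hP
  obtain ⟨Γ, S, hΓ⟩ := H.exists_isArcChart hΩ.isOpen
  exact ⟨Γ, S, _, hΓ, H.self_mem_rect⟩

theorem IsC2Domain.isOuterUnitNormal {Ω : Set Plane} (hΩ : IsC2Domain Ω) {P : Plane}
    (hP : P ∈ frontier Ω) : IsOuterUnitNormal Ω P (outerNormal Ω P) := by
  obtain ⟨Γ, S, U, hΓ, hPU⟩ := hΩ.exists_isArcChart hP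
  have h := hΓ.curve_coord P hP hPU
  have := hΓ.isOuterUnitNormal (S P) (by rwa [h])
  rwa [h] at this

namespace IsArcChart

variable {Ω : Set Plane} {Γ : ℝ → Plane} {S : Plane → ℝ} {U : Set Plane}

theorem isOpen_preimage (H : IsArcChart Ω Γ S U) : IsOpen (Γ ⁻¹' U) :=
  H.isOpen.preimage H.contDiff_curve.continuous

/-- Near each of its points, an arc is a shift of the chart. -/
theorem arc_eq (H : IsArcChart Ω Γ S U) {a b : ℝ} {ψ : ℝ → Plane} (hψ : IsArc Ω a b ψ) {s₀ : ℝ}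
    (hs₀ : s₀ ∈ Ioo a b) (hU : ψ s₀ ∈ U) :
    ∀ᶠ s in 𝓝 s₀, ψ s = Γ (s + (S (ψ s₀) - s₀)) ∧ ψ s ∈ U := by
  have hcont : ContinuousAt ψ s₀ := (hψ s₀ hs₀).2.continuousAt
  have hev : ∀ᶠ s in 𝓝 s₀, s ∈ Ioo a b ∧ ψ s ∈ U :=
    (show ∀ᶠ s in 𝓝 s₀, s ∈ Ioo a b from isOpen_Ioo.mem_nhds hs₀).and
      (hcont (H.isOpen.mem_nhds hU))
  obtain ⟨ε, hε, hball⟩ := Metric.eventually_nhds_iff_ball.1 hev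
  have hSd : ∀ x, DifferentiableAt ℝ S x := H.contDiff_coord.differentiable (by norm_num)
  -- At a common point `ψ` and `Γ` both have velocity `τ`, and `S ∘ Γ` is the identity; hence `S ∘
  -- ψ` has derivative `1`.
  have hd : ∀ s ∈ Metric.ball s₀ ε, HasDerivAt (fun s => S (ψ s) - s) 0 s := by
    intro s hs
    obtain ⟨hab, hsU⟩ := hball s hs
    obtain ⟨hfr, hder⟩ := hψ s hab
    have hback := H.curve_coord _ hfr hsU
    have h1 : HasDerivAt (fun s => S (ψ s)) (fderiv ℝ S (ψ s) (tangent Ω (ψ s))) s :=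
      (hSd (ψ s)).hasFDerivAt.comp_hasDerivAt s hder
    have h2 := H.hasDerivAt (S (ψ s)) (by rwa [hback])
    rw [hback] at h2
    have h3 : HasDerivAt (fun t => S (Γ t)) (fderiv ℝ S (ψ s) (tangent Ω (ψ s))) (S (ψ s)) := by
      have h4 : HasFDerivAt S (fderiv ℝ S (ψ s)) (Γ (S (ψ s))) := by
        rw [hback]; exact (hSd _).hasFDerivAt
      exact h4.comp_hasDerivAt _ h2
    have h5 : HasDerivAt (fun t => S (Γ t)) 1 (S (ψ s)) := by
      simp only [H.coord_curve]; exact hasDerivAt_id _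
    rw [h3.unique h5] at h1
    simpa using! h1.sub (hasDerivAt_id s)
  filter_upwards [Metric.ball_mem_nhds s₀ hε] with s hs
  obtain ⟨hab, hsU⟩ := hball s hs
  refine ⟨?_, hsU⟩
  have hconst : S (ψ s) - s = S (ψ s₀) - s₀ :=
    Metric.isOpen_ball.is_const_of_deriv_eq_zero (convex_ball s₀ ε).isPreconnected
      (fun z hz => (hd z hz).differentiableAt.differentiableWithinAt)
      (fun z hz => (hd z hz).deriv) hs (Metric.mem_ball_self hε)
  rw [← hconst, add_sub_cancel, H.curve_coord _ (hψ s hab).1 hsU]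

theorem exists_isArc (H : IsArcChart Ω Γ S U) {s : ℝ} (hs : Γ s ∈ U) :
    ∃ a b, (0 : ℝ) ∈ Ioo a b ∧ IsArc Ω a b fun t => Γ (s + t) := by
  have hev : ∀ᶠ t in 𝓝 (0 : ℝ), Γ (s + t) ∈ U := by
    have hc : ContinuousAt (fun t => Γ (s + t)) 0 :=
      (H.contDiff_curve.continuous.comp (continuous_const.add continuous_id)).continuousAt
    exact hc (H.isOpen.mem_nhds (by simpa using hs))
  obtain ⟨ε, hε, hball⟩ := Metric.eventually_nhds_iff_ball.1 hev
  refine ⟨-ε, ε, by simpa using hε, fun t ht => ?_⟩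
  have htU := hball t (by rw [Metric.mem_ball, dist_zero_right, Real.norm_eq_abs, abs_lt]; exact ht)
  refine ⟨H.mem_frontier _ htU, ?_⟩
  have := (H.hasDerivAt _ htU).scomp t ((hasDerivAt_id t).const_add s)
  simpa [Function.comp_def] using! this

/-- Every arc through the point is locally a shift of `Γ` by `arc_eq`, so one chart decides the
derivative along all of them. -/
theorem hasArcDerivAt (H : IsArcChart Ω Γ S U) {s d : ℝ} (hs : Γ s ∈ U) {f : Plane → ℝ}
    (hf : HasDerivAt (fun t => f (Γ t)) d s) : HasArcDerivAt Ω f d (Γ s) := by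
  obtain ⟨a, b, hab, harc⟩ := H.exists_isArc hs
  refine ⟨⟨a, b, _, hab, harc, by simp⟩, ?_⟩
  intro a b ψ h0 hψ hψ0
  have := H.arc_eq hψ h0 (by rwa [hψ0])
  rw [hψ0, H.coord_curve] at this
  have h1 : HasDerivAt (fun t => f (Γ (t + (s - 0)))) d 0 := by
    have h2 : HasDerivAt (fun t => f (Γ t)) d (0 + (s - 0)) := by simpa using hf
    simpa [Function.comp_def] using! h2.comp_add_const 0 (s - 0)
  refine h1.congr_of_eventuallyEq ?_
  filter_upwards [this] with t ht
  rw [ht.1]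

end IsArcChart

theorem HasArcDerivAt.unique {Ω : Set Plane} {f : Plane → ℝ} {d d' : ℝ} {P : Plane}
    (h : HasArcDerivAt Ω f d P) (h' : HasArcDerivAt Ω f d' P) : d = d' := by
  obtain ⟨⟨a, b, ψ, h0, hψ, hP⟩, h1⟩ := h
  exact (h1 a b ψ h0 hψ hP).unique (h'.2 a b ψ h0 hψ hP)

theorem HasArcDerivAt.arcDeriv_eq {Ω : Set Plane} {f : Plane → ℝ} {d : ℝ} {P : Plane}
    (h : HasArcDerivAt Ω f d P) : arcDeriv Ω f P = d := by
  have hex : ∃ d, HasArcDerivAt Ω f d P := ⟨d, h⟩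
  rw [arcDeriv, dif_pos hex]
  exact hex.choose_spec.unique h

theorem HasArcDerivAt.hasDerivAt_arc {Ω : Set Plane} {f : Plane → ℝ} {d a b s : ℝ}
    {ψ : ℝ → Plane} (hψ : IsArc Ω a b ψ) (hs : s ∈ Ioo a b) (h : HasArcDerivAt Ω f d (ψ s)) :
    HasDerivAt (fun t => f (ψ t)) d s := by
  have h1 := h.2 (a - s) (b - s) (fun t => ψ (t + s)) ⟨by linarith [hs.1], by linarith [hs.2]⟩ ?_
    (by simp)
  · have h2 : HasDerivAt (fun t => f (ψ (t + s))) d (s + -s) := by simpa using h1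
    simpa using h2.comp_add_const s (-s)
  · intro t ht
    have ht' : t + s ∈ Ioo a b := ⟨by linarith [ht.1], by linarith [ht.2]⟩
    exact ⟨(hψ _ ht').1, (hψ _ ht').2.comp_add_const t s⟩

/-! ### The moving frame along the boundary -/

namespace IsArcChart

variable {Ω : Set Plane} {Γ : ℝ → Plane} {S : Plane → ℝ} {U : Set Plane}

theorem tangent_eq (H : IsArcChart Ω Γ S U) {s : ℝ} (hs : Γ s ∈ U) :
    tangent Ω (Γ s) = deriv Γ s := (H.hasDerivAt s hs).deriv.symm

theorem contDiff_deriv (H : IsArcChart Ω Γ S U) : ContDiff ℝ 1 (deriv Γ) :=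
  ((contDiff_succ_iff_deriv (n := 1)).1 H.contDiff_curve).2.2

theorem continuous_deriv_deriv (H : IsArcChart Ω Γ S U) : Continuous (deriv (deriv Γ)) :=
  H.contDiff_deriv.continuous_deriv_one

/-- Along the chart `τ ∘ Γ = Γ'`, and `Γ` is `C²`. This is where the regularity of the boundary
makes the frame differentiable. -/
theorem hasArcDerivAt_tangent (H : IsArcChart Ω Γ S U) {s : ℝ} (hs : Γ s ∈ U) (α : Fin 2) :
    HasArcDerivAt Ω (fun Q => tangent Ω Q α) (deriv (deriv Γ) s α) (Γ s) := by
  refine H.hasArcDerivAt hs ?_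
  have h1 : HasDerivAt (deriv Γ) (deriv (deriv Γ) s) s :=
    (H.contDiff_deriv.differentiable (by norm_num) s).hasDerivAt
  have h2 : HasDerivAt (fun t => deriv Γ t α) (deriv (deriv Γ) s α) s :=
    (EuclideanSpace.proj (𝕜 := ℝ) α).hasFDerivAt.comp_hasDerivAt s h1
  refine h2.congr_of_eventuallyEq ?_
  filter_upwards [H.isOpen_preimage.mem_nhds hs] with t ht
  rw [H.tangent_eq ht]

end IsArcChart

theorem outerNormal_zero_eq (Ω : Set Plane) (P : Plane) : outerNormal Ω P 0 = tangent Ω P 1 := rfl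

theorem outerNormal_one_eq (Ω : Set Plane) (P : Plane) :
    outerNormal Ω P 1 = -tangent Ω P 0 := by simp [tangent]

theorem HasArcDerivAt.neg {Ω : Set Plane} {f : Plane → ℝ} {d : ℝ} {P : Plane}
    (h : HasArcDerivAt Ω f d P) : HasArcDerivAt Ω (fun Q => -f Q) (-d) P :=
  ⟨h.1, fun a b ψ h0 hψ hP => (h.2 a b ψ h0 hψ hP).neg⟩

namespace IsC2Domain

variable {Ω : Set Plane}

theorem hasArcDerivAt_tangent (hΩ : IsC2Domain Ω) {P : Plane} (hP : P ∈ frontier Ω) (α : Fin 2) :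
    HasArcDerivAt Ω (fun Q => tangent Ω Q α) (arcDeriv Ω (fun Q => tangent Ω Q α) P) P := by
  obtain ⟨Γ, S, U, H, hU⟩ := hΩ.exists_isArcChart hP
  have hb := H.curve_coord P hP hU
  have := H.hasArcDerivAt_tangent (s := S P) (by rwa [hb]) α
  rw [hb] at this
  rwa [this.arcDeriv_eq]

theorem hasArcDerivAt_outerNormal_aux (hΩ : IsC2Domain Ω) {P : Plane} (hP : P ∈ frontier Ω) :
    HasArcDerivAt Ω (fun Q => outerNormal Ω Q 0) (arcDeriv Ω (fun Q => tangent Ω Q 1) P) P ∧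
    HasArcDerivAt Ω (fun Q => outerNormal Ω Q 1) (-arcDeriv Ω (fun Q => tangent Ω Q 0) P) P := by
  refine ⟨hΩ.hasArcDerivAt_tangent hP 1, ?_⟩
  simp only [outerNormal_one_eq]
  exact (hΩ.hasArcDerivAt_tangent hP 0).neg

theorem hasArcDerivAt_outerNormal (hΩ : IsC2Domain Ω) {P : Plane} (hP : P ∈ frontier Ω)
    (α : Fin 2) :
    HasArcDerivAt Ω (fun Q => outerNormal Ω Q α) (arcDeriv Ω (fun Q => outerNormal Ω Q α) P) P := by
  obtain ⟨h0, h1⟩ := hΩ.hasArcDerivAt_outerNormal_aux hP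
  fin_cases α
  · exact h0.arcDeriv_eq.symm ▸ h0
  · exact h1.arcDeriv_eq.symm ▸ h1

theorem arcDeriv_outerNormal_zero (hΩ : IsC2Domain Ω) {P : Plane} (hP : P ∈ frontier Ω) :
    arcDeriv Ω (fun Q => outerNormal Ω Q 0) P = arcDeriv Ω (fun Q => tangent Ω Q 1) P :=
  (hΩ.hasArcDerivAt_outerNormal_aux hP).1.arcDeriv_eq

theorem arcDeriv_outerNormal_one (hΩ : IsC2Domain Ω) {P : Plane} (hP : P ∈ frontier Ω) :
    arcDeriv Ω (fun Q => outerNormal Ω Q 1) P = -arcDeriv Ω (fun Q => tangent Ω Q 0) P :=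
  (hΩ.hasArcDerivAt_outerNormal_aux hP).2.arcDeriv_eq

theorem tangent_sq (hΩ : IsC2Domain Ω) {P : Plane} (hP : P ∈ frontier Ω) :
    tangent Ω P 0 ^ 2 + tangent Ω P 1 ^ 2 = 1 := by
  have := (norm_eq_one_iff_sq _).1 (hΩ.isOuterUnitNormal hP).1
  rw [outerNormal_zero_eq, outerNormal_one_eq] at this
  linarith

/-- Differentiation of `|τ|² = 1` along an arc through `P`. -/
theorem tangent_mul_arcDeriv (hΩ : IsC2Domain Ω) {P : Plane} (hP : P ∈ frontier Ω) :
    tangent Ω P 0 * arcDeriv Ω (fun Q => tangent Ω Q 0) P +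
      tangent Ω P 1 * arcDeriv Ω (fun Q => tangent Ω Q 1) P = 0 := by
  have h0 := hΩ.hasArcDerivAt_tangent hP 0
  have h1 := hΩ.hasArcDerivAt_tangent hP 1
  obtain ⟨a, b, ψ, hab, hψ, hP0⟩ := h0.1
  have d0 := h0.2 a b ψ hab hψ hP0
  have d1 := h1.2 a b ψ hab hψ hP0
  have d2 := (d0.pow 2).add (d1.pow 2)
  have d3 : HasDerivAt (fun s => tangent Ω (ψ s) 0 ^ 2 + tangent Ω (ψ s) 1 ^ 2) 0 0 := by
    refine (hasDerivAt_const (0 : ℝ) (1 : ℝ)).congr_of_eventuallyEq ?_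
    filter_upwards [isOpen_Ioo.mem_nhds hab] with s hs
    exact hΩ.tangent_sq (hψ s hs).1
  have := d2.unique d3
  simp only [hP0] at this
  norm_num at this
  linarith

/-- On the part of the boundary covered by a chart, `τ` coincides with `Γ' ∘ S`, which is continuous
on the plane. -/
theorem continuousOn_tangent (hΩ : IsC2Domain Ω) (α : Fin 2) :
    ContinuousOn (fun Q => tangent Ω Q α) (frontier Ω) := by
  intro P hP
  obtain ⟨Γ, S, U, H, hU⟩ := hΩ.exists_isArcChart hP
  have h1 : Continuous fun Q => deriv Γ (S Q) α :=
    (EuclideanSpace.proj (𝕜 := ℝ) α).continuous.comp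
      (H.contDiff_deriv.continuous.comp H.contDiff_coord.continuous)
  refine h1.continuousWithinAt.congr_of_eventuallyEq ?_ ?_
  · filter_upwards [self_mem_nhdsWithin, mem_nhdsWithin_of_mem_nhds (H.isOpen.mem_nhds hU)]
      with Q hQ hQU
    have hb := H.curve_coord Q hQ hQU
    rw [← H.tangent_eq (by rwa [hb]), hb]
  · have hb := H.curve_coord P hP hU
    rw [← H.tangent_eq (by rwa [hb]), hb]

theorem continuousOn_arcDeriv_tangent (hΩ : IsC2Domain Ω) (α : Fin 2) :
    ContinuousOn (arcDeriv Ω (fun Q => tangent Ω Q α)) (frontier Ω) := by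
  intro P hP
  obtain ⟨Γ, S, U, H, hU⟩ := hΩ.exists_isArcChart hP
  have h1 : Continuous fun Q => deriv (deriv Γ) (S Q) α :=
    (EuclideanSpace.proj (𝕜 := ℝ) α).continuous.comp
      (H.continuous_deriv_deriv.comp H.contDiff_coord.continuous)
  have h2 : ∀ Q ∈ frontier Ω, Q ∈ U →
      arcDeriv Ω (fun Q => tangent Ω Q α) Q = deriv (deriv Γ) (S Q) α := by
    intro Q hQ hQU
    have hb := H.curve_coord Q hQ hQU
    have := H.hasArcDerivAt_tangent (s := S Q) (by rwa [hb]) α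
    rw [hb] at this
    exact this.arcDeriv_eq
  refine h1.continuousWithinAt.congr_of_eventuallyEq ?_ (h2 P hP hU)
  filter_upwards [self_mem_nhdsWithin, mem_nhdsWithin_of_mem_nhds (H.isOpen.mem_nhds hU)]
    with Q hQ hQU using h2 Q hQ hQU

theorem continuousOn_outerNormal (hΩ : IsC2Domain Ω) (α : Fin 2) :
    ContinuousOn (fun Q => outerNormal Ω Q α) (frontier Ω) := by
  fin_cases α
  · exact hΩ.continuousOn_tangent 1
  · exact (hΩ.continuousOn_tangent 0).neg.congr fun Q _ => outerNormal_one_eq Ω Q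

theorem continuousOn_arcDeriv_outerNormal (hΩ : IsC2Domain Ω) (α : Fin 2) :
    ContinuousOn (arcDeriv Ω (fun Q => outerNormal Ω Q α)) (frontier Ω) := by
  fin_cases α
  · exact (hΩ.continuousOn_arcDeriv_tangent 1).congr fun Q hQ => hΩ.arcDeriv_outerNormal_zero hQ
  · exact (hΩ.continuousOn_arcDeriv_tangent 0).neg.congr
      fun Q hQ => hΩ.arcDeriv_outerNormal_one hQ

theorem isCompact_frontier (hΩ : IsC2Domain Ω) : IsCompact (frontier Ω) :=
  hΩ.isBounded.isCompact_closure.of_isClosed_subset isClosed_frontier frontier_subset_closure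

end IsC2Domain

/-! ### Comparison of the arclength measure with parametrizations -/

theorem arcMeasure_apply (Ω B : Set Plane) : arcMeasure Ω B = μH[1] (B ∩ frontier Ω) :=
  Measure.restrict_apply' isClosed_frontier.measurableSet

/-- A `C¹` parametrization of `∂Ω` near `P` dominates the arclength measure. -/
theorem exists_arcMeasure_inter_le {Ω U : Set Plane} {Φ : ℝ → Plane} {c : Plane → ℝ}
    (hΦ : ContDiff ℝ 1 Φ) (hc : Continuous c) (hU : IsOpen U)
    (hΦc : ∀ Q ∈ frontier Ω, Q ∈ U → Φ (c Q) = Q) {P : Plane} (hP : P ∈ U)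
    {V : Set ℝ} (hV : V ∈ 𝓝 (c P)) :
    ∃ (a b : ℝ) (K : NNReal) (U' : Set Plane), Ioo a b ⊆ V ∧ IsOpen U' ∧ P ∈ U' ∧
      ∀ B, arcMeasure Ω (B ∩ U') ≤ K * volume (Φ ⁻¹' B ∩ Ioo a b) := by
  obtain ⟨K, t, ht, hK⟩ := hΦ.contDiffAt.exists_lipschitzOnWith (x := c P)
  obtain ⟨a, b, hab, hsub⟩ := mem_nhds_iff_exists_Ioo_subset.1 (inter_mem hV ht)
  refine ⟨a, b, K, U ∩ c ⁻¹' Ioo a b, fun x hx => (hsub hx).1,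
    hU.inter (isOpen_Ioo.preimage hc), ⟨hP, hab⟩, fun B => ?_⟩
  rw [arcMeasure_apply]
  calc μH[1] (B ∩ (U ∩ c ⁻¹' Ioo a b) ∩ frontier Ω)
      ≤ μH[1] (Φ '' (Φ ⁻¹' B ∩ Ioo a b)) := by
        refine measure_mono ?_
        rintro Q ⟨⟨hQB, hQU, hQc⟩, hQ⟩
        have := hΦc Q hQ hQU
        exact ⟨c Q, ⟨by rwa [mem_preimage, this], hQc⟩, this⟩
    _ ≤ (K : ENNReal) ^ (1 : ℝ) * μH[1] (Φ ⁻¹' B ∩ Ioo a b) :=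
        (hK.mono fun x hx => (hsub hx.2).2).hausdorffMeasure_image_le zero_le_one
    _ = K * volume (Φ ⁻¹' B ∩ Ioo a b) := by rw [ENNReal.rpow_one, hausdorffMeasure_real]

theorem exists_arcMeasure_restrict_le {Ω U : Set Plane} {Φ : ℝ → Plane} {c : Plane → ℝ}
    (hΦ : ContDiff ℝ 1 Φ) (hc : Continuous c) (hU : IsOpen U)
    (hΦc : ∀ Q ∈ frontier Ω, Q ∈ U → Φ (c Q) = Q) {P : Plane} (hP : P ∈ U)
    {V : Set ℝ} (hV : V ∈ 𝓝 (c P)) :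
    ∃ (a b : ℝ) (K : NNReal) (U' : Set Plane), Ioo a b ⊆ V ∧ IsOpen U' ∧ P ∈ U' ∧
      (arcMeasure Ω).restrict U' ≤ (K : ENNReal) • (volume.restrict (Ioo a b)).map Φ := by
  obtain ⟨a, b, K, U', hV', hU', hPU', h⟩ := exists_arcMeasure_inter_le hΦ hc hU hΦc hP hV
  refine ⟨a, b, K, U', hV', hU', hPU', Measure.le_iff.2 fun B hB => ?_⟩
  rw [Measure.restrict_apply hB, Measure.smul_apply,
    Measure.map_apply hΦ.continuous.measurable hB,
    Measure.restrict_apply (hΦ.continuous.measurable hB), smul_eq_mul]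
  exact h B

/-- Locally the boundary is a Lipschitz image of a bounded interval, and it is compact. -/
theorem IsC2Domain.arcMeasure_univ_lt_top {Ω : Set Plane} (hΩ : IsC2Domain Ω) :
    arcMeasure Ω univ < ⊤ := by
  have h1 : arcMeasure Ω (frontier Ω) < ⊤ := by
    refine hΩ.isCompact_frontier.measure_lt_top_of_nhdsWithin fun P hP => ?_
    obtain ⟨Γ, S, U, H, hU⟩ := hΩ.exists_isArcChart hP
    obtain ⟨a, b, K, U', -, hU', hPU', hle⟩ := exists_arcMeasure_restrict_le
      (H.contDiff_curve.of_le (by norm_num)) H.contDiff_coord.continuous H.isOpen H.curve_coord hU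
      (univ_mem)
    refine ⟨U', mem_nhdsWithin_of_mem_nhds (hU'.mem_nhds hPU'), ?_⟩
    have := hle univ
    rw [Measure.restrict_apply_univ] at this
    refine this.trans_lt ?_
    rw [Measure.smul_apply, Measure.map_apply H.contDiff_curve.continuous.measurable
      MeasurableSet.univ, smul_eq_mul]
    refine ENNReal.mul_lt_top ENNReal.coe_lt_top ?_
    simp
  rw [arcMeasure_apply, inter_self] at h1
  rwa [arcMeasure_apply, univ_inter]

/-- On compact sets of parameters, an arc pulls back the arclength measure to a multiple of
the Lebesgue measure at least. -/
theorem IsC2Domain.exists_volume_preimage_le {Ω : Set Plane} (hΩ : IsC2Domain Ω) {a b : ℝ}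
    {ψ : ℝ → Plane} (hψ : IsArc Ω a b ψ) {K : Set ℝ} (hK : IsCompact K) (hKab : K ⊆ Ioo a b) :
    ∃ L : ENNReal, L ≠ ⊤ ∧ ∀ B, volume (K ∩ ψ ⁻¹' B) ≤ L * arcMeasure Ω B := by
  refine hK.induction_on (p := fun K => ∃ L : ENNReal, L ≠ ⊤ ∧
    ∀ B, volume (K ∩ ψ ⁻¹' B) ≤ L * arcMeasure Ω B) ?_ ?_ ?_ ?_
  · exact ⟨0, by simp, by simp⟩
  · rintro s t hst ⟨L, hL, h⟩
    exact ⟨L, hL, fun B => (measure_mono (inter_subset_inter_left _ hst)).trans (h B)⟩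
  · rintro s t ⟨L, hL, h⟩ ⟨L', hL', h'⟩
    refine ⟨L + L', by simp [hL, hL'], fun B => ?_⟩
    rw [union_inter_distrib_right, add_mul]
    exact (measure_union_le _ _).trans (add_le_add (h B) (h' B))
  · intro s₀ hs₀
    obtain ⟨hfr, hd⟩ := hψ s₀ (hKab hs₀)
    obtain ⟨Γ, S, U, H, hU⟩ := hΩ.exists_isArcChart hfr
    obtain ⟨L, W, hW, hL⟩ := (H.contDiff_coord.of_le (m := 1)
      (by norm_num)).contDiffAt.exists_lipschitzOnWith (x := ψ s₀)
    have hev := (H.arc_eq hψ (hKab hs₀) hU).and ((hd.continuousAt.eventually_mem hW).and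
      (show ∀ᶠ s in 𝓝 s₀, s ∈ Ioo a b from isOpen_Ioo.mem_nhds (hKab hs₀)))
    set c := S (ψ s₀) - s₀ with hc
    refine ⟨_, mem_nhdsWithin_of_mem_nhds hev, L, by simp, fun B => ?_⟩
    -- This map is a Lipschitz left inverse of `ψ` near `s₀`, so it bounds Lebesgue measure, which
    -- is `μH[1]` on the line, by the Hausdorff measure of the image.
    have hL' : LipschitzOnWith L (fun x => S x - c) W := by
      intro x hx y hy
      simpa using hL hx hy
    rw [arcMeasure_apply, ← hausdorffMeasure_real]
    calc μH[1] ({s | (ψ s = Γ (s + c) ∧ ψ s ∈ U) ∧ ψ s ∈ W ∧ s ∈ Ioo a b} ∩ ψ ⁻¹' B)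
        ≤ μH[1] ((fun x => S x - c) '' (B ∩ frontier Ω ∩ W)) := by
          refine measure_mono ?_
          rintro s ⟨⟨⟨h1, -⟩, h2, h3⟩, h4⟩
          refine ⟨ψ s, ⟨⟨h4, (hψ s h3).1⟩, h2⟩, ?_⟩
          simp only [h1, H.coord_curve, add_sub_cancel_right]
      _ ≤ (L : ENNReal) ^ (1 : ℝ) * μH[1] (B ∩ frontier Ω ∩ W) :=
          (hL'.mono inter_subset_right).hausdorffMeasure_image_le zero_le_one
      _ ≤ L * μH[1] (B ∩ frontier Ω) := by
          rw [ENNReal.rpow_one]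
          exact mul_le_mul' le_rfl (measure_mono inter_subset_left)

theorem IsArc.continuousOn {Ω : Set Plane} {a b : ℝ} {ψ : ℝ → Plane} (hψ : IsArc Ω a b ψ) :
    ContinuousOn ψ (Ioo a b) := fun s hs => (hψ s hs).2.continuousAt.continuousWithinAt

/-- The form of the comparison that restricts `L²(∂Ω)` functions to arcs. Compactness of `K`
matters: the constant is built from a finite cover. -/
theorem IsC2Domain.exists_map_le {Ω : Set Plane} (hΩ : IsC2Domain Ω) {a b : ℝ}
    {ψ : ℝ → Plane} (hψ : IsArc Ω a b ψ) {K : Set ℝ} (hK : IsCompact K) (hKab : K ⊆ Ioo a b) :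
    AEMeasurable ψ (volume.restrict K) ∧
    ∃ L : ENNReal, L ≠ ⊤ ∧ (volume.restrict K).map ψ ≤ L • arcMeasure Ω := by
  have hm : AEMeasurable ψ (volume.restrict K) :=
    (hψ.continuousOn.mono hKab).aemeasurable hK.measurableSet
  obtain ⟨L, hL, h⟩ := hΩ.exists_volume_preimage_le hψ hK hKab
  refine ⟨hm, L, hL, Measure.le_iff.2 fun B hB => ?_⟩
  rw [Measure.map_apply_of_aemeasurable hm hB, Measure.restrict_apply' hK.measurableSet, inter_comm]
  exact h B

theorem MeasureTheory.MemLp.comp_arc {Ω : Set Plane} (hΩ : IsC2Domain Ω) {a b : ℝ}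
    {ψ : ℝ → Plane} (hψ : IsArc Ω a b ψ) {K : Set ℝ} (hK : IsCompact K) (hKab : K ⊆ Ioo a b)
    {g : Plane → ℝ} (h : MemLp g 2 (arcMeasure Ω)) :
    MemLp (fun s => g (ψ s)) 2 (volume.restrict K) := by
  obtain ⟨hm, L, hL, hle⟩ := hΩ.exists_map_le hψ hK hKab
  exact (h.of_measure_le_smul hL hle).comp_of_map hm

theorem L2Tendsto.comp_arc {Ω : Set Plane} (hΩ : IsC2Domain Ω) {a b : ℝ}
    {ψ : ℝ → Plane} (hψ : IsArc Ω a b ψ) {K : Set ℝ} (hK : IsCompact K) (hKab : K ⊆ Ioo a b)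
    {f : ℕ → Plane → ℝ} {g : Plane → ℝ} (h : L2Tendsto (arcMeasure Ω) f g) :
    L2Tendsto (volume.restrict K) (fun j s => f j (ψ s)) (fun s => g (ψ s)) := by
  obtain ⟨hm, L, hL, hle⟩ := hΩ.exists_map_le hψ hK hKab
  have h2 := h.mono_measure hL hle
  refine ⟨fun j => (h2.memLp j).comp_of_map hm, h2.memLp_lim.comp_of_map hm,
    h2.tendsto.congr fun j => ?_⟩
  exact eLpNorm_map_measure ((h2.memLp j).sub h2.memLp_lim).1 hm

/-! ### The trace inequality -/

theorem measurePreserving_toPlane :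
    MeasurePreserving (fun p : ℝ × ℝ => (!₂[p.1, p.2] : Plane)) (volume.prod volume) volume :=
  ((EuclideanSpace.volume_preserving_symm_measurableEquiv_toLp (Fin 2)).symm _).comp
    ((volume_preserving_finTwoArrow ℝ).symm _)

/-- The linear isometry with matrix columns `a` and `rot a`. -/
noncomputable def frameIsometry (a : Plane) (ha : a 0 ^ 2 + a 1 ^ 2 = 1) : Plane →ₗᵢ[ℝ] Plane where
  toFun x := x 0 • a + x 1 • rot a
  map_add' x y := by simp only [PiLp.add_apply]; module
  map_smul' c x := by simp only [PiLp.smul_apply, smul_eq_mul, RingHom.id_apply]; module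
  norm_map' x := by
    change ‖x 0 • a + x 1 • rot a‖ = ‖x‖
    rw [← sq_eq_sq₀ (norm_nonneg _) (norm_nonneg _), plane_norm_sq, plane_norm_sq]
    simp only [rot, PiLp.add_apply, PiLp.smul_apply, Matrix.cons_val_zero,
      Matrix.cons_val_one, smul_eq_mul]
    linear_combination (x 0 ^ 2 + x 1 ^ 2) * ha

theorem measurePreserving_framePoint (P a : Plane) (ha : a 0 ^ 2 + a 1 ^ 2 = 1) :
    MeasurePreserving (fun p : ℝ × ℝ => framePoint P a p.1 p.2) (volume.prod volume) volume := by
  have h1 := ((frameIsometry a ha).toLinearIsometryEquiv rfl).measurePreserving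
  have h2 := (measurePreserving_add_left (volume : Measure Plane) P).comp
    (h1.comp measurePreserving_toPlane)
  convert! h2 using 1
  ext1 p
  rw [framePoint_eq, add_assoc]
  rfl

/-- Coordinates that flatten the boundary, with second coordinate the height above the graph: a
shear followed by a rigid motion. -/
theorem measurePreserving_graphShear (P a : Plane) (ha : a 0 ^ 2 + a 1 ^ 2 = 1) {g : ℝ → ℝ}
    (hg : Continuous g) :
    MeasurePreserving (fun p : ℝ × ℝ => framePoint P a p.1 (g p.1 + p.2)) (volume.prod volume)
      volume := by
  have h1 : MeasurePreserving (fun p : ℝ × ℝ => (p.1, g p.1 + p.2)) (volume.prod volume)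
      (volume.prod volume) := by
    refine (MeasurePreserving.id volume).skew_product (g := fun t z => g t + z) ?_ ?_
    · fun_prop
    · exact Eventually.of_forall fun t => (measurePreserving_add_left volume (g t)).map_eq
  exact (measurePreserving_framePoint P a ha).comp h1

/-- The derivative of `(z - δ) f²` is integrated over `[0, δ]`; the weight kills the term at `δ` and
leaves `δ f(0)²`. -/
theorem mul_sq_le_integral {f f' : ℝ → ℝ} (hf : ∀ z, HasDerivAt f (f' z) z)
    (hf' : Continuous f') {δ : ℝ} (hδ : 0 < δ) :
    δ * f 0 ^ 2 ≤ (1 + δ) * ∫ z in (0 : ℝ)..δ, (f z ^ 2 + f' z ^ 2) := by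
  have hfc : Continuous f := continuous_iff_continuousAt.2 fun z => (hf z).continuousAt
  have h1 : ∫ z in (0 : ℝ)..δ, (1 * f z ^ 2 + (z - δ) * (2 * f z * f' z)) =
      (δ - δ) * f δ ^ 2 - (0 - δ) * f 0 ^ 2 := by
    refine intervalIntegral.integral_eq_sub_of_hasDerivAt (f := fun z => (z - δ) * f z ^ 2) ?_ ?_
    · intro z _
      have := ((hasDerivAt_id z).sub_const δ).mul ((hf z).pow 2)
      simpa using! this
    · exact Continuous.intervalIntegrable (by fun_prop) _ _
  have h2 : δ * f 0 ^ 2 = ∫ z in (0 : ℝ)..δ, (1 * f z ^ 2 + (z - δ) * (2 * f z * f' z)) := by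
    rw [h1]; ring
  rw [h2, ← intervalIntegral.integral_const_mul]
  refine intervalIntegral.integral_mono_on hδ.le (Continuous.intervalIntegrable (by fun_prop) _ _)
    (Continuous.intervalIntegrable (by fun_prop) _ _) fun z hz => ?_
  -- Here `-2 f f' ≤ f² + f'²` is weighted by `δ - z`, which lies in `[0, δ]`.
  nlinarith [mul_nonneg (sub_nonneg.2 hz.2) (sq_nonneg (f z + f' z)), sq_nonneg (f z),
    sq_nonneg (f' z), mul_nonneg hz.1 (add_nonneg (sq_nonneg (f z)) (sq_nonneg (f' z)))]

/-- The density of the squared `H¹` norm. -/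
noncomputable def energy (v : Plane → ℝ) (x : Plane) : ENNReal :=
  ENNReal.ofReal (v x ^ 2 + (iterPartial [0] v x ^ 2 + iterPartial [1] v x ^ 2))

theorem fderiv_eq_iterPartial (v : Plane → ℝ) (x b : Plane) :
    fderiv ℝ v x b = b 0 * iterPartial [0] v x + b 1 * iterPartial [1] v x := by
  have : b = b 0 • EuclideanSpace.single 0 (1 : ℝ) + b 1 • EuclideanSpace.single 1 (1 : ℝ) := by
    ext i
    fin_cases i <;> simp
  conv_lhs => rw [this]
  simp [iterPartial]

theorem measurable_energy {v : Plane → ℝ} (hv : ContDiff ℝ ∞ v) : Measurable (energy v) := by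
  have h0 := (contDiff_iterPartial hv [0]).continuous
  have h1 := (contDiff_iterPartial hv [1]).continuous
  have h := hv.continuous
  unfold energy
  fun_prop

/-- The one-dimensional inequality is applied on segments of length `h / 2` rising from the graph
and integrated over `t`. Since `|g t| < h / 2`, the segments stay in the rectangle, so their
interior points belong to `Ω`. -/
theorem IsLocalGraph.lintegral_graph_le {Ω : Set Plane} (hΩ : IsOpen Ω) {P a : Plane} {r h : ℝ}
    {g : ℝ → ℝ} (H : IsLocalGraph Ω P a r h g) {V : Set ℝ}
    (hV : ∀ t ∈ V, |t| < r ∧ |g t| < h / 2) {v : Plane → ℝ} (hv : ContDiff ℝ ∞ v) :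
    ∫⁻ t in V, ENNReal.ofReal (v (framePoint P a t (g t)) ^ 2) ≤
      ENNReal.ofReal ((1 + h / 2) / (h / 2)) * ∫⁻ x in Ω, energy v x := by
  have hδ : 0 < h / 2 := half_pos H.h_pos
  have hgc := H.contDiff.continuous
  have key : ∀ t, ENNReal.ofReal (v (framePoint P a t (g t)) ^ 2) ≤
      ENNReal.ofReal ((1 + h / 2) / (h / 2)) *
        ∫⁻ z in Ioo 0 (h / 2), energy v (framePoint P a t (g t + z)) := by
    intro t
    set γ : ℝ → Plane := fun z => framePoint P a t (g t + z) with hγ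
    have hγd : ∀ z, HasDerivAt γ (rot a) z := by
      intro z
      have := (((hasDerivAt_id z).const_add (g t)).smul_const (rot a)).const_add (P + t • a)
      simp only [one_smul] at this
      simpa only [hγ, framePoint_eq, id] using! this
    have hγc : Continuous γ := continuous_iff_continuousAt.2 fun z => (hγd z).continuousAt
    have hd : ∀ z, HasDerivAt (fun z => v (γ z)) (fderiv ℝ v (γ z) (rot a)) z := fun z =>
      (hv.differentiable (by simp) (γ z)).hasFDerivAt.comp_hasDerivAt z (hγd z)
    have h0 := (contDiff_iterPartial hv [0]).continuous.comp hγc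
    have h1 := (contDiff_iterPartial hv [1]).continuous.comp hγc
    have hvγ := hv.continuous.comp hγc
    have hc : Continuous fun z => fderiv ℝ v (γ z) (rot a) := by
      simp only [fderiv_eq_iterPartial]
      exact (h0.const_mul _).add (h1.const_mul _)
    have h2 := mul_sq_le_integral hd hc hδ
    have h3 : v (framePoint P a t (g t)) ^ 2 ≤ (1 + h / 2) / (h / 2) *
        ∫ z in (0 : ℝ)..(h / 2), (v (γ z) ^ 2 +
          (iterPartial [0] v (γ z) ^ 2 + iterPartial [1] v (γ z) ^ 2)) := by
      have h4 : γ 0 = framePoint P a t (g t) := by simp [hγ]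
      rw [div_mul_eq_mul_div, le_div_iff₀ hδ, mul_comm, ← h4]
      refine h2.trans (mul_le_mul_of_nonneg_left ?_ (by linarith))
      refine intervalIntegral.integral_mono_on hδ.le
        (((hvγ.pow 2).add (hc.pow 2)).intervalIntegrable _ _)
        (((hvγ.pow 2).add ((h0.pow 2).add (h1.pow 2))).intervalIntegrable _ _) fun z _ => ?_
      rw [fderiv_eq_iterPartial]
      simp only [rot, Matrix.cons_val_zero, Matrix.cons_val_one]
      have hu := H.unit
      set p := iterPartial [0] v (γ z)
      set q := iterPartial [1] v (γ z)
      -- Lagrange's identity: the squared derivative along the unit vector `rot a` is at most the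
      -- squared gradient.
      have : p ^ 2 + q ^ 2 = (a 0 ^ 2 + a 1 ^ 2) * (p ^ 2 + q ^ 2) := by rw [hu, one_mul]
      rw [this]
      nlinarith [sq_nonneg (a 0 * p + a 1 * q)]
    refine (ENNReal.ofReal_le_ofReal h3).trans (le_of_eq ?_)
    rw [ENNReal.ofReal_mul (by positivity), intervalIntegral.integral_of_le hδ.le,
      integral_Ioc_eq_integral_Ioo, ofReal_integral_eq_lintegral_ofReal]
    · rfl
    · exact (((hvγ.pow 2).add ((h0.pow 2).add (h1.pow 2))).integrableOn_Icc).mono_set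
        Ioo_subset_Icc_self
    · exact Eventually.of_forall fun z => by positivity
  have hF := measurePreserving_graphShear P a H.unit hgc
  set F : ℝ × ℝ → Plane := fun p => framePoint P a p.1 (g p.1 + p.2) with hFdef
  have hEm : Measurable (energy v) := measurable_energy hv
  calc ∫⁻ t in V, ENNReal.ofReal (v (framePoint P a t (g t)) ^ 2)
      ≤ ∫⁻ t in V, ENNReal.ofReal ((1 + h / 2) / (h / 2)) *
        ∫⁻ z in Ioo 0 (h / 2), energy v (F (t, z)) := lintegral_mono fun t => key t
    _ = ENNReal.ofReal ((1 + h / 2) / (h / 2)) *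
        ∫⁻ t in V, ∫⁻ z in Ioo 0 (h / 2), energy v (F (t, z)) :=
        lintegral_const_mul' _ _ ENNReal.ofReal_ne_top
    _ = ENNReal.ofReal ((1 + h / 2) / (h / 2)) *
        ∫⁻ p in V ×ˢ Ioo 0 (h / 2), energy v (F p) ∂(volume.prod volume) := by
        rw [← Measure.prod_restrict, lintegral_prod]
        exact (hEm.comp hF.measurable).aemeasurable
    _ ≤ ENNReal.ofReal ((1 + h / 2) / (h / 2)) * ∫⁻ p in F ⁻¹' Ω, energy v (F p)
        ∂(volume.prod volume) := by
        refine mul_le_mul' le_rfl (lintegral_mono_set ?_)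
        rintro ⟨t, z⟩ ⟨ht, hz⟩
        obtain ⟨ht1, ht2⟩ := hV t ht
        simp only [mem_Ioo] at hz
        rw [mem_preimage, hFdef, H.mem_iff _ (by rwa [coordT_framePoint H.unit]),
          coordT_framePoint H.unit, coordN_framePoint H.unit]
        · linarith [hz.1]
        · rw [coordN_framePoint H.unit, abs_lt]
          rw [abs_lt] at ht2
          constructor <;> linarith [hz.1, hz.2, ht2.1, ht2.2]
    _ = ENNReal.ofReal ((1 + h / 2) / (h / 2)) * ∫⁻ x in Ω, energy v x := by
        rw [← hF.setLIntegral_comp_preimage hΩ.measurableSet hEm]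

/-- The estimate over one graph is localized and summed over a finite cover of the compact boundary;
each constant is independent of `v`. -/
theorem IsC2Domain.exists_lintegral_arcMeasure_le {Ω : Set Plane} (hΩ : IsC2Domain Ω) :
    ∃ C : ENNReal, C ≠ ⊤ ∧ ∀ v : Plane → ℝ, ContDiff ℝ ∞ v →
      ∫⁻ x, ENNReal.ofReal (v x ^ 2) ∂(arcMeasure Ω) ≤ C * ∫⁻ x in Ω, energy v x := by
  have h1 : ∃ C : ENNReal, C ≠ ⊤ ∧ ∀ v : Plane → ℝ, ContDiff ℝ ∞ v →
      ∫⁻ x in frontier Ω, ENNReal.ofReal (v x ^ 2) ∂(arcMeasure Ω) ≤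
        C * ∫⁻ x in Ω, energy v x := by
    refine hΩ.isCompact_frontier.induction_on (p := fun s => ∃ C : ENNReal, C ≠ ⊤ ∧
      ∀ v : Plane → ℝ, ContDiff ℝ ∞ v → ∫⁻ x in s, ENNReal.ofReal (v x ^ 2) ∂(arcMeasure Ω) ≤
        C * ∫⁻ x in Ω, energy v x) ?_ ?_ ?_ ?_
    · exact ⟨0, by simp, by simp⟩
    · rintro s t hst ⟨C, hC, h⟩
      exact ⟨C, hC, fun v hv => (lintegral_mono_set hst).trans (h v hv)⟩
    · rintro s t ⟨C, hC, h⟩ ⟨C', hC', h'⟩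
      refine ⟨C + C', by simp [hC, hC'], fun v hv => ?_⟩
      rw [add_mul]
      exact (lintegral_union_le _ _ _).trans (add_le_add (h v hv) (h' v hv))
    · intro P hP
      obtain ⟨a, r, h, g, H⟩ := hΩ.exists_isLocalGraph hP
      have hg := H.contDiff.of_le (m := 1) (by norm_num)
      have hΦ : ContDiff ℝ 1 fun t => framePoint P a t (g t) := by
        simp only [framePoint_eq]; fun_prop
      have hev : ∀ᶠ t in 𝓝 (coordT P a P), |t| < r ∧ |g t| < h / 2 := by
        have e0 : coordT P a P = 0 := by simp [coordT]
        rw [e0]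
        refine (continuous_abs.continuousAt.eventually (gt_mem_nhds (by simpa using H.r_pos))).and
          (hg.continuous.abs.continuousAt.eventually (gt_mem_nhds ?_))
        simpa [H.zero] using H.h_pos
      obtain ⟨b, c, K, U', hV, hU', hPU', hle⟩ := exists_arcMeasure_restrict_le hΦ
        (continuous_coordT P a) IsLocalGraph.isOpen_rect
        (fun Q hQ hQU => by
          rw [(H.mem_frontier_iff hΩ.isOpen hQU).1 hQ, framePoint_coord H.unit])
        H.self_mem_rect hev
      refine ⟨U', mem_nhdsWithin_of_mem_nhds (hU'.mem_nhds hPU'),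
        K * ENNReal.ofReal ((1 + h / 2) / (h / 2)),
        ENNReal.mul_ne_top ENNReal.coe_ne_top ENNReal.ofReal_ne_top, fun v hv => ?_⟩
      have hvm : Measurable fun x => ENNReal.ofReal (v x ^ 2) :=
        (hv.continuous.pow 2).measurable.ennreal_ofReal
      calc ∫⁻ x in U', ENNReal.ofReal (v x ^ 2) ∂(arcMeasure Ω)
          ≤ ∫⁻ x, ENNReal.ofReal (v x ^ 2) ∂((K : ENNReal) • (volume.restrict (Ioo b c)).map
              fun t => framePoint P a t (g t)) := lintegral_mono' hle le_rfl
        _ = K * ∫⁻ t in Ioo b c, ENNReal.ofReal (v (framePoint P a t (g t)) ^ 2) := by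
            rw [lintegral_smul_measure, lintegral_map hvm hΦ.continuous.measurable, smul_eq_mul]
        _ ≤ _ := by
            rw [mul_assoc]
            exact mul_le_mul' le_rfl
              (H.lintegral_graph_le hΩ.isOpen (fun t ht => hV ht) hv)
  have h2 : (arcMeasure Ω).restrict (frontier Ω) = arcMeasure Ω :=
    Measure.restrict_restrict_of_subset Subset.rfl
  rwa [h2] at h1

theorem eLpNorm_two_eq {X : Type*} [MeasurableSpace X] (μ : Measure X) (f : X → ℝ) :
    eLpNorm f 2 μ = (∫⁻ x, ENNReal.ofReal (f x ^ 2) ∂μ) ^ (1 / 2 : ℝ) := by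
  rw [eLpNorm_eq_lintegral_rpow_enorm_toReal two_ne_zero ENNReal.ofNat_ne_top]
  simp only [ENNReal.toReal_ofNat]
  congr 2
  ext x
  rw [← Real.enorm_of_nonneg (sq_nonneg (f x)), enorm_pow]
  norm_cast

/-- The trace inequality for smooth functions. -/
theorem IsC2Domain.exists_eLpNorm_arcMeasure_le {Ω : Set Plane} (hΩ : IsC2Domain Ω) :
    ∃ C : ENNReal, C ≠ ⊤ ∧ ∀ v : Plane → ℝ, ContDiff ℝ ∞ v →
      eLpNorm v 2 (arcMeasure Ω) ≤ C * (eLpNorm v 2 (volume.restrict Ω) +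
        (eLpNorm (iterPartial [0] v) 2 (volume.restrict Ω) +
          eLpNorm (iterPartial [1] v) 2 (volume.restrict Ω))) := by
  obtain ⟨C, hC, h⟩ := hΩ.exists_lintegral_arcMeasure_le
  refine ⟨C ^ (1 / 2 : ℝ), ENNReal.rpow_ne_top_of_nonneg (by norm_num) hC, fun v hv => ?_⟩
  have h0 := (contDiff_iterPartial hv [0]).continuous
  have h1 := (contDiff_iterPartial hv [1]).continuous
  have hm := hv.continuous
  simp only [eLpNorm_two_eq]
  have e1 : ∫⁻ x in Ω, energy v x = (∫⁻ x in Ω, ENNReal.ofReal (v x ^ 2)) +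
      ((∫⁻ x in Ω, ENNReal.ofReal (iterPartial [0] v x ^ 2)) +
        ∫⁻ x in Ω, ENNReal.ofReal (iterPartial [1] v x ^ 2)) := by
    rw [← lintegral_add_left (by fun_prop), ← lintegral_add_left (by fun_prop)]
    congr 1
    ext x
    rw [energy, ENNReal.ofReal_add (by positivity) (by positivity),
      ENNReal.ofReal_add (by positivity) (by positivity)]
  calc (∫⁻ x, ENNReal.ofReal (v x ^ 2) ∂(arcMeasure Ω)) ^ (1 / 2 : ℝ)
      ≤ (C * ∫⁻ x in Ω, energy v x) ^ (1 / 2 : ℝ) :=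
        ENNReal.rpow_le_rpow (h v hv) (by norm_num)
    _ ≤ _ := by
        rw [ENNReal.mul_rpow_of_nonneg _ _ (by norm_num), e1]
        refine mul_le_mul' le_rfl ((ENNReal.rpow_add_le_add_rpow _ _ (by norm_num)
          (by norm_num)).trans (add_le_add le_rfl ?_))
        exact ENNReal.rpow_add_le_add_rpow _ _ (by norm_num) (by norm_num)

/-! ### Mollification -/

/-- Continuity of translation in `L²`, expressed through integrals of squares. -/
theorem tendsto_lintegral_translate_sub {f : Plane → ℝ} (hf : MemLp f 2 volume) :
    Tendsto (fun y => ∫⁻ x, ENNReal.ofReal ((f (x - y) - f x) ^ 2)) (𝓝 0) (𝓝 0) := by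
  set τ : C(Plane, C(Plane, Plane)) :=
    (ContinuousMap.mk (fun p : Plane × Plane => p.2 - p.1) (by fun_prop)).curry with hτ
  have hmp : ∀ y, MeasurePreserving (τ y) volume volume := fun y =>
    measurePreserving_sub_right volume y
  have h1 : Continuous fun y => Lp.compMeasurePreserving (τ y) (hmp y) (hf.toLp f) :=
    continuous_const.compMeasurePreservingLp τ.continuous hmp (by norm_num)
  have h2 : Tendsto (fun y => edist (Lp.compMeasurePreserving (τ y) (hmp y) (hf.toLp f))
      (Lp.compMeasurePreserving (τ 0) (hmp 0) (hf.toLp f))) (𝓝 0) (𝓝 0) := by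
    have := (h1.edist (continuous_const
      (y := Lp.compMeasurePreserving (τ 0) (hmp 0) (hf.toLp f)))).tendsto (0 : Plane)
    rwa [edist_self] at this
  have hco : ∀ y, (Lp.compMeasurePreserving (τ y) (hmp y) (hf.toLp f) : Plane → ℝ) =ᵐ[volume]
      fun x => f (x - y) := fun y =>
    (Lp.coeFn_compMeasurePreserving _ (hmp y)).trans
      ((hmp y).quasiMeasurePreserving.ae_eq_comp hf.coeFn_toLp)
  have h3 : ∀ y, ∫⁻ x, ENNReal.ofReal ((f (x - y) - f x) ^ 2) =
      edist (Lp.compMeasurePreserving (τ y) (hmp y) (hf.toLp f))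
        (Lp.compMeasurePreserving (τ 0) (hmp 0) (hf.toLp f)) ^ (2 : ℝ) := by
    intro y
    have : edist (Lp.compMeasurePreserving (τ y) (hmp y) (hf.toLp f))
        (Lp.compMeasurePreserving (τ 0) (hmp 0) (hf.toLp f)) =
        eLpNorm (fun x => f (x - y) - f x) 2 volume := by
      rw [Lp.edist_def]
      refine eLpNorm_congr_ae ?_
      filter_upwards [hco y, hco 0] with x hx hx0
      rw [Pi.sub_apply, hx, hx0, sub_zero]
    rw [this, eLpNorm_two_eq, ← ENNReal.rpow_mul]
    norm_num
  simp_rw [h3]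
  have := h2.ennrpow_const 2
  simpa using this

/-- Jensen's inequality for the square: with `m` the mean of `u`, expand `0 ≤ ∫ φ (u - m)²`. -/
theorem ofReal_sq_integral_mul_le {X : Type*} [MeasurableSpace X] {μ : Measure X} {φ u : X → ℝ}
    (hφ0 : ∀ x, 0 ≤ φ x) (hφ : Integrable φ μ) (hφ1 : ∫ x, φ x ∂μ = 1)
    (hu : AEStronglyMeasurable u μ) (hφu : Integrable (fun x => φ x * u x) μ) :
    ENNReal.ofReal ((∫ x, φ x * u x ∂μ) ^ 2) ≤ ∫⁻ x, ENNReal.ofReal (φ x * u x ^ 2) ∂μ := by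
  by_cases htop : ∫⁻ x, ENNReal.ofReal (φ x * u x ^ 2) ∂μ = ⊤
  · rw [htop]; exact le_top
  have hint : Integrable (fun x => φ x * u x ^ 2) μ := by
    refine ⟨hφ.1.mul (hu.pow 2), ?_⟩
    rw [hasFiniteIntegral_iff_ofReal (Eventually.of_forall fun x =>
      mul_nonneg (hφ0 x) (sq_nonneg _))]
    exact lt_top_iff_ne_top.2 htop
  rw [← ofReal_integral_eq_lintegral_ofReal hint (Eventually.of_forall fun x =>
      mul_nonneg (hφ0 x) (sq_nonneg _))]
  refine ENNReal.ofReal_le_ofReal ?_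
  set m := ∫ x, φ x * u x ∂μ with hm
  have h1 : 0 ≤ ∫ x, (φ x * u x ^ 2 - 2 * m * (φ x * u x) + m ^ 2 * φ x) ∂μ := by
    refine integral_nonneg fun x => ?_
    have : φ x * u x ^ 2 - 2 * m * (φ x * u x) + m ^ 2 * φ x = φ x * (u x - m) ^ 2 := by ring
    simp only [this]
    exact mul_nonneg (hφ0 x) (sq_nonneg _)
  rw [integral_add (by exact hint.sub (hφu.const_mul _)) (hφ.const_mul _),
    integral_sub hint (hφu.const_mul _), integral_const_mul, integral_const_mul, hφ1, ← hm] at h1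
  nlinarith

/-- The convolution `φ ⋆ f`. -/
noncomputable def mollify (φ f : Plane → ℝ) (x : Plane) : ℝ := ∫ y, φ y * f (x - y)

theorem mollify_eq_convolution (φ f : Plane → ℝ) :
    mollify φ f = convolution φ f (ContinuousLinearMap.mul ℝ ℝ) volume := rfl

theorem contDiff_mollify {φ f : Plane → ℝ} (hφ : ContDiff ℝ ∞ φ) (hc : HasCompactSupport φ)
    (hf : LocallyIntegrable f volume) : ContDiff ℝ ∞ (mollify φ f) := by
  rw [mollify_eq_convolution]
  exact hc.contDiff_convolution_left _ hφ hf

theorem iterPartial_mollify {φ f : Plane → ℝ} (hφ : ContDiff ℝ ∞ φ) (hc : HasCompactSupport φ)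
    (hf : LocallyIntegrable f volume) (l : List (Fin 2)) :
    iterPartial l (mollify φ f) = mollify (iterPartial l φ) f := by
  induction l with
  | nil => rfl
  | cons i l ih =>
    have hl := contDiff_iterPartial hφ l
    have hlc := hasCompactSupport_iterPartial hc l
    ext x
    have h1 := hlc.hasFDerivAt_convolution_left (ContinuousLinearMap.mul ℝ ℝ)
      (hl.of_le (by simp)) hf x
    rw [← mollify_eq_convolution] at h1
    simp only [iterPartial, ih]
    rw [h1.fderiv, convolution, ContinuousLinearMap.integral_apply]
    · rfl
    · exact (hlc.fderiv ℝ).convolutionExists_left _ (hl.continuous_fderiv (by simp)) hf x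

theorem integrable_mul_translate {φ f : Plane → ℝ} (hφ : Continuous φ) (hc : HasCompactSupport φ)
    (hf : LocallyIntegrable f volume) (x : Plane) :
    Integrable (fun y => φ y * f (x - y)) volume :=
  hc.convolutionExists_left (ContinuousLinearMap.mul ℝ ℝ) hφ hf x

/-- The error `φ ⋆ f - f` is an average of translation differences of `f`; Jensen's inequality and
Tonelli's theorem bound its squared norm by the average of theirs. -/
theorem lintegral_mollify_sub_le {φ f : Plane → ℝ} (hφ : Continuous φ) (hc : HasCompactSupport φ)
    (hφ0 : ∀ x, 0 ≤ φ x) (hφ1 : ∫ x, φ x = 1) (hf : MemLp f 2 volume) {M : ENNReal}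
    (hM : ∀ y, φ y ≠ 0 → ∫⁻ x, ENNReal.ofReal ((f (x - y) - f x) ^ 2) ≤ M) :
    ∫⁻ x, ENNReal.ofReal ((mollify φ f x - f x) ^ 2) ≤ M := by
  -- Tonelli's theorem is applied to a jointly measurable integrand, and passing to a measurable
  -- representative changes neither integral.
  wlog hfm : Measurable f generalizing f
  · have hae := hf.1.ae_eq_mk
    set f' := hf.1.mk f with hf'
    have hqm : ∀ y : Plane, (fun x => f (x - y)) =ᵐ[volume] fun x => f' (x - y) := fun y =>
      (measurePreserving_sub_right volume y).quasiMeasurePreserving.ae_eq_comp hae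
    have hmol : mollify φ f = mollify φ f' := by
      rw [mollify_eq_convolution, mollify_eq_convolution]
      exact convolution_congr _ (ae_eq_refl _) hae
    have := this (f := f') (hf.ae_eq hae) ?_ hf.1.stronglyMeasurable_mk.measurable
    · rw [hmol]
      refine le_trans (le_of_eq ?_) this
      refine lintegral_congr_ae ?_
      filter_upwards [hae] with x hx
      rw [hx]
    · intro y hy
      refine le_trans (le_of_eq ?_) (hM y hy)
      refine lintegral_congr_ae ?_
      filter_upwards [hae, hqm y] with x hx hxy
      rw [hx, hxy]
  have hfl : LocallyIntegrable f volume := hf.locallyIntegrable one_le_two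
  have hφi : Integrable φ volume := hφ.integrable_of_hasCompactSupport hc
  calc ∫⁻ x, ENNReal.ofReal ((mollify φ f x - f x) ^ 2)
      ≤ ∫⁻ x, ∫⁻ y, ENNReal.ofReal (φ y * (f (x - y) - f x) ^ 2) := by
        refine lintegral_mono fun x => ?_
        have hi := integrable_mul_translate hφ hc hfl x
        have e1 : mollify φ f x - f x = ∫ y, φ y * (f (x - y) - f x) := by
          simp only [mul_sub]
          rw [integral_sub hi (hφi.mul_const _), integral_mul_const, hφ1, one_mul]
          rfl
        rw [e1]
        refine ofReal_sq_integral_mul_le hφ0 hφi hφ1 ?_ ?_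
        · exact ((hfm.comp (measurable_const.sub measurable_id)).sub_const _).aestronglyMeasurable
        · simp only [mul_sub]
          exact hi.sub (hφi.mul_const _)
    _ = ∫⁻ y, ∫⁻ x, ENNReal.ofReal (φ y * (f (x - y) - f x) ^ 2) := by
        refine lintegral_lintegral_swap (Measurable.aemeasurable ?_)
        have := hφ.measurable
        simp only [Function.uncurry_def]
        fun_prop
    _ ≤ ∫⁻ y, ENNReal.ofReal (φ y) * M := by
        refine lintegral_mono fun y => ?_
        simp only [ENNReal.ofReal_mul (hφ0 y)]
        rw [lintegral_const_mul' _ _ ENNReal.ofReal_ne_top]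
        by_cases hy : φ y = 0
        · simp [hy]
        · exact mul_le_mul' le_rfl (hM y hy)
    _ = M := by
        rw [lintegral_mul_const _ hφ.measurable.ennreal_ofReal,
          ← ofReal_integral_eq_lintegral_ofReal hφi (Eventually.of_forall hφ0), hφ1]
        simp

/-- Mollifications with kernels whose supports shrink to the origin converge in `L²`. -/
theorem l2Tendsto_mollify {φ : ℕ → Plane → ℝ} {f : Plane → ℝ} (hφ : ∀ j, Continuous (φ j))
    (hc : ∀ j, HasCompactSupport (φ j)) (hφ0 : ∀ j x, 0 ≤ φ j x) (hφ1 : ∀ j, ∫ x, φ j x = 1)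
    (hsupp : ∀ V ∈ 𝓝 (0 : Plane), ∀ᶠ j in atTop, ∀ y, φ j y ≠ 0 → y ∈ V)
    (hf : MemLp f 2 volume) :
    L2Tendsto volume (fun j => mollify (φ j) f) f := by
  have hfl : LocallyIntegrable f volume := hf.locallyIntegrable one_le_two
  have htend : Tendsto (fun j => ∫⁻ x, ENNReal.ofReal ((mollify (φ j) f x - f x) ^ 2)) atTop
      (𝓝 0) := by
    rw [ENNReal.tendsto_nhds_zero]
    intro ε hε
    filter_upwards [hsupp _ (ENNReal.tendsto_nhds_zero.1 (tendsto_lintegral_translate_sub hf) ε hε)]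
      with j hj
    exact lintegral_mollify_sub_le (hφ j) (hc j) (hφ0 j) (hφ1 j) hf hj
  refine ⟨fun j => ?_, hf, ?_⟩
  · have hcont : Continuous (mollify (φ j) f) := by
      rw [mollify_eq_convolution]
      exact (hc j).continuous_convolution_left _ (hφ j) hfl
    have h1 : MemLp (fun x => mollify (φ j) f x - f x) 2 volume := by
      refine ⟨hcont.aestronglyMeasurable.sub hf.1, ?_⟩
      rw [eLpNorm_two_eq]
      refine ENNReal.rpow_lt_top_of_nonneg (by norm_num) ?_
      -- The crude bound by `(2 ‖f‖)²`, valid for every `y`, is enough for the mollification to be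
      -- in `L²`.
      have hbd : ∀ y, ∫⁻ x, ENNReal.ofReal ((f (x - y) - f x) ^ 2) ≤
          (eLpNorm f 2 volume + eLpNorm f 2 volume) ^ (2 : ℝ) := by
        intro y
        have hmp := measurePreserving_sub_right (volume : Measure Plane) y
        have h2 : eLpNorm (fun x => f (x - y) - f x) 2 volume ≤
            eLpNorm f 2 volume + eLpNorm f 2 volume := by
          refine (eLpNorm_two_le_add_of_sub (hf.comp_measurePreserving hmp) hf
            fun x => rfl).trans (le_of_eq ?_)
          rw [eLpNorm_comp_measurePreserving hf.1 hmp]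
        rw [eLpNorm_two_eq] at h2
        have h3 := ENNReal.rpow_le_rpow h2 (zero_le_two : (0 : ℝ) ≤ 2)
        rw [← ENNReal.rpow_mul] at h3
        norm_num at h3 ⊢
        exact h3
      refine ((lintegral_mollify_sub_le (hφ j) (hc j) (hφ0 j) (hφ1 j) hf
        fun y _ => hbd y).trans_lt ?_).ne
      exact ENNReal.rpow_lt_top_of_nonneg zero_le_two
        (ENNReal.add_ne_top.2 ⟨hf.2.ne, hf.2.ne⟩)
    have := h1.add hf
    refine this.ae_eq (Eventually.of_forall fun x => by simp)
  · simp only [eLpNorm_two_eq]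
    have := htend.ennrpow_const (1 / 2)
    simpa using this

/-! ### Density of smooth functions -/

/-- From the points of `Ω` in `U` one can move a little in the directions of a cone around `e`
without leaving `Ω`. -/
def HasCone (Ω U : Set Plane) (e : Plane) (κ δ : ℝ) : Prop :=
  ∀ x ∈ U, x ∈ Ω → ∀ t, 0 < t → t < δ → ∀ y : Plane, ‖y + t • e‖ ≤ t * κ → x - y ∈ Ω

/-- A `C¹` graph is locally Lipschitz, so steps close to the upward direction `rot a` gain more
height than the graph can. -/
theorem IsLocalGraph.exists_hasCone {Ω : Set Plane} {P a : Plane} {r h : ℝ} {g : ℝ → ℝ}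
    (H : IsLocalGraph Ω P a r h g) :
    ∃ (U : Set Plane) (e : Plane) (κ δ : ℝ), IsOpen U ∧ P ∈ U ∧ 0 < κ ∧ 0 < δ ∧
      HasCone Ω U e κ δ := by
  obtain ⟨K, s, hs, hK⟩ := (H.contDiff.of_le (m := 1)
    (by norm_num)).contDiffAt.exists_lipschitzOnWith (x := (0 : ℝ))
  obtain ⟨ε, hε, hball⟩ := Metric.mem_nhds_iff.1 hs
  have hr := H.r_pos
  have hh := H.h_pos
  set ρ := min ε r with hρ
  have hρ0 : 0 < ρ := lt_min hε hr
  have hKn : (0 : ℝ) ≤ K := K.coe_nonneg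
  -- A step gains height at least `t - t κ = (K + 1) t κ`, while the graph rises by at most `K t κ`.
  set κ : ℝ := 1 / (K + 2) with hκ
  have hκ0 : 0 < κ := by positivity
  have hκ1 : κ * (K + 2) = 1 := by rw [hκ]; field_simp
  have hκle : κ ≤ 1 := by nlinarith
  -- The displaced point stays in the larger rectangle: it moves by at most `t κ ≤ t < ρ / 2` along
  -- `a`, and by at most `t + t κ ≤ 2 t < h / 2` along `rot a`.
  refine ⟨rect P a (ρ / 2) (h / 2), rot a, κ, min (ρ / 2) (h / 4), isOpen_rect, ?_, hκ0,
    lt_min (by linarith) (by linarith), ?_⟩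
  · simp [rect, coordT, coordN, hρ0, hh]
  intro x hxU hxΩ t ht htδ y hy
  obtain ⟨hT, hN⟩ := hxU
  have ht1 := htδ.trans_le (min_le_left _ _)
  have ht2 := htδ.trans_le (min_le_right _ _)
  have hρε : ρ ≤ ε := min_le_left _ _
  have hρr : ρ ≤ r := min_le_right _ _
  set u := y + t • rot a with hu
  have hu0 : u 0 = y 0 + t * -(a 1) := by simp [hu, rot]
  have hu1 : u 1 = y 1 + t * a 0 := by simp [hu, rot]
  have hsq : u 0 ^ 2 + u 1 ^ 2 ≤ (t * κ) ^ 2 := by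
    rw [← plane_norm_sq]; exact pow_le_pow_left₀ (norm_nonneg _) hy 2
  have hunit := H.unit
  have htκ : 0 < t * κ := mul_pos ht hκ0
  have hid : (a 0 * u 0 + a 1 * u 1) ^ 2 + (-(a 1) * u 0 + a 0 * u 1) ^ 2 = u 0 ^ 2 + u 1 ^ 2 := by
    linear_combination (u 0 ^ 2 + u 1 ^ 2) * hunit
  have b1 : |a 0 * u 0 + a 1 * u 1| ≤ t * κ :=
    abs_le_of_sq_le_sq (by nlinarith [sq_nonneg (-(a 1) * u 0 + a 0 * u 1)]) htκ.le
  have b2 : |-(a 1) * u 0 + a 0 * u 1| ≤ t * κ :=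
    abs_le_of_sq_le_sq (by nlinarith [sq_nonneg (a 0 * u 0 + a 1 * u 1)]) htκ.le
  have cT : coordT P a (x - y) = coordT P a x - (a 0 * u 0 + a 1 * u 1) := by
    simp only [coordT, PiLp.sub_apply, hu0, hu1]; ring
  have cN : coordN P a (x - y) = coordN P a x + t - (-(a 1) * u 0 + a 0 * u 1) := by
    simp only [coordN, PiLp.sub_apply, hu0, hu1]
    linear_combination t * hunit
  rw [abs_lt] at hT hN
  rw [abs_le] at b1 b2
  have htκ1 : t * κ ≤ t := by nlinarith
  have hT' : |coordT P a (x - y)| < ρ := by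
    rw [cT, abs_lt]; constructor <;> linarith [b1.1, b1.2, hT.1, hT.2]
  have hN' : |coordN P a (x - y)| < h := by
    rw [cN, abs_lt]; constructor <;> linarith [b2.1, b2.2, hN.1, hN.2]
  rw [H.mem_iff _ (hT'.trans_le hρr) hN']
  have hxg : g (coordT P a x) < coordN P a x :=
    (H.mem_iff x (by rw [abs_lt]; constructor <;> linarith [hT.1, hT.2])
      (by rw [abs_lt]; constructor <;> linarith [hN.1, hN.2])).1 hxΩ
  have hlip := hK.dist_le_mul (coordT P a (x - y))
    (hball (by rw [Metric.mem_ball, dist_zero_right]; exact hT'.trans_le hρε)) (coordT P a x)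
    (hball (by
      rw [Metric.mem_ball, dist_zero_right, Real.norm_eq_abs, abs_lt]
      constructor <;> linarith [hT.1, hT.2]))
  rw [Real.dist_eq, Real.dist_eq] at hlip
  have hd : |coordT P a (x - y) - coordT P a x| ≤ t * κ := by
    rw [cT, abs_le]; constructor <;> linarith [b1.1, b1.2]
  have h1 : g (coordT P a (x - y)) - g (coordT P a x) ≤ K * (t * κ) :=
    (le_abs_self _).trans (hlip.trans (mul_le_mul_of_nonneg_left hd hKn))
  have h2 : K * (t * κ) + 2 * (t * κ) = t := by linear_combination t * hκ1
  rw [cN]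
  linarith [b2.2]

/-- At interior points no displacement is needed: `e = 0` gives ordinary mollification. -/
theorem IsC2Domain.exists_hasCone {Ω : Set Plane} (hΩ : IsC2Domain Ω) {P : Plane}
    (hP : P ∈ closure Ω) :
    ∃ (U : Set Plane) (e : Plane) (κ δ : ℝ), IsOpen U ∧ P ∈ U ∧ 0 < κ ∧ 0 < δ ∧
      HasCone Ω U e κ δ := by
  by_cases hPΩ : P ∈ Ω
  · obtain ⟨ε, hε, hball⟩ := Metric.isOpen_iff.1 hΩ.isOpen P hPΩ
    refine ⟨Metric.ball P (ε / 2), 0, 1, ε / 2, Metric.isOpen_ball,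
      Metric.mem_ball_self (half_pos hε), one_pos, half_pos hε, ?_⟩
    intro x hx _ t _ ht y hy
    refine hball ?_
    rw [Metric.mem_ball, dist_eq_norm] at hx ⊢
    have h1 : x - y - P = (x - P) - y := by abel
    rw [h1]
    simp only [smul_zero, add_zero, mul_one] at hy
    linarith [norm_sub_le (x - P) y]
  · obtain ⟨a, r, h, g, H⟩ := hΩ.exists_isLocalGraph (P := P)
      (by rw [hΩ.isOpen.frontier_eq]; exact ⟨hP, hPΩ⟩)
    exact H.exists_hasCone

/-! ### Local approximation by displaced mollifiers. -/

theorem iterPartial_comp_const_sub {φ : Plane → ℝ} (hφ : ContDiff ℝ ∞ φ) (x : Plane)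
    (l : List (Fin 2)) :
    iterPartial l (fun z => φ (x - z)) = fun z => (-1) ^ l.length * iterPartial l φ (x - z) := by
  induction l with
  | nil => ext z; simp [iterPartial]
  | cons i l ih =>
    simp only [iterPartial, ih]
    ext z
    have h1 : HasFDerivAt (fun z : Plane => x - z) (-ContinuousLinearMap.id ℝ Plane) z := by
      simpa using! (hasFDerivAt_id z).const_sub x
    have h2 := (differentiable_iterPartial hφ l (x - z)).hasFDerivAt.comp z h1
    have h3 := h2.const_mul ((-1 : ℝ) ^ l.length)
    rw [show (fun z => (-1 : ℝ) ^ l.length * iterPartial l φ (x - z)) =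
      fun z => (-1 : ℝ) ^ l.length * (iterPartial l φ ∘ fun z => x - z) z from rfl, h3.fderiv]
    simp [pow_succ]

/-- Differentiation of a mollification, where the kernel sees only points of `Ω`. -/
theorem HasWeakDeriv.iterPartial_mollify {Ω : Set Plane} (hΩ : IsOpen Ω) {l : List (Fin 2)}
    {w d φ : Plane → ℝ} (hd : HasWeakDeriv Ω l w d) (hw : LocallyIntegrable (Ω.indicator w) volume)
    (hφ : ContDiff ℝ ∞ φ) (hc : HasCompactSupport φ) {x : Plane}
    (hx : ∀ y ∈ tsupport φ, x - y ∈ Ω) :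
    iterPartial l (mollify φ (Ω.indicator w)) x = mollify φ (Ω.indicator d) x := by
  rw [_root_.iterPartial_mollify hφ hc hw]
  have hsub : ∀ (ψ f : Plane → ℝ), mollify ψ (Ω.indicator f) x = ∫ z in Ω, f z * ψ (x - z) := by
    intro ψ f
    rw [mollify, ← integral_sub_left_eq_self _ volume x, ← integral_indicator hΩ.measurableSet]
    congr 1
    ext z
    rw [sub_sub_cancel]
    by_cases hz : z ∈ Ω
    · simp [hz, mul_comm]
    · simp [hz]
  rw [hsub, hsub]
  have hψ : ContDiff ℝ ∞ fun z => φ (x - z) := hφ.comp (contDiff_const.sub contDiff_id)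
  have hts : tsupport (fun z => φ (x - z)) ⊆ (fun z => x - z) ⁻¹' tsupport φ :=
    tsupport_comp_subset_preimage φ (continuous_const.sub continuous_id)
  -- The reflected kernel is a test function in `Ω`; the sign from the reflection cancels the sign
  -- in the definition of a weak derivative.
  have h1 := hd.2.2 (fun z => φ (x - z)) hψ ?_ ?_
  · rw [iterPartial_comp_const_sub hφ] at h1
    simp only [mul_left_comm _ ((-1 : ℝ) ^ l.length)] at h1
    rw [integral_const_mul] at h1
    exact mul_left_cancel₀ (pow_ne_zero _ (by norm_num)) h1
  · exact hc.comp_homeomorph (Homeomorph.subLeft x)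
  · intro z hz
    have := hx _ (hts hz)
    rwa [sub_sub_cancel] at this

/-- Near each point of the closure, functions in a Sobolev space are approximated by smooth ones. -/
theorem HasCone.exists_l2Tendsto {Ω U : Set Plane} (hΩ : IsOpen Ω) {e : Plane} {κ δ : ℝ}
    (hκ : 0 < κ) (hδ : 0 < δ) (hU : HasCone Ω U e κ δ) (hUo : IsOpen U) {w : Plane → ℝ}
    (hw : MemLp w 2 (volume.restrict Ω)) :
    ∃ f : ℕ → Plane → ℝ, (∀ j, ContDiff ℝ ∞ (f j)) ∧
      ∀ l d, HasWeakDeriv Ω l w d → MemLp d 2 (volume.restrict Ω) →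
        L2Tendsto (volume.restrict (Ω ∩ U)) (fun j => iterPartial l (f j)) d := by
  set t : ℕ → ℝ := fun j => δ / (j + 2) with ht
  have ht0 : ∀ j, 0 < t j := fun j => by positivity
  have htδ : ∀ j, t j < δ := fun j => by
    rw [ht]
    exact div_lt_self hδ (by have : (0 : ℝ) ≤ j := j.cast_nonneg; linarith)
  have httend : Tendsto t atTop (𝓝 0) :=
    tendsto_const_nhds.div_atTop (tendsto_natCast_atTop_atTop.atTop_add tendsto_const_nhds)
  -- Centre `-t e` and outer radius `t κ` describe exactly the shifts `y` that `HasCone` allows.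
  set b : ∀ j : ℕ, ContDiffBump (-(t j • e)) := fun j =>
    ⟨t j * κ / 2, t j * κ, by have := mul_pos (ht0 j) hκ; positivity,
      half_lt_self (mul_pos (ht0 j) hκ)⟩ with hb
  set φ : ℕ → Plane → ℝ := fun j => (b j).normed volume with hφdef
  have hφ : ∀ j, ContDiff ℝ ∞ (φ j) := fun j => (b j).contDiff_normed
  have hc : ∀ j, HasCompactSupport (φ j) := fun j => (b j).hasCompactSupport_normed
  have hts : ∀ j y, y ∈ tsupport (φ j) → ‖y + t j • e‖ ≤ t j * κ := by
    intro j y hy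
    rw [hφdef, ContDiffBump.tsupport_normed_eq, Metric.mem_closedBall, dist_eq_norm,
      sub_neg_eq_add] at hy
    exact hy
  have hsupp : ∀ V ∈ 𝓝 (0 : Plane), ∀ᶠ j in atTop, ∀ y, φ j y ≠ 0 → y ∈ V := by
    intro V hV
    obtain ⟨ε, hε, hball⟩ := Metric.mem_nhds_iff.1 hV
    have h1 : Tendsto (fun j => t j * κ + t j * ‖e‖) atTop (𝓝 0) := by
      simpa using (httend.mul_const κ).add (httend.mul_const ‖e‖)
    filter_upwards [h1.eventually (gt_mem_nhds hε)] with j hj y hy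
    refine hball ?_
    rw [Metric.mem_ball, dist_zero_right]
    have h2 := hts j y (subset_tsupport _ hy)
    have h3 : y = (y + t j • e) - t j • e := by abel
    have h4 : ‖t j • e‖ = t j * ‖e‖ := by rw [norm_smul, Real.norm_of_nonneg (ht0 j).le]
    rw [h3]
    refine (norm_sub_le _ _).trans_lt ?_
    rw [h4]
    linarith
  have hwi : MemLp (Ω.indicator w) 2 volume := (memLp_indicator_iff_restrict hΩ.measurableSet).2 hw
  have hwl := hwi.locallyIntegrable one_le_two
  -- One sequence serves all `l`. Extension by zero creates jumps across the boundary, but for `x`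
  -- in `Ω ∩ U` the kernel does not reach them.
  refine ⟨fun j => mollify (φ j) (Ω.indicator w), fun j => contDiff_mollify (hφ j) (hc j) hwl, ?_⟩
  intro l d hd hd2
  have hdi : MemLp (Ω.indicator d) 2 volume :=
    (memLp_indicator_iff_restrict hΩ.measurableSet).2 hd2
  have h1 := l2Tendsto_mollify (fun j => (hφ j).continuous) hc (fun j => (b j).nonneg_normed)
    (fun j => (b j).integral_normed) hsupp hdi
  have h2 := h1.mono_measure (ν := volume.restrict (Ω ∩ U)) ENNReal.one_ne_top
    (by rw [one_smul]; exact Measure.restrict_le_self)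
  have hm : MeasurableSet (Ω ∩ U) := (hΩ.inter hUo).measurableSet
  refine (h2.congr_right ?_).congr_left fun j => ?_
  · filter_upwards [ae_restrict_mem hm] with x hx
    simp [hx.1]
  · filter_upwards [ae_restrict_mem hm] with x hx
    exact (hd.iterPartial_mollify hΩ hwl (hφ j) (hc j)
      fun y hy => hU x hx.2 hx.1 (t j) (ht0 j) (htδ j) y (hts j y hy)).symm

/-- Since `χ` vanishes off `U`, what the functions do on the rest of `Ω` is irrelevant. -/
theorem L2Tendsto.mul_cutoff {Ω U : Set Plane} (hb : Bornology.IsBounded Ω) (hΩ : IsOpen Ω)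
    (hU : IsOpen U) {χ : Plane → ℝ} (hχ : Continuous χ) (hs : tsupport χ ⊆ U)
    {f : ℕ → Plane → ℝ} {d : Plane → ℝ} (h : L2Tendsto (volume.restrict (Ω ∩ U)) f d) :
    L2Tendsto (volume.restrict Ω) (fun j x => f j x * χ x) (fun x => d x * χ x) := by
  have h1 : L2Tendsto (volume.restrict Ω) (fun j => U.indicator (f j)) (U.indicator d) := by
    have he : (volume.restrict Ω).restrict U = volume.restrict (Ω ∩ U) := by
      rw [Measure.restrict_restrict hU.measurableSet, inter_comm]
    refine ⟨fun j => (memLp_indicator_iff_restrict hU.measurableSet).2 (he ▸ h.memLp j),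
      (memLp_indicator_iff_restrict hU.measurableSet).2 (he ▸ h.memLp_lim), ?_⟩
    refine h.tendsto.congr fun j => ?_
    rw [← he, ← eLpNorm_indicator_eq_eLpNorm_restrict hU.measurableSet]
    congr 1
    ext x
    by_cases hx : x ∈ U <;> simp [hx]
  obtain ⟨C, hC⟩ := hb.isCompact_closure.exists_bound_of_continuousOn hχ.continuousOn
  have h2 := h1.mul_bounded (c := χ) hχ.aestronglyMeasurable (C := C) (by
    filter_upwards [ae_restrict_mem hΩ.measurableSet] with x hx using hC x (subset_closure hx))
  have h0 : ∀ (F : Plane → ℝ) x, U.indicator F x * χ x = F x * χ x := by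
    intro F x
    by_cases hx : x ∈ U
    · simp [hx]
    · rw [image_eq_zero_of_notMem_tsupport (fun h => hx (hs h)), mul_zero, mul_zero]
  simpa only [h0] using h2

theorem iterPartial_single_mul {f χ : Plane → ℝ} (hf : ContDiff ℝ ∞ f) (hχ : ContDiff ℝ ∞ χ)
    (i : Fin 2) : iterPartial [i] (fun x => f x * χ x) =
      fun x => iterPartial [i] f x * χ x + f x * iterPartial [i] χ x := by
  ext x
  simp only [iterPartial]
  rw [fderiv_fun_mul (hf.differentiable (by simp) x) (hχ.differentiable (by simp) x)]
  simp
  ring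

/-- Induction that peels off the innermost derivative by the product rule; `f` and `χ` are
generalized because it lands on either factor. Existence of a limit suffices, so no Leibniz formula
is needed. -/
theorem exists_l2Tendsto_iterPartial_mul_cutoff {Ω U : Set Plane} (hb : Bornology.IsBounded Ω)
    (hΩ : IsOpen Ω) (hU : IsOpen U) (l : List (Fin 2)) {χ : Plane → ℝ} (hχ : ContDiff ℝ ∞ χ)
    (hs : tsupport χ ⊆ U) {f : ℕ → Plane → ℝ} (hf : ∀ j, ContDiff ℝ ∞ (f j))
    (h : ∀ m : List (Fin 2), m.length ≤ l.length →
      ∃ d, L2Tendsto (volume.restrict (Ω ∩ U)) (fun j => iterPartial m (f j)) d) :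
    ∃ d, L2Tendsto (volume.restrict Ω) (fun j => iterPartial l (fun x => f j x * χ x)) d := by
  induction l using List.reverseRecOn generalizing χ f with
  | nil =>
    obtain ⟨d, hd⟩ := h [] le_rfl
    exact ⟨_, hd.mul_cutoff hb hΩ hU hχ.continuous hs⟩
  | append_singleton l i ih =>
    have hfi : ∀ j, ContDiff ℝ ∞ (iterPartial [i] (f j)) := fun j => contDiff_iterPartial (hf j) [i]
    have hχi : ContDiff ℝ ∞ (iterPartial [i] χ) := contDiff_iterPartial hχ [i]
    obtain ⟨d1, hd1⟩ := ih hχ hs hfi fun m hm => by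
      simp only [← iterPartial_append]
      exact h _ (by simpa using hm)
    obtain ⟨d2, hd2⟩ := ih hχi ((tsupport_iterPartial_subset [i] χ).trans hs) hf fun m hm =>
      h m (by simp only [List.length_append, List.length_singleton]; omega)
    refine ⟨_, (hd1.add hd2).congr_left fun j => Eventually.of_forall fun x => ?_⟩
    rw [iterPartial_append, iterPartial_single_mul (hf j) hχ,
      iterPartial_add ((hfi j).mul hχ) ((hf j).mul hχi)]

/-- `MemSobolev` only supplies some weak derivative of order zero in `L²`; it agrees with `w` almost
everywhere. -/
theorem MemSobolev.memLp {Ω : Set Plane} (hΩ : IsOpen Ω) {k : ℕ} {w : Plane → ℝ}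
    (hw : MemSobolev Ω k w) : HasWeakDeriv Ω [] w w ∧ MemLp w 2 (volume.restrict Ω) := by
  obtain ⟨v, hv, hv2⟩ := hw [] (Nat.zero_le _)
  have h1 : HasWeakDeriv Ω [] w w := ⟨hv.1, hv.1, fun φ _ _ _ => by simp [iterPartial]⟩
  exact ⟨h1, hv2.ae_eq (hv.ae_eq hΩ h1)⟩

/-- Functions smooth up to the boundary are dense in `Hᵏ(Ω)`. -/
theorem IsC2Domain.exists_smoothApprox {Ω : Set Plane} (hΩ : IsC2Domain Ω) {k : ℕ} {w : Plane → ℝ}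
    (hw : MemSobolev Ω k w) : ∃ v, SmoothApprox Ω k v w := by
  obtain ⟨hw0, hw2⟩ := hw.memLp hΩ.isOpen
  have hloc : ∀ P : closure Ω, ∃ (U : Set Plane) (f : ℕ → Plane → ℝ), IsOpen U ∧ (P : Plane) ∈ U ∧
      (∀ j, ContDiff ℝ ∞ (f j)) ∧ ∀ l d, HasWeakDeriv Ω l w d → MemLp d 2 (volume.restrict Ω) →
        L2Tendsto (volume.restrict (Ω ∩ U)) (fun j => iterPartial l (f j)) d := by
    rintro ⟨P, hP⟩
    obtain ⟨U, e, κ, δ, hU, hPU, hκ, hδ, hcone⟩ := hΩ.exists_hasCone hP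
    obtain ⟨f, hf, hf2⟩ := hcone.exists_l2Tendsto hΩ.isOpen hκ hδ hU hw2
    exact ⟨U, f, hU, hPU, hf, hf2⟩
  choose U f hU hPU hf hconv using hloc
  obtain ⟨T, hT⟩ := hΩ.isBounded.isCompact_closure.elim_finite_subcover U hU
    (fun P hP => mem_iUnion.2 ⟨⟨P, hP⟩, hPU ⟨P, hP⟩⟩)
  obtain ⟨χ, hχs⟩ := SmoothPartitionOfUnity.exists_isSubordinate (ι := T) (modelWithCornersSelf ℝ Plane)
    (isClosed_closure (s := Ω)) (fun i => U i) (fun i => hU i) (by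
      intro x hx
      obtain ⟨i, hi, hxi⟩ := mem_iUnion₂.1 (hT hx)
      exact mem_iUnion.2 ⟨⟨i, hi⟩, hxi⟩)
  have hχ : ∀ i, ContDiff ℝ ∞ (χ i) := fun i => (χ i).contMDiff.contDiff
  have hv : ∀ j, ContDiff ℝ ∞ fun x => ∑ i : T, f i j x * χ i x := fun j =>
    ContDiff.sum fun (i : T) _ => (hf i j).mul (hχ i)
  -- The local approximations are glued by the partition of unity; since the cutoffs sum to `1` on
  -- `Ω`, the limit is `w`.
  refine ⟨fun j x => ∑ i : T, f i j x * χ i x, SmoothApprox.of_l2Tendsto hv ?_ fun l hl => ?_⟩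
  · have h1 := L2Tendsto.sum (Finset.univ : Finset T) fun i _ =>
      (hconv i [] w hw0 hw2).mul_cutoff hΩ.isBounded hΩ.isOpen (hU i) (hχ i).continuous (hχs i)
    refine h1.congr_right ?_
    filter_upwards [ae_restrict_mem hΩ.isOpen.measurableSet] with x hx
    have h2 := χ.sum_eq_one (subset_closure hx)
    rw [finsum_eq_sum_of_fintype] at h2
    rw [← Finset.mul_sum, h2, mul_one]
  · have h1 : ∀ i : T, ∃ d, L2Tendsto (volume.restrict Ω)
        (fun j => iterPartial l (fun x => f i j x * χ i x)) d := fun i =>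
      exists_l2Tendsto_iterPartial_mul_cutoff hΩ.isBounded hΩ.isOpen (hU i) l (hχ i) (hχs i) (hf i)
        fun m hm => by
          obtain ⟨d, hd, hd2⟩ := hw m (hm.trans hl)
          exact ⟨d, hconv i m d hd hd2⟩
    choose d hd using h1
    refine ⟨_, (L2Tendsto.sum (Finset.univ : Finset T) fun i _ => hd i).congr_left fun j =>
      Eventually.of_forall fun x => ?_⟩
    rw [iterPartial_sum _ fun i : T => (hf i j).mul (hχ i)]

/-! ### Weak derivatives with respect to the arclength -/

theorem continuous_mul_of_tsupport_subset {a b : ℝ} {F η : ℝ → ℝ} (hF : ContinuousOn F (Ioo a b))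
    (hη : Continuous η) (hs : tsupport η ⊆ Ioo a b) : Continuous fun s => F s * η s :=
  continuous_of_tsupport fun _ hx =>
    (hF.continuousAt (isOpen_Ioo.mem_nhds (hs (tsupport_mul_subset_right hx)))).mul
      hη.continuousAt

/-- `F` is controlled only inside the interval, but `F η` extends by zero to a differentiable
function on the line, with integrable derivative of integral zero. -/
theorem setIntegral_mul_deriv_eq_neg {a b : ℝ} {F F' η : ℝ → ℝ}
    (hF : ∀ s ∈ Ioo a b, HasDerivAt F (F' s) s) (hF' : ContinuousOn F' (Ioo a b))
    (hη : ContDiff ℝ ∞ η) (hc : HasCompactSupport η) (hs : tsupport η ⊆ Ioo a b) :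
    ∫ s in Ioo a b, F s * deriv η s = - ∫ s in Ioo a b, F' s * η s := by
  have hFc : ContinuousOn F (Ioo a b) := fun s hx => (hF s hx).continuousAt.continuousWithinAt
  have hη' : Continuous (deriv η) := hη.continuous_deriv (by simp)
  have hs' : tsupport (deriv η) ⊆ Ioo a b := (tsupport_deriv_subset).trans hs
  have hc' : HasCompactSupport (deriv η) := hc.deriv
  have i0 : Integrable (fun s => F s * η s) :=
    (continuous_mul_of_tsupport_subset hFc hη.continuous hs).integrable_of_hasCompactSupport
      hc.mul_left
  have i1 : Integrable (fun s => F' s * η s) :=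
    (continuous_mul_of_tsupport_subset hF' hη.continuous hs).integrable_of_hasCompactSupport
      hc.mul_left
  have i2 : Integrable (fun s => F s * deriv η s) :=
    (continuous_mul_of_tsupport_subset hFc hη' hs').integrable_of_hasCompactSupport hc'.mul_left
  have hderiv : ∀ s, HasDerivAt (fun s => F s * η s) (F' s * η s + F s * deriv η s) s := by
    intro s
    by_cases hx : s ∈ tsupport η
    · exact (hF s (hs hx)).mul (hη.differentiable (by simp) s).hasDerivAt
    · have h1 := notMem_tsupport_iff_eventuallyEq.1 hx
      have h2 : deriv η s = 0 := by rw [h1.deriv_eq]; simp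
      rw [h2, image_eq_zero_of_notMem_tsupport hx, mul_zero, mul_zero, add_zero]
      refine (hasDerivAt_const s (0 : ℝ)).congr_of_eventuallyEq ?_
      filter_upwards [h1] with t ht
      rw [ht]; simp
  have h0 := integral_eq_zero_of_hasDerivAt_of_integrable hderiv (i1.add i2) i0
  rw [integral_add i1 i2] at h0
  rw [setIntegral_eq_integral_of_forall_compl_eq_zero,
    setIntegral_eq_integral_of_forall_compl_eq_zero]
  · linarith
  · intro s hx
    rw [image_eq_zero_of_notMem_tsupport fun h => hx (hs h), mul_zero]
  · intro s hx
    rw [image_eq_zero_of_notMem_tsupport fun h => hx (hs' h), mul_zero]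

section Arc

variable {Ω : Set Plane} {a b : ℝ} {ψ : ℝ → Plane}

/-- Reduction to a compact set of parameters, where arclength dominates Lebesgue measure. -/
theorem setIntegral_arc_eq {θ : ℝ → ℝ} (hs : tsupport θ ⊆ Ioo a b) (g : ℝ → ℝ) :
    ∫ s in Ioo a b, g s * θ s = ∫ s in tsupport θ, g s * θ s := by
  refine setIntegral_eq_of_subset_of_forall_sdiff_eq_zero measurableSet_Ioo hs fun s hx => ?_
  rw [image_eq_zero_of_notMem_tsupport hx.2, mul_zero]

theorem L2Tendsto.tendsto_setIntegral_arc (hΩ : IsC2Domain Ω) (hψ : IsArc Ω a b ψ)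
    {f : ℕ → Plane → ℝ} {g : Plane → ℝ} (h : L2Tendsto (arcMeasure Ω) f g) {θ : ℝ → ℝ}
    (hθ : Continuous θ) (hc : HasCompactSupport θ) (hs : tsupport θ ⊆ Ioo a b) :
    Tendsto (fun j => ∫ s in Ioo a b, f j (ψ s) * θ s) atTop
      (𝓝 (∫ s in Ioo a b, g (ψ s) * θ s)) := by
  rw [setIntegral_arc_eq hs fun s => g (ψ s)]
  simp only [fun j => setIntegral_arc_eq hs fun s => f j (ψ s)]
  exact (h.comp_arc hΩ hψ hc hs).tendsto_integral_mul
    ((hθ.memLp_of_hasCompactSupport hc).restrict _)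

theorem MeasureTheory.MemLp.integrable_arc (hΩ : IsC2Domain Ω) (hψ : IsArc Ω a b ψ)
    {g : Plane → ℝ} (h : MemLp g 2 (arcMeasure Ω)) {θ : ℝ → ℝ}
    (hθ : Continuous θ) (hc : HasCompactSupport θ) (hs : tsupport θ ⊆ Ioo a b) :
    Integrable (fun s => g (ψ s) * θ s) (volume.restrict (Ioo a b)) := by
  have h1 : IntegrableOn (fun s => g (ψ s) * θ s) (tsupport θ) :=
    (h.comp_arc hΩ hψ hc hs).integrable_mul ((hθ.memLp_of_hasCompactSupport (p := 2) hc).restrict _)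
  have h2 : Integrable (fun s => g (ψ s) * θ s) := by
    rw [← integrableOn_iff_integrable_of_support_subset (s := tsupport θ)]
    · exact h1
    · exact (Function.support_mul_subset_right _ _).trans (subset_tsupport _)
  exact h2.restrict

theorem HasWeakArcDeriv.add (hΩ : IsC2Domain Ω) {g h g' h' : Plane → ℝ}
    (H : HasWeakArcDeriv Ω g h) (H' : HasWeakArcDeriv Ω g' h') :
    HasWeakArcDeriv Ω (fun P => g P + g' P) (fun P => h P + h' P) := by
  refine ⟨H.1.add H'.1, H.2.1.add H'.2.1, fun a b ψ hψ η hη hc hs => ?_⟩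
  have hη' : Continuous (deriv η) := hη.continuous_deriv (by simp)
  have hs' : tsupport (deriv η) ⊆ Ioo a b := tsupport_deriv_subset.trans hs
  simp only [add_mul]
  rw [integral_add (H.1.integrable_arc hΩ hψ hη' hc.deriv hs')
      (H'.1.integrable_arc hΩ hψ hη' hc.deriv hs'),
    integral_add (H.2.1.integrable_arc hΩ hψ hη.continuous hc hs)
      (H'.2.1.integrable_arc hΩ hψ hη.continuous hc hs),
    H.2.2 a b ψ hψ η hη hc hs, H'.2.2 a b ψ hψ η hη hc hs, neg_add]

theorem IsArc.mapsTo (hψ : IsArc Ω a b ψ) : MapsTo ψ (Ioo a b) (frontier Ω) :=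
  fun s hs => (hψ s hs).1

theorem IsC2Domain.aestronglyMeasurable_of_continuousOn {c : Plane → ℝ}
    (hc : ContinuousOn c (frontier Ω)) : AEStronglyMeasurable c (arcMeasure Ω) :=
  hc.aestronglyMeasurable isClosed_frontier.measurableSet

theorem ae_mem_frontier (Ω : Set Plane) : ∀ᵐ P ∂(arcMeasure Ω), P ∈ frontier Ω :=
  ae_restrict_mem isClosed_frontier.measurableSet

theorem L2Tendsto.mul_continuousOn (hΩ : IsC2Domain Ω) {f : ℕ → Plane → ℝ} {g c : Plane → ℝ}
    (h : L2Tendsto (arcMeasure Ω) f g) (hc : ContinuousOn c (frontier Ω)) :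
    L2Tendsto (arcMeasure Ω) (fun j P => f j P * c P) (fun P => g P * c P) := by
  obtain ⟨C, hC⟩ := hΩ.isCompact_frontier.exists_bound_of_continuousOn hc
  refine h.mul_bounded (IsC2Domain.aestronglyMeasurable_of_continuousOn hc) (C := C) ?_
  filter_upwards [ae_mem_frontier Ω] with P hP using hC P hP

/-- The weak arclength derivative of the product of a trace with a differentiable function. -/
theorem hasWeakArcDeriv_mul (hΩ : IsC2Domain Ω) {v : ℕ → Plane → ℝ} {t : Plane → ℝ}
    {t' : Fin 2 → Plane → ℝ} (hv : ∀ j, ContDiff ℝ ∞ (v j)) (ht : L2Tendsto (arcMeasure Ω) v t)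
    (ht' : ∀ α, L2Tendsto (arcMeasure Ω) (fun j => iterPartial [α] (v j)) (t' α))
    {c c' : Plane → ℝ} (hcd : ∀ P ∈ frontier Ω, HasArcDerivAt Ω c (c' P) P)
    (hc : ContinuousOn c (frontier Ω)) (hc' : ContinuousOn c' (frontier Ω)) :
    HasWeakArcDeriv Ω (fun P => t P * c P)
      (fun P => (t' 0 P * tangent Ω P 0 + t' 1 P * tangent Ω P 1) * c P + t P * c' P) := by
  have h0 := ht.mul_continuousOn hΩ hc
  have h1 := ((((ht' 0).mul_continuousOn hΩ (hΩ.continuousOn_tangent 0)).add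
    ((ht' 1).mul_continuousOn hΩ (hΩ.continuousOn_tangent 1))).mul_continuousOn hΩ hc).add
      (ht.mul_continuousOn hΩ hc')
  refine ⟨h0.memLp_lim, h1.memLp_lim, fun a b ψ hψ η hη hcη hs => ?_⟩
  have hη' : Continuous (deriv η) := hη.continuous_deriv (by simp)
  have hs' : tsupport (deriv η) ⊆ Ioo a b := tsupport_deriv_subset.trans hs
  have l0 := h0.tendsto_setIntegral_arc hΩ hψ hη' hcη.deriv hs'
  have l1 := (h1.tendsto_setIntegral_arc hΩ hψ hη.continuous hcη hs).neg
  -- For each `j` the identity is classical integration by parts along `ψ`; both sides converge.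
  refine tendsto_nhds_unique l0 (l1.congr fun j => ?_)
  symm
  refine setIntegral_mul_deriv_eq_neg (F := fun s => v j (ψ s) * c (ψ s)) ?_ ?_ hη hcη hs
  · intro s hx
    have d1 := ((hv j).differentiable (by simp) (ψ s)).hasFDerivAt.comp_hasDerivAt s (hψ s hx).2
    have d2 := (hcd _ (hψ s hx).1).hasDerivAt_arc hψ hx
    have := d1.mul d2
    rw [fderiv_eq_iterPartial, mul_comm (tangent Ω (ψ s) 0), mul_comm (tangent Ω (ψ s) 1)] at this
    exact this
  · have hψc := hψ.continuousOn
    have hvc := (hv j).continuous.comp_continuousOn hψc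
    have p0 := (contDiff_iterPartial (hv j) [0]).continuous.comp_continuousOn hψc
    have p1 := (contDiff_iterPartial (hv j) [1]).continuous.comp_continuousOn hψc
    have q0 := (hΩ.continuousOn_tangent 0).comp hψc hψ.mapsTo
    have q1 := (hΩ.continuousOn_tangent 1).comp hψc hψ.mapsTo
    have r0 := hc.comp hψc hψ.mapsTo
    have r1 := hc'.comp hψc hψ.mapsTo
    exact (((p0.mul q0).add (p1.mul q1)).mul r0).add (hvc.mul r1)

/-- Weak arclength derivatives are unique. -/
theorem HasWeakArcDeriv.ae_eq (hΩ : IsC2Domain Ω) {g g' h h' : Plane → ℝ}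
    (H : HasWeakArcDeriv Ω g h) (H' : HasWeakArcDeriv Ω g' h') (hg : g =ᵐ[arcMeasure Ω] g') :
    h =ᵐ[arcMeasure Ω] h' := by
  set B : Set Plane := {P | h P ≠ h' P} with hB
  suffices hnull : arcMeasure Ω (B ∩ frontier Ω) = 0 by
    rw [arcMeasure_apply, inter_assoc, inter_self, ← arcMeasure_apply] at hnull
    exact hnull
  refine measure_null_of_locally_null _ fun P hP => ?_
  obtain ⟨Γ, S, U, hΓ, hPU⟩ := hΩ.exists_isArcChart hP.2
  have hPS := hΓ.curve_coord P hP.2 hPU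
  obtain ⟨a, b, K, U', hab, hU', hPU', hle⟩ := exists_arcMeasure_inter_le
    (hΓ.contDiff_curve.of_le (by norm_num)) hΓ.contDiff_coord.continuous hΓ.isOpen hΓ.curve_coord
    hPU (hΓ.isOpen_preimage.mem_nhds (by rwa [mem_preimage, hPS]))
  refine ⟨B ∩ U', mem_nhdsWithin.2 ⟨U', hU', hPU', fun Q hQ => ⟨hQ.2.1, hQ.1⟩⟩, ?_⟩
  have hψ : IsArc Ω a b Γ := fun s hs => ⟨hΓ.mem_frontier s (hab hs), hΓ.hasDerivAt s (hab hs)⟩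
  have hloc : ∀ f : Plane → ℝ, MemLp f 2 (arcMeasure Ω) →
      LocallyIntegrableOn (fun s => f (Γ s)) (Ioo a b) volume := by
    intro f hf
    rw [locallyIntegrableOn_iff isOpen_Ioo.isLocallyClosed]
    intro k hk hkc
    have : IsFiniteMeasure (volume.restrict k) := ⟨by simpa using hkc.measure_lt_top⟩
    exact (hf.comp_arc hΩ hψ hkc hk).integrable one_le_two
  have key := isOpen_Ioo.ae_eq_zero_of_integral_contDiff_smul_eq_zero (μ := volume)
    (f := fun s => h (Γ s) - h' (Γ s)) ((hloc h H.2.1).sub (hloc h' H'.2.1)) ?_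
  · have hz : volume (Γ ⁻¹' B ∩ Ioo a b) = 0 := by
      refine measure_mono_null ?_ key
      rintro s ⟨hsB, hs⟩ hs2
      exact hsB (sub_eq_zero.1 (hs2 hs))
    -- The estimate holds for arbitrary sets, so measurability of `B` is not an issue.
    have := hle B
    rw [hz, mul_zero] at this
    exact le_antisymm this zero_le
  intro η hη hc hs
  have hη' : Continuous (deriv η) := hη.continuous_deriv (by simp)
  have hs' : tsupport (deriv η) ⊆ Ioo a b := tsupport_deriv_subset.trans hs
  have e1 : ∫ s in Ioo a b, g (Γ s) * deriv η s = ∫ s in Ioo a b, g' (Γ s) * deriv η s := by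
    rw [setIntegral_arc_eq hs' fun s => g (Γ s), setIntegral_arc_eq hs' fun s => g' (Γ s)]
    obtain ⟨hm, L, -, hL⟩ := hΩ.exists_map_le hψ hc.deriv hs'
    -- Transfers the equality of `g` and `g'` almost everywhere on `∂Ω` to almost every parameter.
    have hac : (volume.restrict (tsupport (deriv η))).map Γ ≪ arcMeasure Ω :=
      Measure.absolutelyContinuous_of_le_smul hL
    refine integral_congr_ae ?_
    filter_upwards [ae_of_ae_map hm (hac.ae_le hg)] with s hs3
    rw [hs3]
  rw [H.2.2 a b Γ hψ η hη hc hs, H'.2.2 a b Γ hψ η hη hc hs, neg_inj] at e1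
  rw [← setIntegral_eq_integral_of_forall_compl_eq_zero (s := Ioo a b)]
  · have e2 : ∀ s, η s • (h (Γ s) - h' (Γ s)) = h (Γ s) * η s - h' (Γ s) * η s := by
      intro s; simp only [smul_eq_mul]; ring
    simp_rw [e2]
    rw [integral_sub (H.2.1.integrable_arc hΩ hψ hη.continuous hc hs)
      (H'.2.1.integrable_arc hΩ hψ hη.continuous hc hs), e1, sub_self]
  · intro s hx
    rw [image_eq_zero_of_notMem_tsupport fun h => hx (hs h), zero_smul]

end Arc

/-! ### Boundary values -/

section BoundaryValues

variable {Ω : Set Plane}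

theorem IsC2Domain.memLp_of_continuous (hΩ : IsC2Domain Ω) {f : Plane → ℝ} (hf : Continuous f) :
    MemLp f 2 (volume.restrict Ω) := by
  obtain ⟨C, hC⟩ := hΩ.isBounded.isCompact_closure.exists_bound_of_continuousOn hf.continuousOn
  have : IsFiniteMeasure (volume.restrict Ω) := ⟨by simpa using hΩ.isBounded.measure_lt_top⟩
  refine MemLp.of_bound hf.aestronglyMeasurable C ?_
  filter_upwards [ae_restrict_mem hΩ.isOpen.measurableSet] with x hx using hC x (subset_closure hx)

theorem IsC2Domain.memLp_arcMeasure_of_continuous (hΩ : IsC2Domain Ω) {f : Plane → ℝ}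
    (hf : Continuous f) : MemLp f 2 (arcMeasure Ω) := by
  obtain ⟨C, hC⟩ := hΩ.isCompact_frontier.exists_bound_of_continuousOn hf.continuousOn
  have : IsFiniteMeasure (arcMeasure Ω) := ⟨hΩ.arcMeasure_univ_lt_top⟩
  refine MemLp.of_bound hf.aestronglyMeasurable C ?_
  filter_upwards [ae_mem_frontier Ω] with x hx using hC x hx

theorem SmoothApprox.l2Tendsto (hΩ : IsC2Domain Ω) {k : ℕ} {v : ℕ → Plane → ℝ} {u d : Plane → ℝ}
    {l : List (Fin 2)} (h : SmoothApprox Ω k v u) (hl : l.length ≤ k) (hd : HasWeakDeriv Ω l u d) :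
    L2Tendsto (volume.restrict Ω) (fun j => iterPartial l (v j)) d := by
  obtain ⟨d', hd', hm, ht⟩ := h.2 l hl
  exact L2Tendsto.congr_right
    ⟨fun j => hΩ.memLp_of_continuous (contDiff_iterPartial (h.1 j) l).continuous, hm, ht⟩
    (hd'.ae_eq hΩ.isOpen hd)

theorem SmoothApprox.tendsto_sub (hΩ : IsC2Domain Ω) {k : ℕ} {v v' : ℕ → Plane → ℝ}
    {u : Plane → ℝ} {l : List (Fin 2)} (h : SmoothApprox Ω k v u) (h' : SmoothApprox Ω k v' u)
    (hl : l.length ≤ k) :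
    Tendsto (fun j => eLpNorm (iterPartial l (fun x => v j x - v' j x)) 2 (volume.restrict Ω))
      atTop (𝓝 0) := by
  obtain ⟨d, hd, -, -⟩ := h.2 l hl
  have := (h.l2Tendsto hΩ hl hd).tendsto_sub (h'.l2Tendsto hΩ hl hd)
  refine this.congr fun j => ?_
  rw [iterPartial_sub (h.1 j) (h'.1 j)]

/-- The trace of a function that is approximated by smooth ones in `H¹(Ω)`. -/
theorem SmoothApprox.exists_trace (hΩ : IsC2Domain Ω) {v : ℕ → Plane → ℝ} {u : Plane → ℝ}
    (h : SmoothApprox Ω 1 v u) :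
    ∃ g, ∀ v', SmoothApprox Ω 1 v' u → L2Tendsto (arcMeasure Ω) v' g := by
  obtain ⟨C, hC, htr⟩ := hΩ.exists_eLpNorm_arcMeasure_le
  have hmem : ∀ {f : Plane → ℝ}, ContDiff ℝ ∞ f → MemLp f 2 (arcMeasure Ω) := fun hf =>
    hΩ.memLp_arcMeasure_of_continuous hf.continuous
  obtain ⟨g, hg⟩ : ∃ g, L2Tendsto (arcMeasure Ω) v g := by
    obtain ⟨d0, hd0, -, -⟩ := h.2 [] (by simp)
    obtain ⟨d1, hd1, -, -⟩ := h.2 [0] (by simp)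
    obtain ⟨d2, hd2, -, -⟩ := h.2 [1] (by simp)
    have t0 := h.l2Tendsto hΩ (by simp) hd0
    have t1 := h.l2Tendsto hΩ (by simp) hd1
    have t2 := h.l2Tendsto hΩ (by simp) hd2
    -- The trace inequality for `v i - v j` turns convergence in `H¹(Ω)` into the Cauchy property on
    -- `∂Ω`.
    refine exists_l2Tendsto_of_cauchy (fun j => hmem (h.1 j))
      (b := fun j => C * (eLpNorm (fun x => iterPartial [] (v j) x - d0 x) 2 (volume.restrict Ω) +
        (eLpNorm (fun x => iterPartial [0] (v j) x - d1 x) 2 (volume.restrict Ω) +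
          eLpNorm (fun x => iterPartial [1] (v j) x - d2 x) 2 (volume.restrict Ω)))) ?_ ?_
    · have := ENNReal.Tendsto.const_mul (a := C)
        (t0.tendsto.add (t1.tendsto.add t2.tendsto)) (Or.inr hC)
      simpa using this
    · intro i j
      refine (htr _ ((h.1 i).sub (h.1 j))).trans ?_
      rw [iterPartial_sub (h.1 i) (h.1 j), iterPartial_sub (h.1 i) (h.1 j), ← mul_add]
      refine mul_le_mul' le_rfl ?_
      have key : ∀ {l : List (Fin 2)} {d : Plane → ℝ},
          L2Tendsto (volume.restrict Ω) (fun j => iterPartial l (v j)) d →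
          eLpNorm (fun x => iterPartial l (v i) x - iterPartial l (v j) x) 2 (volume.restrict Ω) ≤
            eLpNorm (fun x => iterPartial l (v i) x - d x) 2 (volume.restrict Ω) +
              eLpNorm (fun x => iterPartial l (v j) x - d x) 2 (volume.restrict Ω) := fun t =>
        eLpNorm_two_le_add_of_sub ((t.memLp i).sub t.memLp_lim) ((t.memLp j).sub t.memLp_lim)
          fun x => by ring
      refine (add_le_add (key t0) (add_le_add (key t1) (key t2))).trans (le_of_eq ?_)
      ring
  -- The trace inequality for `v' j - v j` shows that the limit does not depend on the sequence.
  refine ⟨g, fun v' h' => hg.of_tendsto_sub (fun j => hmem (h'.1 j)) ?_⟩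
  have s0 := h'.tendsto_sub hΩ h (l := []) (by simp)
  have s1 := h'.tendsto_sub hΩ h (l := [0]) (by simp)
  have s2 := h'.tendsto_sub hΩ h (l := [1]) (by simp)
  have s := ENNReal.Tendsto.const_mul (a := C) (s0.add (s1.add s2)) (Or.inr hC)
  simp only [add_zero, mul_zero] at s
  exact tendsto_of_tendsto_of_tendsto_of_le_of_le tendsto_const_nhds s (fun _ => zero_le)
    fun j => htr _ ((h'.1 j).sub (h.1 j))

/-- Traces of all weak derivatives of order at most two of a function in `H³(Ω)`. -/
theorem SmoothApprox.exists_traces (hΩ : IsC2Domain Ω) {v : ℕ → Plane → ℝ} {w : Plane → ℝ}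
    (h : SmoothApprox Ω 3 v w) :
    ∃ t : List (Fin 2) → Plane → ℝ, ∀ m, m.length ≤ 2 →
      (∃ d, HasWeakDeriv Ω m w d ∧ IsTrace Ω d (t m)) ∧
      ∀ k v', m.length < k → SmoothApprox Ω k v' w →
        L2Tendsto (arcMeasure Ω) (fun j => iterPartial m (v' j)) (t m) := by
  have key : ∀ m : List (Fin 2), ∃ t : Plane → ℝ, m.length ≤ 2 →
      (∃ d, HasWeakDeriv Ω m w d ∧ IsTrace Ω d t) ∧
      ∀ k v', m.length < k → SmoothApprox Ω k v' w →
        L2Tendsto (arcMeasure Ω) (fun j => iterPartial m (v' j)) t := by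
    intro m
    by_cases hm : m.length ≤ 2
    · obtain ⟨d, hd, -, -⟩ := h.2 m (hm.trans (by norm_num))
      have h1 : SmoothApprox Ω 1 (fun j => iterPartial m (v j)) d :=
        (h.mono (by omega)).of_hasWeakDeriv hd
      obtain ⟨t, ht⟩ := h1.exists_trace hΩ
      refine ⟨t, fun _ => ⟨⟨d, hd, (ht _ h1).memLp_lim, ⟨_, h1⟩, fun v' hv' =>
        (ht v' hv').tendsto⟩, fun k v' hk hv' => ht _ ?_⟩⟩
      exact (hv'.mono (by omega)).of_hasWeakDeriv hd
    -- A default value: nothing is claimed about derivatives of order above two.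
    · exact ⟨0, fun h => absurd h hm⟩
  choose t ht using key
  exact ⟨t, ht⟩

/-! ### Local derivatives in terms of Cartesian traces. -/

theorem deriv_line {f : Plane → ℝ} (hf : ContDiff ℝ ∞ f) (P b : Plane) (z : ℝ) :
    deriv (fun z : ℝ => f (P + z • b)) z =
      iterPartial [0] f (P + z • b) * b 0 + iterPartial [1] f (P + z • b) * b 1 := by
  have h1 : HasDerivAt (fun z : ℝ => P + z • b) b z := by
    simpa using ((hasDerivAt_id z).smul_const b).const_add P
  have h2 := (hf.differentiable (by simp) (P + z • b)).hasFDerivAt.comp_hasDerivAt z h1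
  rw [fderiv_eq_iterPartial, mul_comm (b 0), mul_comm (b 1)] at h2
  exact h2.deriv

theorem iteratedDeriv_one_line {f : Plane → ℝ} (hf : ContDiff ℝ ∞ f) (P b : Plane) :
    iteratedDeriv 1 (fun z : ℝ => f (P + z • b)) 0 =
      iterPartial [0] f P * b 0 + iterPartial [1] f P * b 1 := by
  rw [iteratedDeriv_one, deriv_line hf]
  simp

theorem iteratedDeriv_two_line {f : Plane → ℝ} (hf : ContDiff ℝ ∞ f) (P b : Plane) :
    iteratedDeriv 2 (fun z : ℝ => f (P + z • b)) 0 =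
      (iterPartial [0, 0] f P * b 0 + iterPartial [1, 0] f P * b 1) * b 0 +
        (iterPartial [0, 1] f P * b 0 + iterPartial [1, 1] f P * b 1) * b 1 := by
  rw [iteratedDeriv_succ, iteratedDeriv_one]
  have h1 : deriv (fun z : ℝ => f (P + z • b)) = fun z : ℝ =>
      iterPartial [0] f (P + z • b) * b 0 + iterPartial [1] f (P + z • b) * b 1 :=
    funext fun z => deriv_line hf P b z
  have hd : ∀ i, DifferentiableAt ℝ (fun z : ℝ => iterPartial [i] f (P + z • b)) 0 := fun i =>
    ((differentiable_iterPartial hf [i]).comp (by fun_prop)).differentiableAt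
  rw [h1, deriv_fun_add ((hd 0).mul_const _) ((hd 1).mul_const _), deriv_mul_const (hd 0),
    deriv_mul_const (hd 1), deriv_line (contDiff_iterPartial hf [0]),
    deriv_line (contDiff_iterPartial hf [1])]
  simp only [← iterPartial_append, zero_smul, add_zero]
  rfl

/-- The boundary values computed from the traces `t` of the Cartesian derivatives. -/
noncomputable def frameBoundaryFunctions (Ω : Set Plane) (t : List (Fin 2) → Plane → ℝ) :
    BoundaryFunctions where
  val := t []
  cart β := t [β]
  cart2 α β := t [α, β]
  s P := t [0] P * tangent Ω P 0 + t [1] P * tangent Ω P 1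
  n P := t [0] P * outerNormal Ω P 0 + t [1] P * outerNormal Ω P 1
  ss P := ((t [0, 0] P * tangent Ω P 0 + t [1, 0] P * tangent Ω P 1) * tangent Ω P 0 +
      t [0] P * arcDeriv Ω (fun Q => tangent Ω Q 0) P) +
    ((t [0, 1] P * tangent Ω P 0 + t [1, 1] P * tangent Ω P 1) * tangent Ω P 1 +
      t [1] P * arcDeriv Ω (fun Q => tangent Ω Q 1) P)
  sn P := ((t [0, 0] P * tangent Ω P 0 + t [1, 0] P * tangent Ω P 1) * outerNormal Ω P 0 +
      t [0] P * arcDeriv Ω (fun Q => outerNormal Ω Q 0) P) +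
    ((t [0, 1] P * tangent Ω P 0 + t [1, 1] P * tangent Ω P 1) * outerNormal Ω P 1 +
      t [1] P * arcDeriv Ω (fun Q => outerNormal Ω Q 1) P)
  nn P := (t [0, 0] P * outerNormal Ω P 0 + t [1, 0] P * outerNormal Ω P 1) * outerNormal Ω P 0 +
    (t [0, 1] P * outerNormal Ω P 0 + t [1, 1] P * outerNormal Ω P 1) * outerNormal Ω P 1

theorem l2Tendsto_normalDeriv_one (hΩ : IsC2Domain Ω) {v : ℕ → Plane → ℝ}
    {t : List (Fin 2) → Plane → ℝ} (hv : ∀ j, ContDiff ℝ ∞ (v j))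
    (h : ∀ i, L2Tendsto (arcMeasure Ω) (fun j => iterPartial [i] (v j)) (t [i])) :
    L2Tendsto (arcMeasure Ω)
      (fun j P => iteratedDeriv 1 (fun z : ℝ => v j (P + z • outerNormal Ω P)) 0)
      (frameBoundaryFunctions Ω t).n := by
  simp only [iteratedDeriv_one_line (hv _)]
  exact ((h 0).mul_continuousOn hΩ (hΩ.continuousOn_outerNormal 0)).add
    ((h 1).mul_continuousOn hΩ (hΩ.continuousOn_outerNormal 1))

theorem l2Tendsto_normalDeriv_two (hΩ : IsC2Domain Ω) {v : ℕ → Plane → ℝ}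
    {t : List (Fin 2) → Plane → ℝ} (hv : ∀ j, ContDiff ℝ ∞ (v j))
    (h : ∀ i k, L2Tendsto (arcMeasure Ω) (fun j => iterPartial [i, k] (v j)) (t [i, k])) :
    L2Tendsto (arcMeasure Ω)
      (fun j P => iteratedDeriv 2 (fun z : ℝ => v j (P + z • outerNormal Ω P)) 0)
      (frameBoundaryFunctions Ω t).nn := by
  simp only [iteratedDeriv_two_line (hv _)]
  have c := hΩ.continuousOn_outerNormal
  exact ((((h 0 0).mul_continuousOn hΩ (c 0)).add
    ((h 1 0).mul_continuousOn hΩ (c 1))).mul_continuousOn hΩ (c 0)).add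
    ((((h 0 1).mul_continuousOn hΩ (c 0)).add
      ((h 1 1).mul_continuousOn hΩ (c 1))).mul_continuousOn hΩ (c 1))

theorem HasArcDerivAt.const {f : Plane → ℝ} {d : ℝ} {P : Plane} (h : HasArcDerivAt Ω f d P)
    (r : ℝ) : HasArcDerivAt Ω (fun _ => r) 0 P :=
  ⟨h.1, fun _ _ _ _ _ _ => hasDerivAt_const _ _⟩

/-- The functions computed from the traces are the boundary values. -/
theorem isBoundaryDerivatives_frameBoundaryFunctions (hΩ : IsC2Domain Ω) {v : ℕ → Plane → ℝ}
    {w : Plane → ℝ} (hv : SmoothApprox Ω 3 v w) {t : List (Fin 2) → Plane → ℝ}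
    (ht : ∀ m : List (Fin 2), m.length ≤ 2 →
      (∃ d, HasWeakDeriv Ω m w d ∧ IsTrace Ω d (t m)) ∧
      ∀ k v', m.length < k → SmoothApprox Ω k v' w →
        L2Tendsto (arcMeasure Ω) (fun j => iterPartial m (v' j)) (t m)) :
    IsBoundaryDerivatives Ω w (frameBoundaryFunctions Ω t) := by
  have hL : ∀ m : List (Fin 2), m.length ≤ 2 →
      L2Tendsto (arcMeasure Ω) (fun j => iterPartial m (v j)) (t m) := fun m hm =>
    (ht m hm).2 3 v (by omega) hv
  -- The candidates `s` and `n` are sums of such products, with `c` a component of `τ` or of `n`;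
  -- this produces `ss` and `sn`.
  have w1 : ∀ β, ∀ {c c' : Plane → ℝ}, (∀ P ∈ frontier Ω, HasArcDerivAt Ω c (c' P) P) →
      ContinuousOn c (frontier Ω) → ContinuousOn c' (frontier Ω) →
      HasWeakArcDeriv Ω (fun P => t [β] P * c P)
        (fun P => (t [0, β] P * tangent Ω P 0 + t [1, β] P * tangent Ω P 1) * c P
          + t [β] P * c' P) := by
    intro β c c' hcd hc hc'
    exact hasWeakArcDeriv_mul hΩ (t' := fun α => t [α, β])
      (fun j => contDiff_iterPartial (hv.1 j) [β]) (hL [β] (by simp))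
      (fun α => hL [α, β] (by simp)) hcd hc hc'
  refine ⟨?_, fun β => (ht [β] (by simp)).1, fun α β => (ht [α, β] (by simp)).1, ?_, ?_, ?_, ?_, ?_⟩
  · have h1 := (ht [] (by simp)).2
    exact ⟨(h1 3 v (by simp) hv).memLp_lim, ⟨v, hv.mono (by norm_num)⟩,
      fun v' hv' => (h1 1 v' (by simp) hv').tendsto⟩
  · have := hasWeakArcDeriv_mul hΩ (t' := fun α => t [α]) hv.1 (hL [] (by simp))
      (fun α => hL [α] (by simp)) (c := fun _ => 1) (c' := fun _ => 0)
      (fun P hP => (hΩ.hasArcDerivAt_tangent hP 0).const 1) continuousOn_const continuousOn_const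
    simp only [mul_one, mul_zero, add_zero] at this
    exact this
  · refine ⟨(l2Tendsto_normalDeriv_one hΩ hv.1 fun i => hL [i] (by simp)).memLp_lim,
      ⟨v, hv.mono (by norm_num)⟩, fun v' hv' => ?_⟩
    exact (l2Tendsto_normalDeriv_one hΩ hv'.1 fun i =>
      (ht [i] (by simp)).2 2 v' (by simp) hv').tendsto
  · exact (w1 0 (fun P hP => hΩ.hasArcDerivAt_tangent hP 0) (hΩ.continuousOn_tangent 0)
      (hΩ.continuousOn_arcDeriv_tangent 0)).add hΩ
      (w1 1 (fun P hP => hΩ.hasArcDerivAt_tangent hP 1) (hΩ.continuousOn_tangent 1)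
      (hΩ.continuousOn_arcDeriv_tangent 1))
  · exact (w1 0 (fun P hP => hΩ.hasArcDerivAt_outerNormal hP 0) (hΩ.continuousOn_outerNormal 0)
      (hΩ.continuousOn_arcDeriv_outerNormal 0)).add hΩ
      (w1 1 (fun P hP => hΩ.hasArcDerivAt_outerNormal hP 1) (hΩ.continuousOn_outerNormal 1)
      (hΩ.continuousOn_arcDeriv_outerNormal 1))
  · refine ⟨(l2Tendsto_normalDeriv_two hΩ hv.1 fun i k => hL [i, k] (by simp)).memLp_lim,
      ⟨v, hv⟩, fun v' hv' => ?_⟩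
    exact (l2Tendsto_normalDeriv_two hΩ hv'.1 fun i k =>
      (ht [i, k] (by simp)).2 3 v' (by simp) hv').tendsto

theorem IsExtendedValue.l2Tendsto {k : ℕ} {B : (Plane → ℝ) → Plane → ℝ} {u g : Plane → ℝ}
    (h : IsExtendedValue Ω k B u g) {v : ℕ → Plane → ℝ} (hv : SmoothApprox Ω k v u)
    (hB : ∀ j, MemLp (B (v j)) 2 (arcMeasure Ω)) :
    L2Tendsto (arcMeasure Ω) (fun j => B (v j)) g :=
  ⟨hB, h.1, h.2.2 v hv⟩

/-- The boundary values are unique. -/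
theorem IsBoundaryDerivatives.ae_eq (hΩ : IsC2Domain Ω) {v : ℕ → Plane → ℝ} {w : Plane → ℝ}
    (hv : SmoothApprox Ω 3 v w) {J J' : BoundaryFunctions} (h : IsBoundaryDerivatives Ω w J)
    (h' : IsBoundaryDerivatives Ω w J') :
    (∀ β, J.cart β =ᵐ[arcMeasure Ω] J'.cart β) ∧
    (∀ α β, J.cart2 α β =ᵐ[arcMeasure Ω] J'.cart2 α β) ∧
    J.s =ᵐ[arcMeasure Ω] J'.s ∧ J.n =ᵐ[arcMeasure Ω] J'.n ∧ J.ss =ᵐ[arcMeasure Ω] J'.ss ∧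
    J.sn =ᵐ[arcMeasure Ω] J'.sn ∧ J.nn =ᵐ[arcMeasure Ω] J'.nn := by
  have hmem : ∀ (l : List (Fin 2)) j, MemLp (iterPartial l (v j)) 2 (arcMeasure Ω) := fun l j =>
    hΩ.memLp_arcMeasure_of_continuous (contDiff_iterPartial (hv.1 j) l).continuous
  have htrace : ∀ {m : List (Fin 2)} {d g : Plane → ℝ}, m.length ≤ 2 → HasWeakDeriv Ω m w d →
      IsTrace Ω d g → L2Tendsto (arcMeasure Ω) (fun j => iterPartial m (v j)) g :=
    fun {m} _ _ hm hd hg => IsExtendedValue.l2Tendsto hg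
      ((hv.mono (show 1 + m.length ≤ 3 by omega)).of_hasWeakDeriv hd) (hmem m)
  have c := hΩ.continuousOn_outerNormal
  have hval : J.val =ᵐ[arcMeasure Ω] J'.val :=
    (IsExtendedValue.l2Tendsto h.val (hv.mono (by norm_num)) (hmem [])).unique
      (IsExtendedValue.l2Tendsto h'.val (hv.mono (by norm_num)) (hmem []))
  have hs := h.s.ae_eq hΩ h'.s hval
  -- An extended value records only norm convergence; these traces serve to show that the normal
  -- derivatives of the approximants are in `L²(∂Ω)`.
  obtain ⟨t, ht⟩ := hv.exists_traces hΩ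
  have hn1 : ∀ j, MemLp (fun P => iteratedDeriv 1
      (fun z : ℝ => v j (P + z • outerNormal Ω P)) 0) 2 (arcMeasure Ω) :=
    (l2Tendsto_normalDeriv_one hΩ hv.1 (t := t) fun i =>
      (ht [i] (by simp)).2 3 v (by simp) hv).memLp
  have hn2 : ∀ j, MemLp (fun P => iteratedDeriv 2
      (fun z : ℝ => v j (P + z • outerNormal Ω P)) 0) 2 (arcMeasure Ω) :=
    (l2Tendsto_normalDeriv_two hΩ hv.1 (t := t) fun i k =>
      (ht [i, k] (by simp)).2 3 v (by simp) hv).memLp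
  have hn : J.n =ᵐ[arcMeasure Ω] J'.n :=
    (IsExtendedValue.l2Tendsto h.n (hv.mono (by norm_num)) hn1).unique
      (IsExtendedValue.l2Tendsto h'.n (hv.mono (by norm_num)) hn1)
  refine ⟨fun β => ?_, fun α β => ?_, hs, hn, h.ss.ae_eq hΩ h'.ss hs, h.sn.ae_eq hΩ h'.sn hn,
    (IsExtendedValue.l2Tendsto h.nn hv hn2).unique (IsExtendedValue.l2Tendsto h'.nn hv hn2)⟩
  · obtain ⟨d, hd, hg⟩ := h.cart β
    obtain ⟨d', hd', hg'⟩ := h'.cart β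
    exact (htrace (by simp) hd hg).unique (htrace (by simp) hd' hg')
  · obtain ⟨d, hd, hg⟩ := h.cart2 α β
    obtain ⟨d', hd', hg'⟩ := h'.cart2 α β
    exact (htrace (by simp) hd hg).unique (htrace (by simp) hd' hg')

/-- The derivative of the unit vector `τ` is orthogonal to it, hence a multiple of its rotation,
with factor the inner product of that rotation with the derivative. -/
theorem IsC2Domain.exists_curvature (hΩ : IsC2Domain Ω) {P : Plane} (hP : P ∈ frontier Ω) :
    ∃ κ : ℝ, arcDeriv Ω (fun Q => tangent Ω Q 0) P = -κ * tangent Ω P 1 ∧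
      arcDeriv Ω (fun Q => tangent Ω Q 1) P = κ * tangent Ω P 0 := by
  have h1 := hΩ.tangent_sq hP
  have h2 := hΩ.tangent_mul_arcDeriv hP
  set p := tangent Ω P 0
  set q := tangent Ω P 1
  set p' := arcDeriv Ω (fun Q => tangent Ω Q 0) P
  set q' := arcDeriv Ω (fun Q => tangent Ω Q 1) P
  refine ⟨p * q' - q * p', ?_, ?_⟩
  · linear_combination (-p') * h1 + p * h2
  · linear_combination (-q') * h1 + q * h2

/-- The change of variables formulas at a boundary point. -/
theorem frameBoundaryFunctions_formulas (hΩ : IsC2Domain Ω) {P : Plane} (hP : P ∈ frontier Ω)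
    {t : List (Fin 2) → Plane → ℝ} (hsymm : t [0, 1] P = t [1, 0] P) :
    (∀ β, (frameBoundaryFunctions Ω t).cart β P =
      (frameBoundaryFunctions Ω t).n P * outerNormal Ω P β +
        (frameBoundaryFunctions Ω t).s P * tangent Ω P β) ∧
    (∀ α β, (frameBoundaryFunctions Ω t).cart2 α β P =
      (frameBoundaryFunctions Ω t).ss P * (tangent Ω P α * tangent Ω P β)
        + (frameBoundaryFunctions Ω t).nn P * (outerNormal Ω P α * outerNormal Ω P β)
        + (frameBoundaryFunctions Ω t).sn P *
          (tangent Ω P α * outerNormal Ω P β + tangent Ω P β * outerNormal Ω P α)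
        + (frameBoundaryFunctions Ω t).s P * (tangent Ω P α * arcDeriv Ω (fun Q => tangent Ω Q β) P
            - outerNormal Ω P α * arcDeriv Ω (fun Q => outerNormal Ω Q β) P)
        + (frameBoundaryFunctions Ω t).n P *
          (tangent Ω P α * arcDeriv Ω (fun Q => outerNormal Ω Q β) P)) := by
  obtain ⟨κ, k0, k1⟩ := hΩ.exists_curvature hP
  have h1 := hΩ.tangent_sq hP
  have m0 := hΩ.arcDeriv_outerNormal_zero hP
  have m1 := hΩ.arcDeriv_outerNormal_one hP
  rw [k1] at m0
  rw [k0] at m1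
  have n0 := outerNormal_zero_eq Ω P
  have n1 := outerNormal_one_eq Ω P
  simp only [Fin.forall_fin_two, frameBoundaryFunctions, n0, n1, m0, m1, k0, k1, hsymm]
  generalize tangent Ω P 0 = p at *
  generalize tangent Ω P 1 = q at *
  -- With `x = p² + q²`, the first-order identities are off by a trace times `x - 1`. In the
  -- second-order ones all curvature terms cancel and `x² - 1 = (x + 1) (x - 1)` remains.
  refine ⟨⟨?_, ?_⟩, ⟨?_, ?_⟩, ?_, ?_⟩
  · linear_combination (-t [0] P) * h1
  · linear_combination (-t [1] P) * h1
  · linear_combination (-t [0, 0] P * (p ^ 2 + q ^ 2 + 1)) * h1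
  · linear_combination (-t [1, 0] P * (p ^ 2 + q ^ 2 + 1)) * h1
  · linear_combination (-t [1, 0] P * (p ^ 2 + q ^ 2 + 1)) * h1
  · linear_combination (-t [1, 1] P * (p ^ 2 + q ^ 2 + 1)) * h1

end BoundaryValues

theorem lemma3p2 (Ω : Set Plane) (hΩ : IsC2Domain Ω) (w : Plane → ℝ) (hw : MemSobolev Ω 3 w) :
    -- the frame is well defined and differentiable in the arclength at every boundary point
    (∀ P ∈ frontier Ω, IsOuterUnitNormal Ω P (outerNormal Ω P) ∧
      ∀ α : Fin 2, HasArcDerivAt Ω (fun Q => outerNormal Ω Q α)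
          (arcDeriv Ω (fun Q => outerNormal Ω Q α) P) P ∧
        HasArcDerivAt Ω (fun Q => tangent Ω Q α)
          (arcDeriv Ω (fun Q => tangent Ω Q α) P) P) ∧
    -- the boundary values of the Cartesian and local derivatives of `w` exist
    (∃ J : BoundaryFunctions, IsBoundaryDerivatives Ω w J) ∧
    -- and they satisfy the change of variables formulas
    ∀ J : BoundaryFunctions, IsBoundaryDerivatives Ω w J →
      (∀ β : Fin 2, ∀ᵐ P ∂(arcMeasure Ω),
        J.cart β P = J.n P * outerNormal Ω P β + J.s P * tangent Ω P β) ∧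
      (∀ α β : Fin 2, ∀ᵐ P ∂(arcMeasure Ω),
        J.cart2 α β P =
          J.ss P * (tangent Ω P α * tangent Ω P β)
          + J.nn P * (outerNormal Ω P α * outerNormal Ω P β)
          + J.sn P * (tangent Ω P α * outerNormal Ω P β + tangent Ω P β * outerNormal Ω P α)
          + J.s P * (tangent Ω P α * arcDeriv Ω (fun Q => tangent Ω Q β) P
              - outerNormal Ω P α * arcDeriv Ω (fun Q => outerNormal Ω Q β) P)
          + J.n P * (tangent Ω P α * arcDeriv Ω (fun Q => outerNormal Ω Q β) P)) ∧
      (∀ α β : Fin 2, ∀ᵐ P ∂(arcMeasure Ω),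
        J.cart2 α β P =
          J.ss P * (tangent Ω P α * tangent Ω P β)
          + J.nn P * (outerNormal Ω P α * outerNormal Ω P β)
          + J.sn P * (tangent Ω P α * outerNormal Ω P β + tangent Ω P β * outerNormal Ω P α)
          + J.s P * (tangent Ω P β * arcDeriv Ω (fun Q => tangent Ω Q α) P
              - outerNormal Ω P β * arcDeriv Ω (fun Q => outerNormal Ω Q α) P)
          + J.n P * (tangent Ω P β * arcDeriv Ω (fun Q => outerNormal Ω Q α) P)) := by
  obtain ⟨v, hv⟩ := hΩ.exists_smoothApprox hw
  obtain ⟨t, ht⟩ := hv.exists_traces hΩ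
  have hJ₀ := isBoundaryDerivatives_frameBoundaryFunctions hΩ hv ht
  -- Both are `L²` limits of the same sequence, by symmetry of second derivatives of smooth
  -- functions.
  have hsymm : t [0, 1] =ᵐ[arcMeasure Ω] t [1, 0] :=
    ((ht [0, 1] (by simp)).2 3 v (by simp) hv).unique
      (((ht [1, 0] (by simp)).2 3 v (by simp) hv).congr_left fun j => by
        rw [iterPartial_single_comm (hv.1 j)])
  refine ⟨fun P hP => ⟨hΩ.isOuterUnitNormal hP, fun α =>
    ⟨hΩ.hasArcDerivAt_outerNormal hP α, hΩ.hasArcDerivAt_tangent hP α⟩⟩, ⟨_, hJ₀⟩, fun J hJ => ?_⟩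
  obtain ⟨hcart, hcart2, hs, hn, hss, hsn, hnn⟩ := hJ.ae_eq hΩ hv hJ₀
  refine ⟨fun β => ?_, fun α β => ?_, fun α β => ?_⟩
  · filter_upwards [ae_mem_frontier Ω, hsymm, hcart β, hn, hs] with P hP h0 h1 h2 h3
    rw [h1, h2, h3]
    exact (frameBoundaryFunctions_formulas hΩ hP h0).1 β
  · filter_upwards [ae_mem_frontier Ω, hsymm, hcart2 α β, hn, hs, hss, hsn, hnn]
      with P hP h0 h1 h2 h3 h4 h5 h6
    rw [h1, h2, h3, h4, h5, h6]
    exact (frameBoundaryFunctions_formulas hΩ hP h0).2 α β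
  · filter_upwards [ae_mem_frontier Ω, hsymm, hcart2 α β, hn, hs, hss, hsn, hnn]
      with P hP h0 h1 h2 h3 h4 h5 h6
    -- The last formula is the previous one with the indices exchanged, once the left side is known
    -- to be symmetric.
    have hswap : (frameBoundaryFunctions Ω t).cart2 α β P =
        (frameBoundaryFunctions Ω t).cart2 β α P := by
      fin_cases α <;> fin_cases β
      · rfl
      · exact h0
      · exact h0.symm
      · rfl
    rw [h1, h2, h3, h4, h5, h6, hswap, (frameBoundaryFunctions_formulas hΩ hP h0).2 β α]
    ring
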